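/- **Setting.** Let $U\subset\mathbb R^4$ be open (a coordinate chart). All fields are smooth on $U$; $g_{ab}$ is a Lorentzian metric of signature $(-,+,+,+)$ with Levi-Civita connection $\nabla$, Christoffel symbols $\Gamma^a{}_{bc}$, contracted symbols $\Gamma^a=g^{bc}\Gamma^a{}_{bc}$, curvature $\nabla_c\nabla_du^a-\nabla_d\nabla_cu^a=R^a{}_{bcd}u^b$, $R_{bd}=R^a{}_{bad}$, $R=g^{ab}R_{ab}$, volume form $\epsilon_{abcd}$ and $\square=g^{ab}\nabla_a\nabla_b$. The unknowns are the components $u$ of $g_{ab},\Xi,s,L_{ab},d_{abcd},\phi,\phi_a,\phi_{ab}$, with $1-\tfrac14\Xi^2\phi^2\neq0$. Put $$T_{ab}=\phi_a\phi_b-\tfrac14g_{ab}\phi_c\phi^c-\tfrac12\phi\,\phi_{ab}+\tfrac12\phi^2L_{ab},$$ $$\begin{aligned}T_{abc}=\big(1-\tfrac14\Xi^2\phi^2\big)^{-1}\big(&\tfrac32\Xi\phi L_{c[b}\phi_{a]}+\tfrac32\Xi\phi_{[b}\phi_{a]c}-\tfrac14\Xi\phi^2d_{abcd}\nabla^d\Xi-\tfrac14\Xi^2\phi\,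 d_{abcd}\phi^d+\tfrac12\Xi\phi g_{c[b}L_{a]d}\phi^d\\&+\tfrac12\Xi g_{c[a}\phi_{b]d}\phi^d+g_{c[b}T_{a]d}\nabla^d\Xi+3T_{c[b}\nabla_{a]}\Xi\big),\end{aligned}$$ and ${}^*T_{abc}=\tfrac12\epsilon_{ab}{}^{de}T_{dec}$. Let $\mathcal R$ (conformal gauge source function) and $\mathcal F^a$ (coordinate gauge source functions) be prescribed smooth functions on $U$. The reduced Ricci operator is $\mathscr R_{ab}=R_{ab}-g_{c(a}\nabla_{b)}\Gamma^c+g_{c(a}\nabla_{b)}\mathcal F^c$, and the reduced wave operator $\blacksquare$ on a covariant tensor is $$\blacksquare T_{a\cdots b}=\square T_{a\cdots b}+\big(2L_{ca}+\tfrac16\mathcal Rg_{ca}-R_{ca}-g_{ec}\nabla_a(\mathcal F^e-\Gamma^e)\big)T^c{}_{\cdots b}+\cdots+\big(2L_{cb}+\tfrac16\mathcal Rg_{cb}-R_{cb}-g_{ec}\nabla_b(\mathcal F^e-\Gamma^e)\big)T_{a\cdots}{}^c ,$$ with $\blacksquare=\square$ on scalars; here $\nabla_a\Gamma^c$ means $\partial_a\Gamma^c+\Gamma^c{}_{ab}\Gamma^b$.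 The **reduced system** is $$\begin{aligned} \blacksquare\Xi&=4s-\tfrac16\Xi\mathcal R,\\ \blacksquare s&=-\tfrac16s\mathcal R+\Xi L_{ab}L^{ab}-\tfrac16\nabla_a\mathcal R\nabla^a\Xi+\tfrac14\Xi^5T_{ab}T^{ab}-\Xi^3L_{ab}T^{ab}+\Xi\nabla^a\Xi\nabla^b\Xi T_{ab},\\ \blacksquare L_{ab}&=-2\Xi d_{acbd}L^{cd}+4L_a{}^cL_{bc}-L_{cd}L^{cd}g_{ab}+\tfrac16\nabla_a\nabla_b\mathcal R+\tfrac12\Xi^3d_{acbd}T^{cd}-\Xi\nabla_cT_a{}^c{}_b-2T_{(a|c|b)}\nabla^c\Xi,\\ \blacksquare d_{abcd}&=-4\Xi d_a{}^f{}_{[c}{}^ed_{d]ebf}-2\Xi d_a{}^f{}_b{}^ed_{cdfe}+\tfrac12d_{abcd}\mathcal R-\Xi^2T_{[a}{}^fd_{b]fcd}-\Xi^2T_{[c}{}^fd_{d]fab}\\&\quad-\Xi^2g_{a[c}d_{d]ebf}T^{fe}+\Xi^2g_{b[c}d_{d]eaf}T^{fe}+2\nabla_{[a}T_{|cd|b]}+\epsilon_{abef}\nabla^f\,{}^*T_{cd}{}^e,\\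 \mathscr R_{ab}&=2L_{ab}+\tfrac16\mathcal Rg_{ab},\\ \blacksquare\phi&=\tfrac16\mathcal R\phi,\\ \blacksquare\phi_a&=2\phi^bL_{ab}+\tfrac13\mathcal R\phi_a+\tfrac16\phi\nabla_a\mathcal R,\\ \blacksquare\phi_{ab}&=\tfrac12\phi_{ab}\mathcal R-\tfrac13\mathcal R\phi L_{ab}-2\phi^{cd}L_{cd}g_{ab}-\tfrac16\phi^cg_{ab}\nabla_c\mathcal R+\tfrac16\phi\nabla_{(a}\nabla_{b)}\mathcal R-2\Xi\phi^{cd}d_{(a|c|b)d}+8\phi_{(a}{}^cL_{b)c}\\&\quad+2\Xi\phi^cT_{(a|c|b)}+\tfrac23\phi_{(a}\nabla_{b)}\mathcal R+2\phi^c\nabla_{(a}L_{b)c}-2\phi^cd_{(a|c|b)}{}^d\nabla_d\Xi . \end{aligned}$$ **Proposition.** (i) For all smooth $\mathcal R,\mathcal F^a$ the reduced system is a proper quasilinear system of wave equations in the following sense. Up to a non-zero constant factor in each equation, it has the form $$g^{\sigma\tau}\partial_\sigma\partial_\tau u_i=N_i(x,u,\partial u)+A_i^{\sigma\tau}(x,u,\partial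 u)\,\partial_\sigma\partial_\tau\Xi,$$ one equation for each component $u_i$ of the unknowns, with $N_i,A_i^{\sigma\tau}$ smooth wherever $\det g\neq0$ and $1-\tfrac14\Xi^2\phi^2\ne0$, and with $A_i^{\sigma\tau}=0$ except in the equations for $L_{ab}$ and $d_{abcd}$. In particular, no second derivative of the metric enters the equations of the other fields. If, moreover, the second derivatives of $\Xi$ which arise from differentiating $T_{abc}$ and ${}^*T_{abc}$ in the equations for $L_{ab}$ and $d_{abcd}$ are eliminated by means of the conformal field equation $\nabla_a\nabla_b\Xi=-\Xi L_{ab}+sg_{ab}+\tfrac12\Xi^3T_{ab}$, then the system takes, in the same sense, the form $$g^{\sigma\tau}\partial_\sigma\partial_\tau u_i=N_i(x,u,\partial u)$$ of a proper quasilinear system of wave equations. (ii) Let $L_{ab}$ and $\phi_{ab}$ be symmetric, let $d_{abcd}$ have the algebraic symmetries of a Weyl tensor (including tracelessness), let $R_{ab}=2L_{ab}+\tfrac16Rg_{ab}$ hold, and let the equations for $\phi,\phi_a,\phi_{ab}$ above hold in their geometric form, that is, with $\square$ and the Ricci scalar $R$ in place of $\blacksquare$ and $\mathcal R$. Put $Q_a=\phi_a-\nabla_a\phi$,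 $Q_{ab}=\phi_{ab}-\nabla_a\nabla_b\phi$, $$\Delta_{abc}=\nabla_aL_{bc}-\nabla_bL_{ac}-\nabla_e\Xi\,d^e{}_{cab}-\Xi T_{abc},\qquad P_{abcd}=R_{abcd}-\Xi d_{abcd}-2(g_{a[c}L_{d]b}-g_{b[c}L_{d]a}).$$ Then these satisfy the wave equations, homogeneous in the zero-quantities $Q_a,Q_{ab},\Delta_{abc},P_{abcd}$, $$\square Q_a=\tfrac13RQ_a+2L_a{}^bQ_b,$$ $$\begin{aligned}\square Q_{ab}=\;&\tfrac12Q_{ab}R-2Q^{cd}L_{cd}g_{ab}-\tfrac16Q^cg_{ab}\nabla_cR+2Q^c\nabla_cL_{ab}-2\Xi Q^{cd}d_{acbd}+8Q_{(a}{}^cL_{b)c}-2\phi^c\Delta_{(a|c|b)}\\&+4\Xi Q^cT_{(a|c|b)}+4Q^c\Delta_{(a|c|b)}+\tfrac23Q_{(a}\nabla_{b)}R-4Q^cd_{(a|c|b)}{}^d\nabla_d\Xi+2P_{acbd}\nabla^c\nabla^d\phi .\end{aligned}$$ In particular, the last term is absent when $P_{abcd}=0$. -/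

import Mathlib

open scoped ContDiff

noncomputable section

namespace ConfWave

/-! ### Tensor calculus in a coordinate chart of a four-dimensional spacetime -/

/-- Values of a coordinate index. -/
abbrev Idx := Fin 4

/-- Points of the coordinate chart. -/
abbrev Pt := Fin 4 → ℝ

/-- The components of a covariant tensor of rank `n` at a point. -/
abbrev Tensor (n : ℕ) := (Fin n → Idx) → ℝ

/-- The coordinate derivative `∂_μ f`. -/
def pd (μ : Idx) (f : Pt → ℝ) (x : Pt) : ℝ := fderiv ℝ f x (Pi.single μ 1)

/-- A scalar field as a tensor field of rank zero. -/
def scal (f : Pt → ℝ) : Pt → Tensor 0 := fun x _ => f x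

/-- Raise the `i`-th index with the contravariant metric `h`. -/
def raise {n : ℕ} (h : Matrix Idx Idx ℝ) (i : Fin n) (T : Tensor n) : Tensor n :=
  fun a => ∑ k, h (a i) k * T (Function.update a i k)

/-- A symmetric bilinear form of signature `(-,+,+,+)`. -/
def IsLorentzian (m : Matrix Idx Idx ℝ) : Prop :=
  m.IsSymm ∧ ∃ p : Matrix Idx Idx ℝ, IsUnit p.det ∧
    p.transpose * m * p = Matrix.diagonal ![-1, 1, 1, 1]

/-- The Levi-Civita symbol. -/
def leviCivita (a b c d : Idx) : ℝ :=
  Matrix.det (Matrix.of fun i j : Idx => if ![a, b, c, d] i = j then (1 : ℝ) else 0)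

/-- The volume form `ε_{abcd}` of the metric `m`. -/
def vol (m : Matrix Idx Idx ℝ) (a b c d : Idx) : ℝ :=
  Real.sqrt |m.det| * leviCivita a b c d

/-- The Hodge dual `*T_{abc} = ½ ε_{ab}{}^{de} T_{dec}`. -/
def dual3 (m : Matrix Idx Idx ℝ) (T : Tensor 3) : Tensor 3 := fun a =>
  1 / 2 * ∑ k, ∑ l, ∑ d, ∑ e,
    vol m (a 0) (a 1) k l * m⁻¹ k d * m⁻¹ l e * T ![d, e, a 2]

section Geometry

variable (G : Pt → Matrix Idx Idx ℝ)

/-- Christoffel symbols `Γ^a{}_{bc}`. -/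
def chr (x : Pt) (a b c : Idx) : ℝ :=
  1 / 2 * ∑ e, (G x)⁻¹ a e *
    (pd b (fun y => G y e c) x + pd c (fun y => G y b e) x - pd e (fun y => G y b c) x)

/-- Riemann tensor `R^a{}_{bcd}`, with `∇_c ∇_d u^a - ∇_d ∇_c u^a = R^a{}_{bcd} u^b`. -/
def riem (x : Pt) (a b c d : Idx) : ℝ :=
  pd c (fun y => chr G y a d b) x - pd d (fun y => chr G y a c b) x
    + ∑ e, (chr G x a c e * chr G x e d b - chr G x a d e * chr G x e c b)

/-- `R_{abcd}`. -/
def riemLow (x : Pt) (a b c d : Idx) : ℝ := ∑ e, G x a e * riem G x e b c d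

/-- Ricci tensor `R_{bd} = R^a{}_{bad}`. -/
def ricci (x : Pt) (b d : Idx) : ℝ := ∑ a, riem G x a b a d

/-- Ricci scalar. -/
def scalarCurv (x : Pt) : ℝ := ∑ a, ∑ b, (G x)⁻¹ a b * ricci G x a b

/-- Levi-Civita covariant derivative of a covariant tensor field; the index of the derivative
comes first: `(∇T)_{e a₁ … aₙ} = ∇_e T_{a₁ … aₙ}`. -/
def covD {n : ℕ} (T : Pt → Tensor n) : Pt → Tensor (n + 1) := fun x a =>
  pd (a 0) (fun y => T y (fun i => a i.succ)) x
    - ∑ i : Fin n, ∑ k, chr G x k (a 0) (a i.succ) *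
        T x (Function.update (fun j : Fin n => a j.succ) i k)

/-- The geometric wave operator `□ = g^{ef} ∇_e ∇_f`. -/
def box {n : ℕ} (T : Pt → Tensor n) : Pt → Tensor n := fun x a =>
  ∑ e, ∑ f, (G x)⁻¹ e f *
    covD G (covD G T) x (Matrix.vecCons e (Matrix.vecCons f a))

/-- Contracted Christoffel symbols `Γ^μ = g^{ab} Γ^μ{}_{ab}`. -/
def contrChr (x : Pt) (μ : Idx) : ℝ := ∑ a, ∑ b, (G x)⁻¹ a b * chr G x μ a b

/-- `∇_ν V^σ = ∂_ν V^σ + Γ^σ{}_{νk} V^k`; for the non-tensorial `Γ^σ` this is the meaning of the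
symbol `∇_ν Γ^σ`. -/
def covDVec (V : Pt → Idx → ℝ) (x : Pt) (ν σ : Idx) : ℝ :=
  pd ν (fun y => V y σ) x + ∑ k, chr G x σ ν k * V x k

/-- The reduced Ricci operator
`R_{μν} - g_{σ(μ} ∇_{ν)} Γ^σ + g_{σ(μ} ∇_{ν)} F^σ` for coordinate gauge source functions `F`. -/
def redRicci (F : Pt → Idx → ℝ) (x : Pt) (μ ν : Idx) : ℝ :=
  ricci G x μ ν
    - 1 / 2 * ∑ σ, (G x σ μ * covDVec G (contrChr G) x ν σ
        + G x σ ν * covDVec G (contrChr G) x μ σ)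
    + 1 / 2 * ∑ σ, (G x σ μ * covDVec G F x ν σ + G x σ ν * covDVec G F x μ σ)

/-- The reduced wave operator `■` on covariant tensor fields of any rank (on scalars it is `□`),
for the field `L_{ab}`, the conformal gauge source function `R` and the coordinate gauge source
functions `F`. -/
def blackBox (L : Pt → Tensor 2) (R : Pt → ℝ) (F : Pt → Idx → ℝ) {n : ℕ}
    (T : Pt → Tensor n) : Pt → Tensor n := fun x a =>
  box G T x a + ∑ i : Fin n, ∑ τ,
    ((2 * L x ![τ, a i] + 1 / 6 * R x * G x τ (a i) - ricci G x τ (a i))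
      - ∑ σ, G x σ τ * (covDVec G F x (a i) σ - covDVec G (contrChr G) x (a i) σ))
      * raise (G x)⁻¹ i (T x) (Function.update a i τ)

end Geometry

/-! ### The unknowns -/

/-- The components of the unknowns `g_{μν}, Ξ, s, L_{μν}, d_{μνρσ}, φ, φ_μ, φ_{μν}`. -/
inductive Comp
  | g (μ ν : Idx)
  | Xi
  | s
  | L (μ ν : Idx)
  | d (μ ν ρ σ : Idx)
  | phi
  | phi1 (μ : Idx)
  | phi2 (μ ν : Idx)
  deriving DecidableEq, Fintype

/-- Values of all the unknowns at a point. -/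
abbrev State := Comp → ℝ

/-- Values of the first coordinate derivatives of all the unknowns at a point. -/
abbrev Jet := Comp → Idx → ℝ

/-- The metric part of a state. -/
def gOf (y : State) : Matrix Idx Idx ℝ := Matrix.of fun μ ν => y (.g μ ν)

/-- The `L_{ab}` part of a state. -/
def LOf (y : State) : Tensor 2 := fun a => y (.L (a 0) (a 1))

/-- The `d_{abcd}` part of a state. -/
def dOf (y : State) : Tensor 4 := fun a => y (.d (a 0) (a 1) (a 2) (a 3))

/-- The `φ_a` part of a state. -/
def phi1Of (y : State) : Tensor 1 := fun a => y (.phi1 (a 0))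

/-- The `φ_{ab}` part of a state. -/
def phi2Of (y : State) : Tensor 2 := fun a => y (.phi2 (a 0) (a 1))

/-- `φ^a`. -/
def phi1Up (y : State) (a : Idx) : ℝ := raise (gOf y)⁻¹ 0 (phi1Of y) ![a]

/-- Raise both indices of a tensor of rank two. -/
def up2 (y : State) (T : Tensor 2) (a b : Idx) : ℝ :=
  raise (gOf y)⁻¹ 0 (raise (gOf y)⁻¹ 1 T) ![a, b]

/-- Mixed components `T_a{}^b` of a tensor of rank two. -/
def mix2 (y : State) (T : Tensor 2) (a b : Idx) : ℝ := raise (gOf y)⁻¹ 1 T ![a, b]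

/-- `v^a` for a covector `v`. -/
def upV (y : State) (v : Idx → ℝ) (a : Idx) : ℝ := ∑ k, (gOf y)⁻¹ a k * v k

/-! ### The matter model -/

/-- The energy-momentum tensor of the conformally invariant scalar field in terms of the auxiliary
fields: `T_{ab} = φ_a φ_b - ¼ g_{ab} φ_c φ^c - ½ φ φ_{ab} + ½ φ² L_{ab}`. -/
def emT (y : State) : Tensor 2 := fun a =>
  phi1Of y ![a 0] * phi1Of y ![a 1]
    - 1 / 4 * gOf y (a 0) (a 1) * (∑ c, phi1Of y ![c] * phi1Up y c)
    - 1 / 2 * y .phi * phi2Of y a + 1 / 2 * y .phi ^ 2 * LOf y a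

/-- The rescaled Cotton tensor `T_{abc}` of the conformally invariant scalar field in terms of the
auxiliary fields; the covector `v` stands for `∇_a Ξ`. -/
def cotton (y : State) (v : Idx → ℝ) : Tensor 3 := fun i =>
  let a := i 0
  let b := i 1
  let c := i 2
  let g := gOf y
  let L := LOf y
  let T := emT y
  let p := phi1Of y
  let q := phi2Of y
  let d := dOf y
  let Ξ := y .Xi
  let φ := y .phi
  (1 - 1 / 4 * Ξ ^ 2 * φ ^ 2)⁻¹ *
    (3 / 2 * Ξ * φ * (1 / 2 * (L ![c, b] * p ![a] - L ![c, a] * p ![b]))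
      + 3 / 2 * Ξ * (1 / 2 * (p ![b] * q ![a, c] - p ![a] * q ![b, c]))
      - 1 / 4 * Ξ * φ ^ 2 * (∑ k, d ![a, b, c, k] * upV y v k)
      - 1 / 4 * Ξ ^ 2 * φ * (∑ k, d ![a, b, c, k] * phi1Up y k)
      + 1 / 2 * Ξ * φ * (∑ k, 1 / 2 * (g c b * L ![a, k] - g c a * L ![b, k]) * phi1Up y k)
      + 1 / 2 * Ξ * (∑ k, 1 / 2 * (g c a * q ![b, k] - g c b * q ![a, k]) * phi1Up y k)
      + (∑ k, 1 / 2 * (g c b * T ![a, k] - g c a * T ![b, k]) * upV y v k)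
      + 3 * (1 / 2 * (T ![c, b] * v a - T ![c, a] * v b)))

/-- The part `K_{abc}{}^d v_d` of the rescaled Cotton tensor which is linear in `v_d = ∇_d Ξ`. -/
def cottonLin (y : State) (v : Idx → ℝ) : Tensor 3 := fun i => cotton y v i - cotton y 0 i

section Fields

variable (u : Pt → State)

/-- The metric field. -/
def metric : Pt → Matrix Idx Idx ℝ := fun x => gOf (u x)

/-- `∇_a Ξ`. -/
def dXi (x : Pt) (a : Idx) : ℝ := pd a (fun y => u y .Xi) x

/-- `∇^a Ξ`. -/
def dXiUp (x : Pt) (a : Idx) : ℝ := upV (u x) (dXi u x) a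

/-- The field `L_{ab}`. -/
def LF : Pt → Tensor 2 := fun x => LOf (u x)

/-- The rescaled Cotton tensor as a field. -/
def cottonF : Pt → Tensor 3 := fun x => cotton (u x) (dXi u x)

/-- The Hodge dual of the rescaled Cotton tensor as a field. -/
def dualCottonF : Pt → Tensor 3 := fun x => dual3 (metric u x) (cottonF u x)

/-- Zero-quantity `Υ_{ab} = ∇_a ∇_b Ξ + Ξ L_{ab} - s g_{ab} - ½ Ξ³ T_{ab}`. -/
def Upsilon : Pt → Tensor 2 := fun x a =>
  covD (metric u) (covD (metric u) (scal fun y => u y .Xi)) x a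
    + u x .Xi * LF u x a - u x .s * metric u x (a 0) (a 1)
    - 1 / 2 * u x .Xi ^ 3 * emT (u x) a

/-- `∇_e T_{abc}` as it stands. -/
def dCotton : Pt → Tensor 4 := covD (metric u) (cottonF u)

/-- `∇_e *T_{abc}` as it stands. -/
def dDualCotton : Pt → Tensor 4 := covD (metric u) (dualCottonF u)

/-- `∇_e T_{abc}` with its only second derivatives, `K_{abc}{}^d ∇_e ∇_d Ξ`, eliminated by
the conformal field equation `∇_e ∇_d Ξ = - Ξ L_{ed} + s g_{ed} + ½ Ξ³ T_{ed}`, that is,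
`∇_e T_{abc} - K_{abc}{}^d Υ_{ed}`. -/
def dCottonElim : Pt → Tensor 4 := fun x i =>
  dCotton u x i - cottonLin (u x) (fun k => Upsilon u x ![i 0, k]) (fun j => i j.succ)

/-- The same elimination in `∇_e *T_{abc}`. -/
def dDualCottonElim : Pt → Tensor 4 := fun x i =>
  dDualCotton u x i
    - dual3 (metric u x) (cottonLin (u x) (fun k => Upsilon u x ![i 0, k])) (fun j => i j.succ)

/-! ### Right-hand sides of the wave equations

`R` is the Ricci scalar in the geometric form of the equations, and the conformal gauge source
function in their reduced form. -/

/-- Right-hand side of the equation for `Ξ`. -/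
def rhsXi (R : Pt → ℝ) (x : Pt) : ℝ := 4 * u x .s - 1 / 6 * u x .Xi * R x

/-- Right-hand side of the equation for `s`. -/
def rhsS (R : Pt → ℝ) (x : Pt) : ℝ :=
  let y := u x
  let L := LOf y
  let T := emT y
  let Ξ := y .Xi
  Ξ * (∑ a, ∑ b, L ![a, b] * up2 y L a b) - 1 / 6 * y .s * R x
    - 1 / 6 * (∑ a, pd a R x * dXiUp u x a)
    + 1 / 4 * Ξ ^ 5 * (∑ a, ∑ b, T ![a, b] * up2 y T a b)
    - Ξ ^ 3 * (∑ a, ∑ b, L ![a, b] * up2 y T a b)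
    + Ξ * (∑ a, ∑ b, dXiUp u x a * dXiUp u x b * T ![a, b])

/-- Right-hand side of the equation for `L_{ab}`; `D` stands for `∇_e T_{abc}`. -/
def rhsL (R : Pt → ℝ) (D : Pt → Tensor 4) (x : Pt) : Tensor 2 := fun i =>
  let a := i 0
  let b := i 1
  let y := u x
  let g := gOf y
  let L := LOf y
  let T := emT y
  let d := dOf y
  let C := cottonF u x
  let Ξ := y .Xi
  4 * (∑ c, mix2 y L a c * L ![b, c])
    - 2 * Ξ * (∑ c, ∑ e, d ![a, c, b, e] * up2 y L c e)
    - (∑ c, ∑ e, L ![c, e] * up2 y L c e) * g a b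
    + 1 / 6 * covD (metric u) (covD (metric u) (scal R)) x ![a, b]
    + 1 / 2 * Ξ ^ 3 * (∑ c, ∑ e, d ![a, c, b, e] * up2 y T c e)
    - Ξ * (∑ c, ∑ e, g⁻¹ c e * D x ![c, a, e, b])
    - 2 * (∑ c, 1 / 2 * (C ![a, c, b] + C ![b, c, a]) * dXiUp u x c)

/-- Right-hand side of the equation for `d_{abcd}`; `D` stands for `∇_e T_{abc}` and `S` for
`∇_e *T_{abc}`. -/
def rhsD (R : Pt → ℝ) (D S : Pt → Tensor 4) (x : Pt) : Tensor 4 := fun i =>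
  let a := i 0
  let b := i 1
  let c := i 2
  let d := i 3
  let y := u x
  let g := gOf y
  let T := emT y
  let w := dOf y
  -- `w_p{}^q{}_r{}^t`
  let wM : Idx → Idx → Idx → Idx → ℝ := fun p q r t => raise g⁻¹ 1 (raise g⁻¹ 3 w) ![p, q, r, t]
  let Ξ := y .Xi
  1 / 2 * w ![a, b, c, d] * R x
    - 4 * Ξ * (∑ f, ∑ e, 1 / 2 * (wM a f c e * w ![d, e, b, f] - wM a f d e * w ![c, e, b, f]))
    - 2 * Ξ * (∑ f, ∑ e, wM a f b e * w ![c, d, f, e])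
    - Ξ ^ 2 * (∑ f, 1 / 2 * (mix2 y T a f * w ![b, f, c, d] - mix2 y T b f * w ![a, f, c, d]))
    - Ξ ^ 2 * (∑ f, 1 / 2 * (mix2 y T c f * w ![d, f, a, b] - mix2 y T d f * w ![c, f, a, b]))
    - Ξ ^ 2 * (∑ f, ∑ e, 1 / 2 * (g a c * w ![d, e, b, f] - g a d * w ![c, e, b, f]) * up2 y T f e)
    + Ξ ^ 2 * (∑ f, ∑ e, 1 / 2 * (g b c * w ![d, e, a, f] - g b d * w ![c, e, a, f]) * up2 y T f e)
    + (D x ![a, c, d, b] - D x ![b, c, d, a])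
    + ∑ e, ∑ f, vol g a b e f * raise g⁻¹ 0 (raise g⁻¹ 3 (S x)) ![f, c, d, e]

/-- Right-hand side of the conformally invariant wave equation. -/
def rhsPhi (R : Pt → ℝ) (x : Pt) : ℝ := 1 / 6 * R x * u x .phi

/-- Right-hand side of the equation for `φ_a`. -/
def rhsPhi1 (R : Pt → ℝ) (x : Pt) : Tensor 1 := fun i =>
  2 * (∑ b, phi1Up (u x) b * LOf (u x) ![i 0, b]) + 1 / 3 * R x * phi1Of (u x) i
    + 1 / 6 * u x .phi * pd (i 0) R x

/-- Right-hand side of the equation for `φ_{ab}`. -/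
def rhsPhi2 (R : Pt → ℝ) (x : Pt) : Tensor 2 := fun i =>
  let a := i 0
  let b := i 1
  let y := u x
  let g := gOf y
  let L := LOf y
  let d := dOf y
  let p := phi1Of y
  let q := phi2Of y
  let C := cottonF u x
  let DL := covD (metric u) (LF u) x
  let Ξ := y .Xi
  let φ := y .phi
  1 / 2 * q ![a, b] * R x - 1 / 3 * R x * φ * L ![a, b]
    - 2 * (∑ c, ∑ e, up2 y q c e * L ![c, e]) * g a b
    - 1 / 6 * g a b * (∑ c, phi1Up y c * pd c R x)
    + 1 / 6 * φ * (1 / 2 * (covD (metric u) (covD (metric u) (scal R)) x ![a, b]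
        + covD (metric u) (covD (metric u) (scal R)) x ![b, a]))
    - 2 * Ξ * (∑ c, ∑ e, up2 y q c e * (1 / 2 * (d ![a, c, b, e] + d ![b, c, a, e])))
    + 8 * (1 / 2 * ∑ c, (mix2 y q a c * L ![b, c] + mix2 y q b c * L ![a, c]))
    + 2 * Ξ * (∑ c, phi1Up y c * (1 / 2 * (C ![a, c, b] + C ![b, c, a])))
    + 2 / 3 * (1 / 2 * (p ![a] * pd b R x + p ![b] * pd a R x))
    + 2 * (∑ c, phi1Up y c * (1 / 2 * (DL ![a, b, c] + DL ![b, a, c])))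
    - 2 * (∑ c, ∑ e, phi1Up y c * (1 / 2 * (d ![a, c, b, e] + d ![b, c, a, e])) * dXiUp u x e)

/-! ### The reduced evolution system -/

/-- Left-hand side minus right-hand side of the reduced evolution equations for the conformally
invariant scalar field, one for each component of the unknowns. `R` and `F` are the gauge source
functions, and `D` and `S` stand for the covariant derivatives of the rescaled Cotton tensor and of
its dual. -/
def reducedEqs (R : Pt → ℝ) (F : Pt → Idx → ℝ) (D S : Pt → Tensor 4) (x : Pt) : Comp → ℝ
  | .g μ ν => redRicci (metric u) F x μ ν
      - (2 * LF u x ![μ, ν] + 1 / 6 * R x * metric u x μ ν)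
  | .Xi => blackBox (metric u) (LF u) R F (scal fun y => u y .Xi) x ![] - rhsXi u R x
  | .s => blackBox (metric u) (LF u) R F (scal fun y => u y .s) x ![] - rhsS u R x
  | .L μ ν => blackBox (metric u) (LF u) R F (LF u) x ![μ, ν] - rhsL u R D x ![μ, ν]
  | .d μ ν ρ σ => blackBox (metric u) (LF u) R F (fun y => dOf (u y)) x ![μ, ν, ρ, σ]
      - rhsD u R D S x ![μ, ν, ρ, σ]
  | .phi => blackBox (metric u) (LF u) R F (scal fun y => u y .phi) x ![] - rhsPhi u R x
  | .phi1 μ => blackBox (metric u) (LF u) R F (fun y => phi1Of (u y)) x ![μ]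
      - rhsPhi1 u R x ![μ]
  | .phi2 μ ν => blackBox (metric u) (LF u) R F (fun y => phi2Of (u y)) x ![μ, ν]
      - rhsPhi2 u R x ![μ, ν]

/-- The reduced system, with the derivatives of the Cotton tensor as they stand. -/
def reducedSystem (R : Pt → ℝ) (F : Pt → Idx → ℝ) (u : Pt → State) (x : Pt) : Comp → ℝ :=
  reducedEqs u R F (dCotton u) (dDualCotton u) x

/-- The reduced system, with the second derivatives of `Ξ` in the derivatives of the Cotton tensor
eliminated by the conformal field equation for `∇_a ∇_b Ξ`. -/
def reducedSystemElim (R : Pt → ℝ) (F : Pt → Idx → ℝ) (u : Pt → State) (x : Pt) : Comp → ℝ :=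
  reducedEqs u R F (dCottonElim u) (dDualCottonElim u) x

end Fields

/-- Smooth unknowns on `U` for which the metric is Lorentzian and the expression for the Cotton
tensor is defined. -/
def IsAdmissible (U : Set Pt) (u : Pt → State) : Prop :=
  ContDiffOn ℝ ∞ u U ∧
    ∀ x ∈ U, IsLorentzian (gOf (u x)) ∧ 1 - 1 / 4 * u x .Xi ^ 2 * u x .phi ^ 2 ≠ 0

/-- The open set of states at which the nonlinearities have to be smooth. -/
def regularStates : Set State :=
  {y | (gOf y).det ≠ 0 ∧ 1 - 1 / 4 * y .Xi ^ 2 * y .phi ^ 2 ≠ 0}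

/-- The domain, in the space of triples (point, unknowns, first derivatives), of the
nonlinearities. -/
def jetDomain (U : Set Pt) : Set (Pt × State × Jet) := U ×ˢ (regularStates ×ˢ Set.univ)

/-- The first derivatives of the unknowns. -/
def jet (u : Pt → State) (x : Pt) : Jet := fun i μ => pd μ (fun y => u y i) x

/-- The principal part `g^{στ}(u) ∂_σ ∂_τ u_i`. -/
def principal (u : Pt → State) (x : Pt) (i : Comp) : ℝ :=
  ∑ σ, ∑ τ, (gOf (u x))⁻¹ σ τ * pd σ (pd τ fun y => u y i) x

/-- `E[u] = 0` is a proper quasilinear system of wave equations: up to constant non-zero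
normalisations of the single equations, it is
`g^{στ}(u) ∂_σ ∂_τ u_i = N_i(x, u, ∂u)` with smooth `N_i`; in particular no second derivative
of the metric enters the equations of the other fields. -/
def IsProperQuasilinearWaveSystem (U : Set Pt) (E : (Pt → State) → Pt → Comp → ℝ) : Prop :=
  ∃ (c : Comp → ℝ) (N : Pt × State × Jet → Comp → ℝ),
    (∀ i, c i ≠ 0) ∧ ContDiffOn ℝ ∞ N (jetDomain U) ∧
    ∀ u, IsAdmissible U u → ∀ x ∈ U, ∀ i,
      E u x i = c i * (principal u x i - N (x, u x, jet u x) i)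

/-- As above, except that in the equations for the components in `rows` second derivatives of the
conformal factor `Ξ` may enter linearly, with coefficients depending on `(x, u, ∂u)`. -/
def IsProperQuasilinearUpToHessian (rows : Set Comp) (U : Set Pt)
    (E : (Pt → State) → Pt → Comp → ℝ) : Prop :=
  ∃ (c : Comp → ℝ) (N : Pt × State × Jet → Comp → ℝ)
    (A : Pt × State × Jet → Comp → Idx → Idx → ℝ),
    (∀ i, c i ≠ 0) ∧ ContDiffOn ℝ ∞ N (jetDomain U) ∧ ContDiffOn ℝ ∞ A (jetDomain U) ∧
    (∀ q, ∀ i ∉ rows, A q i = 0) ∧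
    ∀ u, IsAdmissible U u → ∀ x ∈ U, ∀ i,
      E u x i = c i * (principal u x i - N (x, u x, jet u x) i
        - ∑ σ, ∑ τ, A (x, u x, jet u x) i σ τ * pd σ (pd τ fun y => u y .Xi) x)

/-- The components of `L_{ab}` and of `d_{abcd}`. -/
def LdRows : Set Comp := {i | (∃ μ ν, i = .L μ ν) ∨ ∃ μ ν ρ σ, i = .d μ ν ρ σ}

/-! ### Zero-quantities -/

/-- The algebraic symmetries of the Weyl tensor. -/
def IsWeylLike (m : Matrix Idx Idx ℝ) (d : Tensor 4) : Prop :=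
  (∀ a b c e, d ![a, b, c, e] = - d ![b, a, c, e]) ∧
  (∀ a b c e, d ![a, b, c, e] = - d ![a, b, e, c]) ∧
  (∀ a b c e, d ![a, b, c, e] = d ![c, e, a, b]) ∧
  (∀ a b c e, d ![a, b, c, e] + d ![a, c, e, b] + d ![a, e, b, c] = 0) ∧
  (∀ b e, ∑ a, ∑ c, m⁻¹ a c * d ![a, b, c, e] = 0)

/-- The fields `L_{ab}`, `φ_{ab}`, `d_{abcd}` have their index symmetries on `U`. -/
def HasFieldSymmetries (U : Set Pt) (u : Pt → State) : Prop :=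
  ∀ x ∈ U, (∀ a b, LOf (u x) ![a, b] = LOf (u x) ![b, a]) ∧
    (∀ a b, phi2Of (u x) ![a, b] = phi2Of (u x) ![b, a]) ∧ IsWeylLike (gOf (u x)) (dOf (u x))

section ZeroQuantities

variable (u : Pt → State)

/-- `Q_a = φ_a - ∇_a φ`. -/
def Q1 : Pt → Tensor 1 := fun x i =>
  phi1Of (u x) i - covD (metric u) (scal fun y => u y .phi) x i

/-- `Q_{ab} = φ_{ab} - ∇_a ∇_b φ`. -/
def Q2 : Pt → Tensor 2 := fun x i =>
  phi2Of (u x) i - covD (metric u) (covD (metric u) (scal fun y => u y .phi)) x i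

/-- `Δ_{abc} = ∇_a L_{bc} - ∇_b L_{ac} - ∇_e Ξ d^e{}_{cab} - Ξ T_{abc}`. -/
def Delta : Pt → Tensor 3 := fun x i =>
  covD (metric u) (LF u) x ![i 0, i 1, i 2] - covD (metric u) (LF u) x ![i 1, i 0, i 2]
    - (∑ e, dXiUp u x e * dOf (u x) ![e, i 2, i 0, i 1]) - u x .Xi * cottonF u x i

/-- `P_{abcd} = R_{abcd} - Ξ d_{abcd} - 2 (g_{a[c} L_{d]b} - g_{b[c} L_{d]a})`. -/
def PZero : Pt → Tensor 4 := fun x i =>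
  let g := metric u x
  let L := LF u x
  riemLow (metric u) x (i 0) (i 1) (i 2) (i 3) - u x .Xi * dOf (u x) i
    - ((g (i 0) (i 2) * L ![i 3, i 1] - g (i 0) (i 3) * L ![i 2, i 1])
      - (g (i 1) (i 2) * L ![i 3, i 0] - g (i 1) (i 3) * L ![i 2, i 0]))

/-- The homogeneous right-hand side `⅓ R Q_a + 2 L_a{}^b Q_b`. -/
def rhsQ1 (R : Pt → ℝ) (x : Pt) : Tensor 1 := fun i =>
  1 / 3 * R x * Q1 u x i + 2 * ∑ b, mix2 (u x) (LOf (u x)) (i 0) b * Q1 u x ![b]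

/-- The right-hand side, homogeneous in `Q_a`, `Q_{ab}` and `Δ_{abc}`, of the wave equation for
`Q_{ab}`. -/
def rhsQ2 (R : Pt → ℝ) (x : Pt) : Tensor 2 := fun i =>
  let a := i 0
  let b := i 1
  let y := u x
  let g := gOf y
  let L := LOf y
  let d := dOf y
  let Q := Q2 u x
  let Qv : Idx → ℝ := fun c => Q1 u x ![c]
  let Qu : Idx → ℝ := upV y Qv
  let C := cottonF u x
  let Δ := Delta u x
  let DL := covD (metric u) (LF u) x
  let Ξ := y .Xi
  1 / 2 * Q ![a, b] * R x - 2 * (∑ c, ∑ e, up2 y Q c e * L ![c, e]) * g a b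
    - 1 / 6 * g a b * (∑ c, Qu c * pd c R x)
    + 2 * (∑ c, Qu c * DL ![c, a, b])
    - 2 * Ξ * (∑ c, ∑ e, up2 y Q c e * d ![a, c, b, e])
    + 8 * (1 / 2 * ∑ c, (mix2 y Q a c * L ![b, c] + mix2 y Q b c * L ![a, c]))
    - 2 * (∑ c, phi1Up y c * (1 / 2 * (Δ ![a, c, b] + Δ ![b, c, a])))
    + 4 * Ξ * (∑ c, Qu c * (1 / 2 * (C ![a, c, b] + C ![b, c, a])))
    + 4 * (∑ c, Qu c * (1 / 2 * (Δ ![a, c, b] + Δ ![b, c, a])))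
    + 2 / 3 * (1 / 2 * (Qv a * pd b R x + Qv b * pd a R x))
    - 4 * (∑ c, ∑ e, Qu c * (1 / 2 * (d ![a, c, b, e] + d ![b, c, a, e])) * dXiUp u x e)

/-- The term `2 P_{acbd} ∇^c ∇^d φ`, which vanishes if `P_{abcd} = 0`. -/
def termP (x : Pt) : Tensor 2 := fun i =>
  2 * ∑ c, ∑ e, PZero u x ![i 0, c, i 1, e] *
    up2 (u x) (covD (metric u) (covD (metric u) (scal fun y => u y .phi)) x) c e

/-- The unphysical Einstein equation `R_{ab} = 2 L_{ab} + (1/6) R g_{ab}` on `U`. -/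
def UnphysicalEinstein (U : Set Pt) : Prop :=
  ∀ x ∈ U, ∀ a b, ricci (metric u) x a b
    = 2 * LF u x ![a, b] + 1 / 6 * scalarCurv (metric u) x * metric u x a b

/-- The conformally invariant wave equation and the auxiliary system for `φ_a` and `φ_{ab}`, in
geometric form, on `U`. -/
def SolvesScalarWaveEqs (U : Set Pt) : Prop :=
  ∀ x ∈ U,
    box (metric u) (scal fun y => u y .phi) x ![] = rhsPhi u (scalarCurv (metric u)) x ∧
    (∀ a, box (metric u) (fun y => phi1Of (u y)) x ![a]
      = rhsPhi1 u (scalarCurv (metric u)) x ![a]) ∧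
    (∀ a b, box (metric u) (fun y => phi2Of (u y)) x ![a, b]
      = rhsPhi2 u (scalarCurv (metric u)) x ![a, b])

end ZeroQuantities

end ConfWave

end

open scoped ContDiff

noncomputable section

namespace ConfWave

/-! Part (i) is a count of derivatives. `IsJet` singles out the functionals of the unknowns that are
smooth functions of (x, u, ∂u). They are closed under algebraic operations, so only genuine second
derivatives have to be tracked, and these have two sources. The first is ∂Γ, which occurs in the
Ricci tensor, in ∇Γ^σ, and in □ once for every index of the field. Its top order part is `dchrTop`.
The correction in the reduced wave operator is built so that, index by index, the top order part of
g^{ef}∂_eΓ^k_{fa} is cancelled by that of R_{τa} - g_{στ}∇_aΓ^σ with τ raised (`dchrTop_cancel`,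
`isJet_blackBox_sub`). The same bookkeeping leaves -½ g^{στ}∂_σ∂_τ g_{μν} in the reduced Ricci
operator (`isJet_redRicci_add`). The second source is the derivative of the Cotton tensor. That
tensor is affine in ∇Ξ with coefficients depending on the state alone, so its derivative is K·∂∂Ξ
plus first-order terms. Since Υ equals ∂∂Ξ plus first-order terms, subtracting K·Υ removes the
second derivatives. Part (ii) is a commutator computation. `box_grad` and `box_hessian` commute □
with the gradient and the Hessian of a scalar, using the Ricci identity and the contracted Bianchi
identity. After inserting □φ = Rφ/6 and R_{ab} = 2L_{ab} + R g_{ab}/6, the gradient of φ solves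
exactly the equation imposed on φ_a. The Hessian solves the equation imposed on φ_{ab} up to terms
in Q, Δ and P. Subtraction gives the homogeneous equations, the second by the purely algebraic
`hessian_identity`. The commutators are proved over an arbitrary commutative ℝ-algebra with
commuting derivations, where covariant differentiation is polynomial algebra free of
differentiability conditions. The algebra `smoothFns U` realises this setting, and `Rep` carries the
identities back to functions on the chart. -/

/-! ### Tensor calculus over a commutative algebra with commuting derivations -/

section Algebraic

variable {A : Type*} [CommRing A] [Algebra ℝ A]

/-- `∇_e w_a`. -/
def cov1 (D : Idx → Derivation ℝ A A) (Γ : Idx → Idx → Idx → A) (w : Idx → A) (e a : Idx) : A :=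
  D e (w a) - ∑ k, Γ k e a * w k

/-- `∇_e w_{ab}`. -/
def cov2 (D : Idx → Derivation ℝ A A) (Γ : Idx → Idx → Idx → A) (w : Idx → Idx → A)
    (e a b : Idx) : A :=
  D e (w a b) - ∑ k, Γ k e a * w k b - ∑ k, Γ k e b * w a k

/-- `∇_e w_{abc}`. -/
def cov3 (D : Idx → Derivation ℝ A A) (Γ : Idx → Idx → Idx → A) (w : Idx → Idx → Idx → A)
    (e a b c : Idx) : A :=
  D e (w a b c) - ∑ k, Γ k e a * w k b c - ∑ k, Γ k e b * w a k c - ∑ k, Γ k e c * w a b k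

/-- `∇_e w_{abcd}`. -/
def cov4 (D : Idx → Derivation ℝ A A) (Γ : Idx → Idx → Idx → A) (w : Idx → Idx → Idx → Idx → A)
    (e a b c d : Idx) : A :=
  D e (w a b c d) - ∑ k, Γ k e a * w k b c d - ∑ k, Γ k e b * w a k c d
    - ∑ k, Γ k e c * w a b k d - ∑ k, Γ k e d * w a b c k

/-- The curvature `R^a{}_{bcd}` of the connection `Γ`. -/
def rm (D : Idx → Derivation ℝ A A) (Γ : Idx → Idx → Idx → A) (a b c d : Idx) : A :=
  D c (Γ a d b) - D d (Γ a c b) + ∑ e, (Γ a c e * Γ e d b - Γ a d e * Γ e c b)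

/-- `∇_e R^a{}_{bcd}`. -/
def covRm (D : Idx → Derivation ℝ A A) (Γ : Idx → Idx → Idx → A) (e a b c d : Idx) : A :=
  D e (rm D Γ a b c d) + ∑ k, Γ a e k * rm D Γ k b c d - ∑ k, Γ k e b * rm D Γ a k c d
    - ∑ k, Γ k e c * rm D Γ a b k d - ∑ k, Γ k e d * rm D Γ a b c k

/-- The curvature `R_{abcd}`. -/
def rmLow (D : Idx → Derivation ℝ A A) (Γ : Idx → Idx → Idx → A) (g : Idx → Idx → A)
    (a b c d : Idx) : A := ∑ e, g a e * rm D Γ e b c d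

/-- The Ricci tensor. -/
def ric (D : Idx → Derivation ℝ A A) (Γ : Idx → Idx → Idx → A) (b d : Idx) : A :=
  ∑ a, rm D Γ a b a d

variable {D : Idx → Derivation ℝ A A} {Γ : Idx → Idx → Idx → A} {g h : Idx → Idx → A}

/-- Ricci identity. Second derivatives of `w` cancel because the derivations commute, and the
connection terms on the derivative index cancel because `Γ` is symmetric; only curvature is left. -/
lemma cov2_cov1_sub_swap (hD : ∀ i j f, D i (D j f) = D j (D i f))
    (hΓ : ∀ k i j, Γ k i j = Γ k j i) (w : Idx → A) (c d b : Idx) :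
    cov2 D Γ (cov1 D Γ w) c d b - cov2 D Γ (cov1 D Γ w) d c b = -∑ k, rm D Γ k b c d * w k := by
  simp only [cov2, cov1, rm, Fin.sum_univ_four, map_sub, map_add, Derivation.leibniz, smul_eq_mul,
    hΓ _ d c, hD d c]
  ring

lemma cov3_cov2_sub_swap (hD : ∀ i j f, D i (D j f) = D j (D i f))
    (hΓ : ∀ k i j, Γ k i j = Γ k j i) (w : Idx → Idx → A) (c d a b : Idx) :
    cov3 D Γ (cov2 D Γ w) c d a b - cov3 D Γ (cov2 D Γ w) d c a b
      = -(∑ k, rm D Γ k a c d * w k b) - ∑ k, rm D Γ k b c d * w a k := by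
  simp only [cov3, cov2, rm, Fin.sum_univ_four, map_sub, map_add, Derivation.leibniz, smul_eq_mul,
    hΓ _ d c, hD d c]
  ring

lemma rm_swap (a b c d : Idx) : rm D Γ a b c d = -rm D Γ a b d c := by
  simp only [rm, Fin.sum_univ_four]; ring

lemma rm_cyclic (hΓ : ∀ k i j, Γ k i j = Γ k j i) (a b c d : Idx) :
    rm D Γ a b c d + rm D Γ a c d b + rm D Γ a d b c = 0 := by
  simp only [rm, Fin.sum_univ_four, hΓ _ c b, hΓ _ d b, hΓ _ d c]; ring

/-- Second Bianchi identity. After full expansion the second derivatives of `Γ` cancel in pairs and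
the rest is a polynomial identity; no metric is involved. -/
lemma covRm_cyclic (hD : ∀ i j f, D i (D j f) = D j (D i f))
    (hΓ : ∀ k i j, Γ k i j = Γ k j i) (a b c d e : Idx) :
    covRm D Γ e a b c d + covRm D Γ c a b d e + covRm D Γ d a b e c = 0 := by
  simp only [covRm, rm, Fin.sum_univ_four, map_sub, map_add, Derivation.leibniz, smul_eq_mul,
    hΓ _ d c, hΓ _ e c, hΓ _ e d, hD d c, hD e c, hD e d]
  ring

end Algebraic

/-! ### Metric-compatible connections: contractions and curvature symmetries -/

section Algebraic

variable {A : Type*} [CommRing A] [Algebra ℝ A]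
variable {D : Idx → Derivation ℝ A A} {Γ : Idx → Idx → Idx → A} {g h : Idx → Idx → A}

/-- Differentiating GH = 1 gives H' = -HG'H. Compatibility reads G' = CᵀG + GC, and the products GH
and HG then collapse to 1. -/
lemma deriv_inverse_metric (hgh : ∀ a b, ∑ k, g a k * h k b = if a = b then 1 else 0)
    (cg : ∀ e a b, D e (g a b) = ∑ k, Γ k e a * g k b + ∑ k, Γ k e b * g a k) (e a b : Idx) :
    D e (h a b) = -(∑ k, Γ a e k * h k b) - ∑ k, Γ b e k * h a k := by
  set G : Matrix Idx Idx A := Matrix.of g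
  set H : Matrix Idx Idx A := Matrix.of h
  set C : Matrix Idx Idx A := Matrix.of fun k i => Γ k e i
  set G' : Matrix Idx Idx A := Matrix.of fun i j => D e (g i j)
  set H' : Matrix Idx Idx A := Matrix.of fun i j => D e (h i j)
  have h1 : G * H = 1 := by
    ext i j; simp [Matrix.mul_apply, G, H, hgh, Matrix.one_apply]
  have h2 : H * G = 1 := mul_eq_one_comm.mp h1
  have h3 : G' * H + G * H' = 0 := by
    ext i j
    have := congrArg (D e) (hgh i j)
    rw [map_sum] at this
    have h0 : D e (if i = j then (1 : A) else 0) = 0 := by split_ifs <;> simp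
    rw [h0] at this
    simp only [Matrix.add_apply, Matrix.mul_apply, G, H, G', H', Matrix.of_apply, Matrix.zero_apply,
      ← Finset.sum_add_distrib]
    rw [← this]
    refine Finset.sum_congr rfl fun k _ => ?_
    rw [Derivation.leibniz, smul_eq_mul, smul_eq_mul]; ring
  have h4 : G' = C.transpose * G + G * C := by
    ext i j
    simp only [Matrix.add_apply, Matrix.mul_apply, G, C, G', Matrix.of_apply,
      Matrix.transpose_apply, cg]
    congr 1
    exact Finset.sum_congr rfl fun k _ => mul_comm _ _
  have h5 : H' = -(C * H) - H * C.transpose := by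
    calc H' = (H * G) * H' := by rw [h2, one_mul]
      _ = H * (G' * H + G * H') - H * G' * H := by noncomm_ring
      _ = -(H * C.transpose * (G * H)) - (H * G) * C * H := by rw [h3, h4]; noncomm_ring
      _ = _ := by rw [h1, h2]; noncomm_ring
  have := congrFun (congrFun h5 a) b
  simp only [Matrix.sub_apply, Matrix.neg_apply, Matrix.mul_apply, H, C, H', Matrix.of_apply,
      Matrix.transpose_apply] at this
  rw [this]
  congr 1
  exact Finset.sum_congr rfl fun k _ => mul_comm _ _

/-- Covariant derivative of a contraction with the inverse metric: scalar result. -/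
lemma deriv_contract (ch : ∀ e a b, D e (h a b) = -(∑ k, Γ a e k * h k b) - ∑ k, Γ b e k * h a k)
    (T : Idx → Idx → A) (m : Idx) :
    D m (∑ e, ∑ f, h e f * T e f) = ∑ e, ∑ f, h e f * cov2 D Γ T m e f := by
  simp only [cov2, Fin.sum_univ_four, map_add, Derivation.leibniz, smul_eq_mul, ch]
  ring

/-- With the free index frozen this is the scalar case; the connection term of the free index does
not touch the contracted pair and passes through the sum. -/
lemma cov1_contract (ch : ∀ e a b, D e (h a b) = -(∑ k, Γ a e k * h k b) - ∑ k, Γ b e k * h a k)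
    (T : Idx → Idx → Idx → A) (m a : Idx) :
    cov1 D Γ (fun a => ∑ e, ∑ f, h e f * T e f a) m a = ∑ e, ∑ f, h e f * cov3 D Γ T m e f a := by
  have h1 := deriv_contract ch (fun e f => T e f a) m
  simp only [cov1, h1, cov2, cov3, mul_sub, Finset.sum_sub_distrib, sub_right_inj]
  simp only [Finset.mul_sum]
  rw [Finset.sum_comm]
  refine Finset.sum_congr rfl fun e _ => ?_
  rw [Finset.sum_comm]
  refine Finset.sum_congr rfl fun f _ => Finset.sum_congr rfl fun k _ => ?_
  ring

lemma cov2_contract (ch : ∀ e a b, D e (h a b) = -(∑ k, Γ a e k * h k b) - ∑ k, Γ b e k * h a k)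
    (T : Idx → Idx → Idx → Idx → A) (m a b : Idx) :
    cov2 D Γ (fun a b => ∑ e, ∑ f, h e f * T e f a b) m a b
      = ∑ e, ∑ f, h e f * cov4 D Γ T m e f a b := by
  have h1 := cov1_contract ch (fun e f a => T e f a b) m a
  simp only [cov1] at h1
  simp only [cov2, h1, cov3, cov4, mul_sub, Finset.sum_sub_distrib, sub_right_inj]
  simp only [Finset.mul_sum]
  rw [Finset.sum_comm]
  refine Finset.sum_congr rfl fun e _ => ?_
  rw [Finset.sum_comm]
  refine Finset.sum_congr rfl fun f _ => Finset.sum_congr rfl fun k _ => ?_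
  ring

omit [Algebra ℝ A] in
lemma sum_metric_inverse_mul (hgh : ∀ a b, ∑ k, g a k * h k b = if a = b then 1 else 0)
    (v : Idx → A) (a : Idx) : ∑ k, g a k * (∑ m, h k m * v m) = v a := by
  simp only [Finset.mul_sum, ← mul_assoc]
  rw [Finset.sum_comm]
  simp [← Finset.sum_mul, hgh]

/-- Lowering an index commutes with ∇ because ∇g = 0; this transfers the Bianchi identity to the
fully covariant curvature. -/
lemma cov4_rmLow (cg : ∀ e a b, D e (g a b) = ∑ k, Γ k e a * g k b + ∑ k, Γ k e b * g a k)
    (e a b c d : Idx) :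
    cov4 D Γ (rmLow D Γ g) e a b c d = ∑ k, g a k * covRm D Γ e k b c d := by
  simp only [cov4, rmLow, covRm, Fin.sum_univ_four, map_add, Derivation.leibniz, smul_eq_mul, cg]
  ring

lemma cov4_rmLow_cyclic (hD : ∀ i j f, D i (D j f) = D j (D i f))
    (hΓ : ∀ k i j, Γ k i j = Γ k j i)
    (cg : ∀ e a b, D e (g a b) = ∑ k, Γ k e a * g k b + ∑ k, Γ k e b * g a k)
    (a b c d e : Idx) :
    cov4 D Γ (rmLow D Γ g) e a b c d + cov4 D Γ (rmLow D Γ g) c a b d e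
      + cov4 D Γ (rmLow D Γ g) d a b e c = 0 := by
  simp only [cov4_rmLow cg, ← Finset.sum_add_distrib, ← mul_add,
    covRm_cyclic hD hΓ, mul_zero, Finset.sum_const_zero]

lemma rmLow_swap_right (a b c d : Idx) : rmLow D Γ g a b c d = -rmLow D Γ g a b d c := by
  simp only [rmLow, rm_swap _ _ c d, mul_neg, Finset.sum_neg_distrib]

lemma rmLow_cyclic (hΓ : ∀ k i j, Γ k i j = Γ k j i) (a b c d : Idx) :
    rmLow D Γ g a b c d + rmLow D Γ g a c d b + rmLow D Γ g a d b c = 0 := by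
  simp only [rmLow, ← Finset.sum_add_distrib, ← mul_add, rm_cyclic hΓ, mul_zero,
    Finset.sum_const_zero]

/-- The Ricci identity applied to g itself: ∇g = 0, so the commutator vanishes, and its curvature
side is the symmetrisation in the first pair. -/
lemma rmLow_swap_left (hD : ∀ i j f, D i (D j f) = D j (D i f))
    (hΓ : ∀ k i j, Γ k i j = Γ k j i) (hg : ∀ a b, g a b = g b a)
    (cg : ∀ e a b, D e (g a b) = ∑ k, Γ k e a * g k b + ∑ k, Γ k e b * g a k)
    (a b c d : Idx) : rmLow D Γ g a b c d = -rmLow D Γ g b a c d := by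
  have h0 : cov2 D Γ g = fun _ _ _ => 0 := by
    funext e i j; rw [cov2, cg]; ring
  have := cov3_cov2_sub_swap hD hΓ g c d b a
  rw [h0] at this
  simp only [cov3, map_zero, mul_zero, Finset.sum_const_zero, sub_zero] at this
  have h1 : ∑ k, rm D Γ k b c d * g k a = rmLow D Γ g a b c d :=
    Finset.sum_congr rfl fun k _ => by rw [hg, mul_comm]
  have h2 : ∑ k, rm D Γ k a c d * g b k = rmLow D Γ g b a c d :=
    Finset.sum_congr rfl fun k _ => by rw [mul_comm]
  rw [h1, h2] at this
  linear_combination this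

/-- Pair symmetry of a tensor with the algebraic symmetries of a curvature tensor. -/
lemma rmLow_pair (hD : ∀ i j f, D i (D j f) = D j (D i f))
    (hΓ : ∀ k i j, Γ k i j = Γ k j i) (hg : ∀ a b, g a b = g b a)
    (cg : ∀ e a b, D e (g a b) = ∑ k, Γ k e a * g k b + ∑ k, Γ k e b * g a k)
    (a b c d : Idx) : rmLow D Γ g a b c d = rmLow D Γ g c d a b := by
  -- The argument below yields twice the claim; the factor 2 is cancelled through the real scalar
  -- action.
  have two : ∀ x y : A, 2 * x = 2 * y → x = y := fun x y hxy => by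
    have : (2 : ℝ) • x = (2 : ℝ) • y := by
      rw [two_smul, two_smul, ← two_mul, ← two_mul, hxy]
    exact smul_right_injective _ (by norm_num : (2 : ℝ) ≠ 0) this
  set r := rmLow D Γ g with hr
  have sR : ∀ a b c d, r a b c d = -r a b d c := rmLow_swap_right
  have sL : ∀ a b c d, r a b c d = -r b a c d := rmLow_swap_left hD hΓ hg cg
  have cy : ∀ a b c d, r a b c d + r a c d b + r a d b c = 0 := rmLow_cyclic hΓ
  apply two
  -- Four instances of the first Bianchi identity, brought to common representatives by the two
  -- antisymmetries. In the alternating combination everything but the pair-exchange difference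
  -- drops out.
  have c1 := cy a b c d
  have c2 := cy b c d a
  have c3 := cy c d a b
  have c4 := cy d a b c
  rw [sR a c d b] at c1
  rw [sR b c d a, sL b a c d] at c2
  rw [sL c a b d, sL c b d a, sR b c d a] at c3
  rw [sL d a b c, sL d b c a, sR b d c a, sL d c a b] at c4
  linear_combination c1 - c2 - c3 + c4
end Algebraic

/-! ### Levi-Civita connections: Ricci tensor, contracted Bianchi identity, □ of a gradient -/

section Algebraic

variable {A : Type*} [CommRing A] [Algebra ℝ A]

/-- `Γ` is the Levi-Civita connection of the metric `g` with inverse `h`, with respect to the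
commuting derivations `D`. -/
structure IsLeviCivita (D : Idx → Derivation ℝ A A) (Γ : Idx → Idx → Idx → A)
    (g h : Idx → Idx → A) : Prop where
  comm : ∀ i j f, D i (D j f) = D j (D i f)
  torsionFree : ∀ k i j, Γ k i j = Γ k j i
  symm : ∀ a b, g a b = g b a
  symm_inv : ∀ a b, h a b = h b a
  mul_inv : ∀ a b, ∑ k, g a k * h k b = if a = b then 1 else 0
  compat : ∀ e a b, D e (g a b) = ∑ k, Γ k e a * g k b + ∑ k, Γ k e b * g a k

variable {D : Idx → Derivation ℝ A A} {Γ : Idx → Idx → Idx → A} {g h : Idx → Idx → A}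

namespace IsLeviCivita

variable (H : IsLeviCivita D Γ g h)
include H

lemma compat_inv (e a b : Idx) :
    D e (h a b) = -(∑ k, Γ a e k * h k b) - ∑ k, Γ b e k * h a k :=
  deriv_inverse_metric H.mul_inv H.compat e a b

lemma inv_mul (a b : Idx) : ∑ k, h a k * g k b = if a = b then 1 else 0 := by
  rw [← (by simp only [eq_comm] : (if b = a then (1 : A) else 0) = if a = b then 1 else 0),
    ← H.mul_inv b a]
  exact Finset.sum_congr rfl fun k _ => by rw [H.symm b k, H.symm_inv k a, mul_comm]

lemma raise_rmLow (a b c d : Idx) : ∑ m, h a m * rmLow D Γ g m b c d = rm D Γ a b c d := by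
  have h1 : ∀ v : Idx → A, ∑ m, h a m * ∑ e, g m e * v e = v a := fun v => by
    simp only [Finset.mul_sum, ← mul_assoc]
    rw [Finset.sum_comm]
    simp [← Finset.sum_mul, H.inv_mul]
  exact h1 fun e => rm D Γ e b c d

lemma contract_rmLow (a b : Idx) :
    ∑ e, ∑ f, h e f * rmLow D Γ g f a e b = ric D Γ a b := by
  simp only [H.raise_rmLow]; rfl

lemma contract_rmLow' (a b : Idx) :
    ∑ e, ∑ f, h e f * rmLow D Γ g e a f b = ric D Γ a b := by
  rw [Finset.sum_comm, ← H.contract_rmLow]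
  exact Finset.sum_congr rfl fun e _ => Finset.sum_congr rfl fun f _ => by rw [H.symm_inv]

lemma swap_left (a b c d : Idx) : rmLow D Γ g a b c d = -rmLow D Γ g b a c d :=
  rmLow_swap_left H.comm H.torsionFree H.symm H.compat a b c d

lemma pair (a b c d : Idx) : rmLow D Γ g a b c d = rmLow D Γ g c d a b :=
  rmLow_pair H.comm H.torsionFree H.symm H.compat a b c d

lemma ric_symm (a b : Idx) : ric D Γ a b = ric D Γ b a := by
  rw [← H.contract_rmLow, ← H.contract_rmLow']
  exact Finset.sum_congr rfl fun e _ => Finset.sum_congr rfl fun f _ => by rw [H.pair]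

/-- Antisymmetry in the first pair moves the traced index to the front, where the trace is the Ricci
tensor; this is the origin of the sign. -/
lemma contract_rm (k a : Idx) :
    ∑ e, ∑ f, h e f * rm D Γ k f e a = -∑ m, h k m * ric D Γ m a := by
  have h1 : ∀ e f, rm D Γ k f e a = -∑ m, h k m * rmLow D Γ g f m e a := fun e f => by
    rw [← H.raise_rmLow, ← Finset.sum_neg_distrib]
    exact Finset.sum_congr rfl fun m _ => by rw [H.swap_left]; ring
  simp only [h1, mul_neg, Finset.sum_neg_distrib, neg_inj, ← H.contract_rmLow, Finset.mul_sum]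
  rw [Finset.sum_congr rfl fun e _ => Finset.sum_comm, Finset.sum_comm]
  exact Finset.sum_congr rfl fun e _ => Finset.sum_congr rfl fun f _ =>
    Finset.sum_congr rfl fun k _ => by ring

/-- The contracted second Bianchi identity `∇^f R_{famb} = ∇_m R_{ab} - ∇_b R_{am}`. -/
lemma div_rmLow (a m b : Idx) :
    ∑ e, ∑ f, h e f * cov4 D Γ (rmLow D Γ g) e f a m b
      = cov2 D Γ (ric D Γ) m a b - cov2 D Γ (ric D Γ) b a m := by
  -- Traces commute with ∇, so ∇Ric is a trace of ∇Riem. The claim then follows from the second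
  -- Bianchi identity term by term in `e`, `f`.
  have h1 : ∀ m a b, cov2 D Γ (ric D Γ) m a b
      = ∑ e, ∑ f, h e f * cov4 D Γ (rmLow D Γ g) m f a e b := fun m a b => by
    have h2 := cov2_contract H.compat_inv (fun e f a b => rmLow D Γ g f a e b) m a b
    have h3 : (fun a b => ∑ e, ∑ f, h e f * rmLow D Γ g f a e b) = ric D Γ := by
      funext a b; exact H.contract_rmLow a b
    rw [h3] at h2
    rw [h2]
    refine Finset.sum_congr rfl fun e _ => Finset.sum_congr rfl fun f _ => ?_
    simp only [cov4]; ring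
  have h4 : ∀ f c d : Idx,
      cov4 D Γ (rmLow D Γ g) m f a c d = -cov4 D Γ (rmLow D Γ g) m f a d c := fun f c d => by
    have h5 : rmLow D Γ g = fun a b c d => -rmLow D Γ g a b d c := by
      funext a b c d; exact rmLow_swap_right a b c d
    refine (congrArg (fun W => cov4 D Γ W m f a c d) h5).trans ?_
    simp only [cov4, map_neg, mul_neg, Finset.sum_neg_distrib]
    ring
  rw [h1, h1, ← sub_eq_zero]
  simp only [← Finset.sum_sub_distrib, ← mul_sub]
  refine Finset.sum_eq_zero fun e _ => Finset.sum_eq_zero fun f _ => ?_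
  have := cov4_rmLow_cyclic H.comm H.torsionFree H.compat f a m b e
  rw [h4 f e b]
  linear_combination h e f * this

/-- `□ ∇_b φ = ∇_b □ φ + R_{bd} ∇^d φ`. -/
lemma box_grad (φ : A) (b : Idx) :
    ∑ e, ∑ f, h e f * cov2 D Γ (cov1 D Γ fun a => D a φ) e f b
      = D b (∑ e, ∑ f, h e f * cov1 D Γ (fun a => D a φ) e f)
        + ∑ d, ric D Γ b d * ∑ k, h d k * D k φ := by
  set ψ : Idx → A := fun a => D a φ
  have hs : ∀ a b, cov1 D Γ ψ a b = cov1 D Γ ψ b a := fun a b => by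
    simp only [cov1, ψ, H.comm a b, H.torsionFree _ a b]
  -- Symmetry of the Hessian puts `b` into a derivative slot, from which the Ricci identity can pull
  -- it outermost and free the trace over `e`, `f`.
  have hs2 : ∀ e f b, cov2 D Γ (cov1 D Γ ψ) e f b = cov2 D Γ (cov1 D Γ ψ) e b f := fun e f b => by
    have h5 : cov1 D Γ ψ = fun a b => cov1 D Γ ψ b a := by funext a b; exact hs a b
    refine (congrArg (fun W => cov2 D Γ W e f b) h5).trans ?_
    simp only [cov2]; ring
  have h1 : ∀ e f, cov2 D Γ (cov1 D Γ ψ) e f b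
      = cov2 D Γ (cov1 D Γ ψ) b e f - ∑ k, rm D Γ k f e b * ψ k := fun e f => by
    have := cov2_cov1_sub_swap H.comm H.torsionFree ψ e b f
    rw [hs2]; linear_combination this
  simp only [h1, mul_sub, Finset.sum_sub_distrib, deriv_contract H.compat_inv]
  rw [sub_eq_add_neg]
  congr 1
  have h2 : ∑ e, ∑ f, h e f * ∑ k, rm D Γ k f e b * ψ k
      = ∑ k, (∑ e, ∑ f, h e f * rm D Γ k f e b) * ψ k := by
    simp only [Finset.mul_sum, Finset.sum_mul, ← mul_assoc]
    rw [Finset.sum_congr rfl fun e _ => Finset.sum_comm, Finset.sum_comm]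
  rw [h2]
  simp only [H.contract_rm, neg_mul, Finset.sum_neg_distrib, neg_neg, Finset.sum_mul,
    Finset.mul_sum]
  rw [Finset.sum_comm]
  exact Finset.sum_congr rfl fun e _ => Finset.sum_congr rfl fun f _ => by
    rw [H.ric_symm b e, H.symm_inv e f]; ring

end IsLeviCivita
end Algebraic

/-! ### □ of the Hessian of a scalar -/

section Algebraic

variable {A : Type*} [CommRing A] [Algebra ℝ A]
variable {D : Idx → Derivation ℝ A A} {Γ : Idx → Idx → Idx → A} {g h : Idx → Idx → A}

namespace IsLeviCivita

variable (H : IsLeviCivita D Γ g h)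
include H

lemma deriv_raise (w : Idx → A) (e d : Idx) :
    D e (∑ k, h d k * w k)
      = ∑ k, h d k * cov1 D Γ w e k - ∑ m, Γ d e m * ∑ k, h m k * w k := by
  simp only [cov1, Fin.sum_univ_four, map_add, Derivation.leibniz, smul_eq_mul, H.compat_inv]
  ring

/-- Leibniz rule for a contraction: the connection term on the raised index of `w` cancels the one
on the contracted lower index of `T`. -/
lemma cov1_contract_raise (T : Idx → Idx → A) (w : Idx → A) (a b : Idx) :
    cov1 D Γ (fun b => ∑ d, T b d * ∑ k, h d k * w k) a b
      = ∑ d, cov2 D Γ T a b d * (∑ k, h d k * w k)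
        + ∑ d, T b d * ∑ k, h d k * cov1 D Γ w a k := by
  have hD := H.deriv_raise w a
  generalize hW : (fun d => ∑ k, h d k * w k) = W
  have hW' : ∀ d, ∑ k, h d k * w k = W d := fun d => congrFun hW d
  have hV : ∀ d, ∑ k, h d k * cov1 D Γ w a k = D a (W d) + ∑ m, Γ d a m * W m := fun d => by
    simp only [← hW', hD]; ring
  simp only [hW', hV]
  simp only [cov1, cov2, map_add, Derivation.leibniz, smul_eq_mul, Fin.sum_univ_four]
  ring

lemma cov3_contract_raise (T : Idx → Idx → Idx → Idx → A) (w : Idx → A) (e b f a : Idx) :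
    cov3 D Γ (fun b f a => ∑ m, T m b f a * ∑ k, h m k * w k) e b f a
      = ∑ m, cov4 D Γ T e m b f a * (∑ k, h m k * w k)
        + ∑ m, T m b f a * ∑ k, h m k * cov1 D Γ w e k := by
  have hD := H.deriv_raise w e
  generalize hW : (fun d => ∑ k, h d k * w k) = W
  have hW' : ∀ d, ∑ k, h d k * w k = W d := fun d => congrFun hW d
  have hV : ∀ d, ∑ k, h d k * cov1 D Γ w e k = D e (W d) + ∑ m, Γ d e m * W m := fun d => by
    simp only [← hW', hD]; ring
  simp only [hW', hV]
  simp only [cov3, cov4, map_add, Derivation.leibniz, smul_eq_mul, Fin.sum_univ_four]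
  ring

lemma contract_rm_mul (T : Idx → A) (a : Idx) :
    ∑ e, ∑ f, h e f * ∑ k, rm D Γ k f e a * T k = -∑ c, ric D Γ a c * ∑ k, h c k * T k := by
  have h2 : ∑ e, ∑ f, h e f * ∑ k, rm D Γ k f e a * T k
      = ∑ k, (∑ e, ∑ f, h e f * rm D Γ k f e a) * T k := by
    simp only [Finset.mul_sum, Finset.sum_mul, ← mul_assoc]
    rw [Finset.sum_congr rfl fun e _ => Finset.sum_comm, Finset.sum_comm]
  rw [h2]
  simp only [H.contract_rm, neg_mul, Finset.sum_neg_distrib, Finset.sum_mul, Finset.mul_sum]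
  rw [Finset.sum_comm]
  exact congrArg _ <| Finset.sum_congr rfl fun e _ => Finset.sum_congr rfl fun f _ => by
    rw [H.ric_symm a e, H.symm_inv e f]; ring

/-- The curvature symmetries give R_{mbfa} = R_{afbm}. Together with `contract_rm_raise` this brings
both Riemann terms of `box_hessian` to one shape, which explains the coefficient 2 there. -/
lemma contract_rmLow_raise (T : Idx → Idx → A) (a b : Idx) :
    ∑ e, ∑ f, h e f * ∑ m, rmLow D Γ g m b f a * ∑ k, h m k * T e k
      = ∑ c, ∑ e, rmLow D Γ g a c b e * ∑ k, h c k * ∑ l, h e l * T k l := by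
  have h1 : ∀ m f, rmLow D Γ g m b f a = rmLow D Γ g a f b m := fun m f => by
    rw [H.pair m b f a, rmLow_swap_right, H.swap_left]; ring
  simp only [h1, Finset.mul_sum]
  rw [Finset.sum_comm]
  refine Finset.sum_congr rfl fun c _ => ?_
  rw [Finset.sum_comm]
  refine Finset.sum_congr rfl fun e _ => Finset.sum_congr rfl fun k _ =>
    Finset.sum_congr rfl fun l _ => ?_
  rw [H.symm_inv k c]; ring

lemma contract_rm_raise (T : Idx → Idx → A) (a b : Idx) :
    ∑ e, ∑ f, h e f * ∑ k, rm D Γ k b e a * T f k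
      = ∑ c, ∑ e, rmLow D Γ g a c b e * ∑ k, h c k * ∑ l, h e l * T k l := by
  rw [← H.contract_rmLow_raise, Finset.sum_comm]
  refine Finset.sum_congr rfl fun f _ => Finset.sum_congr rfl fun e _ => ?_
  rw [H.symm_inv]
  congr 1
  simp only [← H.raise_rmLow, Finset.sum_mul, Finset.mul_sum]
  rw [Finset.sum_comm]
  refine Finset.sum_congr rfl fun c _ => Finset.sum_congr rfl fun k _ => ?_
  rw [H.symm_inv k c]; ring

/-- The commutator of `□` with the Hessian of a scalar. -/
lemma box_hessian (φ : A) (a b : Idx) :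
    ∑ e, ∑ f, h e f * cov3 D Γ (cov2 D Γ (cov1 D Γ fun a => D a φ)) e f a b
      = cov1 D Γ (fun b => D b (∑ e, ∑ f, h e f * cov1 D Γ (fun a => D a φ) e f)) a b
        - 2 * ∑ c, ∑ e, rmLow D Γ g a c b e
          * ∑ k, h c k * ∑ l, h e l * cov1 D Γ (fun a => D a φ) k l
        + ∑ c, ric D Γ a c * ∑ k, h c k * cov1 D Γ (fun a => D a φ) b k
        + ∑ c, ric D Γ b c * ∑ k, h c k * cov1 D Γ (fun a => D a φ) a k
        + ∑ c, (cov2 D Γ (ric D Γ) a b c + cov2 D Γ (ric D Γ) b a c - cov2 D Γ (ric D Γ) c a b)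
          * ∑ k, h c k * D k φ := by
  have hgrad := H.box_grad φ
  set ψ : Idx → A := fun a => D a φ with hψ
  set X := cov1 D Γ ψ with hX
  have hs : ∀ a b, X a b = X b a := fun a b => by
    simp only [hX, cov1, ψ, H.comm a b, H.torsionFree _ a b]
  -- The curvature term produced when ∇_f and ∇_a are exchanged in ∇_f∇_a∇_bφ.
  set S : Idx → Idx → Idx → A := fun b f a =>
    ∑ m, rmLow D Γ g m b f a * ∑ k, h m k * ψ k with hS
  have h1 : cov2 D Γ X = fun f a b => cov2 D Γ X a f b - S b f a := by
    funext f a b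
    have := cov2_cov1_sub_swap H.comm H.torsionFree ψ f a b
    have h2 : S b f a = ∑ k, rm D Γ k b f a * ψ k := by
      simp only [hS, ← H.raise_rmLow, Finset.sum_mul, Finset.mul_sum]
      rw [Finset.sum_comm]
      refine Finset.sum_congr rfl fun c _ => Finset.sum_congr rfl fun k _ => ?_
      rw [H.symm_inv k c]; ring
    rw [h2]; linear_combination this
  have h2 : ∀ e f, cov3 D Γ (cov2 D Γ X) e f a b
      = cov3 D Γ (cov2 D Γ X) e a f b - cov3 D Γ S e b f a := fun e f => by
    refine (congrArg (fun W => cov3 D Γ W e f a b) h1).trans ?_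
    simp only [cov3, map_sub, mul_sub, Finset.sum_sub_distrib]
    ring
  -- Next ∇_a is moved past ∇_e. The curvature acting on `f` becomes Ricci after tracing, while that
  -- acting on `b` stays a full Riemann term.
  have h3 : ∀ e f, cov3 D Γ (cov2 D Γ X) e a f b = cov3 D Γ (cov2 D Γ X) a e f b
      - (∑ k, rm D Γ k f e a * X k b) - ∑ k, rm D Γ k b e a * X f k := fun e f => by
    linear_combination cov3_cov2_sub_swap H.comm H.torsionFree X e a f b
  -- With ∇_a outermost the trace inside is □∇_bφ, which `box_grad` evaluates; differentiating its
  -- Ricci term gives both ∇Ric·∇φ and Ric·∇∇φ.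
  have h4 : ∑ e, ∑ f, h e f * cov3 D Γ (cov2 D Γ X) a e f b
      = cov1 D Γ (fun b => D b (∑ e, ∑ f, h e f * X e f)) a b
        + ∑ d, cov2 D Γ (ric D Γ) a b d * (∑ k, h d k * ψ k)
        + ∑ d, ric D Γ b d * ∑ k, h d k * X a k := by
    rw [← cov1_contract H.compat_inv, add_assoc, ← H.cov1_contract_raise]
    simp only [hgrad]
    simp only [cov1, map_add, mul_add, Finset.sum_add_distrib]
    ring
  -- The divergence hits either ∇φ, giving the second Riemann term, or the curvature, where the
  -- contracted Bianchi identity supplies the remaining derivatives of Ricci.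
  have h5 : ∑ e, ∑ f, h e f * cov3 D Γ S e b f a
      = ∑ m, (cov2 D Γ (ric D Γ) m a b - cov2 D Γ (ric D Γ) b a m) * (∑ k, h m k * ψ k)
        + ∑ c, ∑ e, rmLow D Γ g a c b e * ∑ k, h c k * ∑ l, h e l * X k l := by
    simp only [hS, H.cov3_contract_raise, mul_add, Finset.sum_add_distrib]
    rw [H.contract_rmLow_raise]
    congr 1
    generalize (fun m => ∑ k, h m k * ψ k) = W
    have hp : ∀ e m f, cov4 D Γ (rmLow D Γ g) e m b f a
        = cov4 D Γ (rmLow D Γ g) e f a m b := fun e m f => by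
      have h5 : rmLow D Γ g = fun a b c d => rmLow D Γ g c d a b := by
        funext a b c d; exact H.pair a b c d
      refine (congrArg (fun W => cov4 D Γ W e m b f a) h5).trans ?_
      simp only [cov4]; ring
    simp only [← H.div_rmLow, hp]
    simp only [Finset.mul_sum, Finset.sum_mul, ← mul_assoc]
    rw [Finset.sum_congr rfl fun e _ => Finset.sum_comm, Finset.sum_comm]
    exact Finset.sum_congr rfl fun e _ => (Finset.sum_congr rfl fun e _ => Finset.sum_comm).trans Finset.sum_comm
  simp only [h2, h3, mul_sub, Finset.sum_sub_distrib, h4, h5, H.contract_rm_mul (fun k => X k b),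
    H.contract_rm_raise]
  simp only [hs _ b, sub_mul, add_mul, Finset.sum_add_distrib, Finset.sum_sub_distrib]
  ring

end IsLeviCivita
end Algebraic

/-! ### Coordinate derivatives -/

lemma pd_congr {U : Set Pt} (hU : IsOpen U) {f f' : Pt → ℝ} (hf : ∀ x ∈ U, f x = f' x) (μ : Idx)
    {x : Pt} (hx : x ∈ U) : pd μ f x = pd μ f' x := by
  have : f =ᶠ[nhds x] f' := Filter.eventuallyEq_of_mem (hU.mem_nhds hx) hf
  rw [pd, pd, this.fderiv_eq]

lemma pd_add {f f' : Pt → ℝ} {x : Pt} (hf : DifferentiableAt ℝ f x)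
    (hf' : DifferentiableAt ℝ f' x) (μ : Idx) :
    pd μ (fun y => f y + f' y) x = pd μ f x + pd μ f' x := by
  simp [pd, fderiv_fun_add hf hf']

lemma pd_sub {f f' : Pt → ℝ} {x : Pt} (hf : DifferentiableAt ℝ f x)
    (hf' : DifferentiableAt ℝ f' x) (μ : Idx) :
    pd μ (fun y => f y - f' y) x = pd μ f x - pd μ f' x := by
  simp [pd, fderiv_fun_sub hf hf']

lemma pd_mul {f f' : Pt → ℝ} {x : Pt} (hf : DifferentiableAt ℝ f x)
    (hf' : DifferentiableAt ℝ f' x) (μ : Idx) :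
    pd μ (fun y => f y * f' y) x = f x * pd μ f' x + f' x * pd μ f x := by
  simp [pd, fderiv_fun_mul hf hf']

lemma pd_const_mul {f : Pt → ℝ} {x : Pt} (hf : DifferentiableAt ℝ f x) (c : ℝ) (μ : Idx) :
    pd μ (fun y => c * f y) x = c * pd μ f x := by
  simp [pd, fderiv_const_mul hf]

lemma pd_sum {ι : Type*} (s : Finset ι) {f : ι → Pt → ℝ} {x : Pt}
    (hf : ∀ i, DifferentiableAt ℝ (f i) x) (μ : Idx) :
    pd μ (fun y => ∑ i ∈ s, f i y) x = ∑ i ∈ s, pd μ (f i) x := by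
  simp [pd, fderiv_fun_sum fun i _ => hf i]

lemma _root_.ContDiffOn.pd {U : Set Pt} (hU : IsOpen U) {f : Pt → ℝ} (hf : ContDiffOn ℝ ∞ f U)
    (μ : Idx) : ContDiffOn ℝ ∞ (pd μ f) U :=
  (hf.fderiv_of_isOpen hU (by simp)).clm_apply contDiffOn_const

lemma differentiableAt_of_contDiffOn {U : Set Pt} (hU : IsOpen U) {f : Pt → ℝ}
    (hf : ContDiffOn ℝ ∞ f U) {x : Pt} (hx : x ∈ U) : DifferentiableAt ℝ f x :=
  (hf.contDiffAt (hU.mem_nhds hx)).differentiableAt (by simp)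

lemma pd_comm {U : Set Pt} (hU : IsOpen U) {f : Pt → ℝ} (hf : ContDiffOn ℝ ∞ f U) (μ ν : Idx)
    {x : Pt} (hx : x ∈ U) : pd μ (pd ν f) x = pd ν (pd μ f) x := by
  have hd : DifferentiableAt ℝ (fderiv ℝ f) x :=
    ((hf.fderiv_of_isOpen hU (m := ∞) (by simp)).contDiffAt (hU.mem_nhds hx)).differentiableAt
      (by simp)
  have h1 : ∀ μ ν, pd μ (pd ν f) x = fderiv ℝ (fderiv ℝ f) x (Pi.single μ 1) (Pi.single ν 1) :=
    fun μ ν => by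
      change fderiv ℝ (fun y => fderiv ℝ f y (Pi.single ν 1)) x (Pi.single μ 1) = _
      rw [fderiv_clm_apply hd (differentiableAt_const _)]
      simp
  have hs : IsSymmSndFDerivAt ℝ f x :=
    (hf.contDiffAt (hU.mem_nhds hx)).isSymmSndFDerivAt
      (by simpa using WithTop.coe_le_coe.2 (le_top : (2 : ℕ∞) ≤ ⊤))
  rw [h1, h1, hs]

/-! ### The algebra of smooth functions on an open set -/

/-- The algebra of smooth functions on `U`. -/
def smoothFns (U : Set Pt) : Subalgebra ℝ (U → ℝ) where
  carrier := {f | ∃ F : Pt → ℝ, ContDiffOn ℝ ∞ F U ∧ ∀ x : U, f x = F x}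
  mul_mem' := by
    rintro _ _ ⟨F, hF, h⟩ ⟨F', hF', h'⟩
    exact ⟨_, hF.mul hF', fun x => by simp [h, h']⟩
  add_mem' := by
    rintro _ _ ⟨F, hF, h⟩ ⟨F', hF', h'⟩
    exact ⟨_, hF.add hF', fun x => by simp [h, h']⟩
  algebraMap_mem' c := ⟨fun _ => c, contDiffOn_const, fun _ => rfl⟩

namespace smoothFns

variable {U : Set Pt}

/-- `f` is the restriction of `F` to `U`. -/
def Rep (f : smoothFns U) (F : Pt → ℝ) : Prop := ∀ x : U, f.1 x = F x

/-- A smooth extension of an element of `smoothFns U`. -/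
def ext (f : smoothFns U) : Pt → ℝ := f.2.choose

lemma contDiffOn_ext (f : smoothFns U) : ContDiffOn ℝ ∞ (ext f) U := f.2.choose_spec.1

lemma rep_ext (f : smoothFns U) : Rep f (ext f) := f.2.choose_spec.2

/-- The restriction to `U` of a function which is smooth on `U`. -/
def restrict (F : Pt → ℝ) (hF : ContDiffOn ℝ ∞ F U) : smoothFns U := ⟨fun x => F x, F, hF, fun _ => rfl⟩

lemma rep_restrict (F : Pt → ℝ) (hF : ContDiffOn ℝ ∞ F U) : Rep (restrict F hF) F := fun _ => rfl

/-- Values on `U` determine an element of the algebra. Pointwise equations on `U` thereby become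
equations in the algebra, where they may be differentiated; `Rep.eq` is the way back. -/
lemma Rep.unique {f f' : smoothFns U} {F : Pt → ℝ} (h : Rep f F) (h' : Rep f' F) : f = f' :=
  Subtype.ext (funext fun x => (h x).trans (h' x).symm)

lemma Rep.congr {f : smoothFns U} {F F' : Pt → ℝ} (h : Rep f F) (hF : ∀ x ∈ U, F x = F' x) :
    Rep f F' := fun x => (h x).trans (hF x x.2)

lemma Rep.contDiffOn {f : smoothFns U} {F : Pt → ℝ} (h : Rep f F) : ContDiffOn ℝ ∞ F U :=
  (contDiffOn_ext f).congr fun x hx => by rw [← h ⟨x, hx⟩, rep_ext f ⟨x, hx⟩]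

lemma Rep.add {f f' : smoothFns U} {F F' : Pt → ℝ} (h : Rep f F) (h' : Rep f' F') :
    Rep (f + f') fun x => F x + F' x := fun x => by
  simp only [← h x, ← h' x]; rfl

lemma Rep.sub {f f' : smoothFns U} {F F' : Pt → ℝ} (h : Rep f F) (h' : Rep f' F') :
    Rep (f - f') fun x => F x - F' x := fun x => by
  simp only [← h x, ← h' x]; rfl

lemma Rep.mul {f f' : smoothFns U} {F F' : Pt → ℝ} (h : Rep f F) (h' : Rep f' F') :
    Rep (f * f') fun x => F x * F' x := fun x => by
  simp only [← h x, ← h' x]; rfl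

lemma Rep.smul {f : smoothFns U} {F : Pt → ℝ} (h : Rep f F) (c : ℝ) :
    Rep (c • f) fun x => c * F x := fun x => by
  simp only [← h x]; rfl

lemma rep_zero : Rep (0 : smoothFns U) fun _ => 0 := fun _ => rfl

lemma rep_one : Rep (1 : smoothFns U) fun _ => 1 := fun _ => rfl

lemma Rep.sum {ι : Type*} {s : Finset ι} {f : ι → smoothFns U} {F : ι → Pt → ℝ}
    (h : ∀ i, Rep (f i) (F i)) : Rep (∑ i ∈ s, f i) fun x => ∑ i ∈ s, F i x := by
  classical
  induction s using Finset.induction_on with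
  | empty => simpa using rep_zero
  | insert i s hi ih => simpa [Finset.sum_insert hi] using (h i).add ih

/-- The coordinate derivations of the algebra of smooth functions. -/
def pdA (hU : IsOpen U) (μ : Idx) : Derivation ℝ (smoothFns U) (smoothFns U) :=
  Derivation.mk'
    -- The extension is an arbitrary choice. As `U` is open, derivatives at its points see only
    -- values on `U`, so `pd_congr` may replace one extension by another.
    { toFun := fun f => restrict (pd μ (ext f)) ((contDiffOn_ext f).pd hU μ)
      map_add' := fun f f' => Subtype.ext <| funext fun x => by
        refine (pd_congr hU (fun y hy => ?_) μ x.2).trans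
          (pd_add (differentiableAt_of_contDiffOn hU (contDiffOn_ext f) x.2)
            (differentiableAt_of_contDiffOn hU (contDiffOn_ext f') x.2) μ)
        exact ((rep_ext (f + f') ⟨y, hy⟩).symm.trans
          ((rep_ext f).add (rep_ext f') ⟨y, hy⟩))
      map_smul' := fun c f => Subtype.ext <| funext fun x => by
        refine (pd_congr hU (fun y hy => ?_) μ x.2).trans
          (pd_const_mul (differentiableAt_of_contDiffOn hU (contDiffOn_ext f) x.2) c μ)
        exact ((rep_ext (c • f) ⟨y, hy⟩).symm.trans ((rep_ext f).smul c ⟨y, hy⟩)) }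
    fun f f' => Subtype.ext <| funext fun x => by
      refine (pd_congr hU (fun y hy => ?_) μ x.2).trans
        ((pd_mul (differentiableAt_of_contDiffOn hU (contDiffOn_ext f) x.2)
          (differentiableAt_of_contDiffOn hU (contDiffOn_ext f') x.2) μ).trans ?_)
      · exact ((rep_ext (f * f') ⟨y, hy⟩).symm.trans ((rep_ext f).mul (rep_ext f') ⟨y, hy⟩))
      · rw [← rep_ext f x, ← rep_ext f' x]; rfl

lemma Rep.pdA (hU : IsOpen U) {f : smoothFns U} {F : Pt → ℝ} (h : Rep f F) (μ : Idx) :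
    Rep (pdA hU μ f) (pd μ F) := fun x =>
  pd_congr hU (fun y hy => by rw [← rep_ext f ⟨y, hy⟩, h ⟨y, hy⟩]) μ x.2

lemma pdA_comm (hU : IsOpen U) (μ ν : Idx) (f : smoothFns U) :
    pdA hU μ (pdA hU ν f) = pdA hU ν (pdA hU μ f) :=
  (((rep_ext f).pdA hU ν).pdA hU μ).unique
    ((((rep_ext f).pdA hU μ).pdA hU ν).congr fun _ hx =>
      pd_comm hU (contDiffOn_ext f) ν μ hx)

end smoothFns

/-! ### Covariant derivatives of low rank in components -/

section Components

variable (G : Pt → Matrix Idx Idx ℝ)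

lemma update_vec1 {α : Type*} (a k : α) : Function.update ![a] 0 k = ![k] := by
  ext i; fin_cases i; rfl

lemma update_vec2_0 {α : Type*} (a b k : α) : Function.update ![a, b] 0 k = ![k, b] := by
  ext i; fin_cases i <;> rfl

lemma update_vec2_1 {α : Type*} (a b k : α) : Function.update ![a, b] 1 k = ![a, k] := by
  ext i; fin_cases i <;> rfl

lemma update_vec3_0 {α : Type*} (a b c k : α) :
    Function.update ![a, b, c] 0 k = ![k, b, c] := by
  ext i; fin_cases i <;> rfl

lemma update_vec3_1 {α : Type*} (a b c k : α) :
    Function.update ![a, b, c] 1 k = ![a, k, c] := by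
  ext i; fin_cases i <;> rfl

lemma update_vec3_2 {α : Type*} (a b c k : α) :
    Function.update ![a, b, c] 2 k = ![a, b, k] := by
  ext i; fin_cases i <;> rfl

lemma covD_rank0 (T : Pt → Tensor 0) (x : Pt) (e : Idx) :
    covD G T x ![e] = pd e (fun y => T y ![]) x := by
  simp [covD, Matrix.empty_eq]

lemma covD_rank1 (T : Pt → Tensor 1) (x : Pt) (e a : Idx) :
    covD G T x ![e, a] = pd e (fun y => T y ![a]) x - ∑ k, chr G x k e a * T x ![k] := by
  have h0 : (fun j : Fin 1 => ![e, a] j.succ) = ![a] := rfl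
  simp only [covD, h0, Fin.sum_univ_one, update_vec1]
  rfl

lemma covD_rank2 (T : Pt → Tensor 2) (x : Pt) (e a b : Idx) :
    covD G T x ![e, a, b] = pd e (fun y => T y ![a, b]) x
      - ∑ k, chr G x k e a * T x ![k, b] - ∑ k, chr G x k e b * T x ![a, k] := by
  have h0 : (fun j : Fin 2 => ![e, a, b] j.succ) = ![a, b] := rfl
  simp only [covD, h0, Fin.sum_univ_two, update_vec2_0, update_vec2_1, ← sub_sub]
  rfl

lemma covD_rank3 (T : Pt → Tensor 3) (x : Pt) (e a b c : Idx) :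
    covD G T x ![e, a, b, c] = pd e (fun y => T y ![a, b, c]) x
      - ∑ k, chr G x k e a * T x ![k, b, c] - ∑ k, chr G x k e b * T x ![a, k, c]
      - ∑ k, chr G x k e c * T x ![a, b, k] := by
  have h0 : (fun j : Fin 3 => ![e, a, b, c] j.succ) = ![a, b, c] := rfl
  simp only [covD, h0, Fin.sum_univ_three, update_vec3_0, update_vec3_1, update_vec3_2, ← sub_sub]
  rfl

end Components

/-! ### Smooth metrics -/

/-- A smooth non-degenerate metric on `U`. -/
structure IsSmoothMetric (U : Set Pt) (G : Pt → Matrix Idx Idx ℝ) : Prop where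
  symm : ∀ x ∈ U, ∀ a b, G x a b = G x b a
  det_ne : ∀ x ∈ U, (G x).det ≠ 0
  smooth : ∀ a b, ContDiffOn ℝ ∞ (fun x => G x a b) U
  smooth_inv : ∀ a b, ContDiffOn ℝ ∞ (fun x => (G x)⁻¹ a b) U

namespace IsSmoothMetric

open smoothFns

variable {U : Set Pt} {G : Pt → Matrix Idx Idx ℝ} (hG : IsSmoothMetric U G) (hU : IsOpen U)

/-- The metric over the algebra of smooth functions. -/
def gA (a b : Idx) : smoothFns U := restrict (fun x => G x a b) (hG.smooth a b)

/-- The inverse metric over the algebra of smooth functions. -/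
def hA (a b : Idx) : smoothFns U := restrict (fun x => (G x)⁻¹ a b) (hG.smooth_inv a b)

/-- The Christoffel symbols over the algebra of smooth functions. -/
def ΓA (a b c : Idx) : smoothFns U :=
  (1 / 2 : ℝ) • ∑ e, hG.hA a e *
    (pdA hU b (hG.gA e c) + pdA hU c (hG.gA b e)
      - pdA hU e (hG.gA b c))

include hG

lemma symm_inv {x : Pt} (hx : x ∈ U) (a b : Idx) : (G x)⁻¹ a b = (G x)⁻¹ b a := by
  have h1 : (G x).transpose = G x := by
    ext i j; rw [Matrix.transpose_apply, hG.symm x hx]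
  have h2 := Matrix.transpose_nonsing_inv (A := G x)
  rw [h1] at h2
  exact congrFun (congrFun h2 b) a

lemma mul_inv {x : Pt} (hx : x ∈ U) (a b : Idx) :
    ∑ k, G x a k * (G x)⁻¹ k b = if a = b then 1 else 0 := by
  have h1 := Matrix.mul_nonsing_inv (G x) (isUnit_iff_ne_zero.2 (hG.det_ne x hx))
  rw [← Matrix.mul_apply, h1, Matrix.one_apply]

lemma rep_Γ (a b c : Idx) : Rep (hG.ΓA hU a b c) fun x => chr G x a b c :=
  (Rep.sum fun e => (rep_restrict _ (hG.smooth_inv a e)).mul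
    ((((rep_restrict _ (hG.smooth e c)).pdA hU b).add ((rep_restrict _ (hG.smooth b e)).pdA hU c)).sub
      ((rep_restrict _ (hG.smooth b c)).pdA hU e))).smul (1 / 2)

/-- Brings an actual smooth metric under the abstract theory. -/
lemma isLeviCivita : IsLeviCivita (pdA hU) (hG.ΓA hU) hG.gA hG.hA := by
  have hs : ∀ a b, hG.gA a b = hG.gA b a := fun a b =>
    (rep_restrict _ (hG.smooth a b)).unique ((rep_restrict _ (hG.smooth b a)).congr fun x hx =>
      hG.symm x hx b a)
  have hm : ∀ a b, ∑ k, hG.gA a k * hG.hA k b = if a = b then 1 else 0 := fun a b =>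
    (Rep.sum fun k => (rep_restrict _ (hG.smooth a k)).mul (rep_restrict _ (hG.smooth_inv k b))).unique <| by
      have := fun x hx => (hG.mul_inv (x := x) hx a b).symm
      split_ifs with h
      · exact rep_one.congr fun x hx => by simpa [h] using this x hx
      · exact rep_zero.congr fun x hx => by simpa [h] using this x hx
  refine ⟨pdA_comm hU, fun k i j => ?_, hs, fun a b => ?_, hm, fun e a b => ?_⟩
  · simp only [ΓA, hs i j]
    congr 1
    refine Finset.sum_congr rfl fun e _ => ?_
    rw [hs e j, hs i e]; ring
  · exact (rep_restrict _ (hG.smooth_inv a b)).unique ((rep_restrict _ (hG.smooth_inv b a)).congr fun x hx =>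
      hG.symm_inv hx b a)
  -- Lowering the upper index gives the Christoffel symbol of the first kind; two of these add up to
  -- the derivative of the metric.
  · have h1 : ∀ a b, ∑ k, hG.ΓA hU k e a * hG.gA k b = (1 / 2 : ℝ) •
        (pdA hU e (hG.gA b a) + pdA hU a (hG.gA e b)
      - pdA hU b (hG.gA e a)) := fun a b => by
      rw [← sum_metric_inverse_mul hm (fun b => pdA hU e (hG.gA b a)
        + pdA hU a (hG.gA e b) - pdA hU b (hG.gA e a)) b, Finset.smul_sum]
      refine Finset.sum_congr rfl fun k _ => ?_
      rw [ΓA, hs k b, smul_mul_assoc, mul_comm]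
    have h2 : ∑ k, hG.ΓA hU k e b * hG.gA a k = ∑ k, hG.ΓA hU k e b * hG.gA k a :=
      Finset.sum_congr rfl fun k _ => by rw [hs]
    rw [h2, h1, h1, hs b a, hs e b, hs e a]
    module

omit hG in
lemma rep_covD0 {T : Pt → Tensor 0} {f : smoothFns U} (h : Rep f fun x => T x ![]) (e : Idx) :
    Rep (pdA hU e f) fun x => covD G T x ![e] := by
  simp only [covD_rank0]; exact h.pdA hU e

lemma rep_covD1 {T : Pt → Tensor 1} {w : Idx → smoothFns U}
    (h : ∀ a, Rep (w a) fun x => T x ![a]) (e a : Idx) :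
    Rep (cov1 (pdA hU) (hG.ΓA hU) w e a) fun x => covD G T x ![e, a] := by
  simp only [covD_rank1]
  exact ((h a).pdA hU e).sub (Rep.sum fun k => (hG.rep_Γ hU k e a).mul (h k))

lemma rep_covD2 {T : Pt → Tensor 2} {w : Idx → Idx → smoothFns U}
    (h : ∀ a b, Rep (w a b) fun x => T x ![a, b]) (e a b : Idx) :
    Rep (cov2 (pdA hU) (hG.ΓA hU) w e a b) fun x => covD G T x ![e, a, b] := by
  simp only [covD_rank2]
  exact (((h a b).pdA hU e).sub (Rep.sum fun k => (hG.rep_Γ hU k e a).mul (h k b))).sub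
    (Rep.sum fun k => (hG.rep_Γ hU k e b).mul (h a k))

lemma rep_covD3 {T : Pt → Tensor 3} {w : Idx → Idx → Idx → smoothFns U}
    (h : ∀ a b c, Rep (w a b c) fun x => T x ![a, b, c]) (e a b c : Idx) :
    Rep (cov3 (pdA hU) (hG.ΓA hU) w e a b c) fun x => covD G T x ![e, a, b, c] := by
  simp only [covD_rank3]
  exact ((((h a b c).pdA hU e).sub (Rep.sum fun k => (hG.rep_Γ hU k e a).mul (h k b c))).sub
    (Rep.sum fun k => (hG.rep_Γ hU k e b).mul (h a k c))).sub
    (Rep.sum fun k => (hG.rep_Γ hU k e c).mul (h a b k))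

lemma rep_box0 {T : Pt → Tensor 0} {f : smoothFns U} (h : Rep f fun x => T x ![]) :
    Rep (∑ e, ∑ f', hG.hA e f' *
      cov1 (pdA hU) (hG.ΓA hU) (fun a => pdA hU a f) e f')
      fun x => box G T x ![] :=
  Rep.sum fun e => Rep.sum fun f => (rep_restrict _ (hG.smooth_inv e f)).mul
    (hG.rep_covD1 hU (fun a => rep_covD0 (G := G) hU h a) e f)

lemma rep_box1 {T : Pt → Tensor 1} {w : Idx → smoothFns U}
    (h : ∀ a, Rep (w a) fun x => T x ![a]) (a : Idx) :
    Rep (∑ e, ∑ f, hG.hA e f *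
      cov2 (pdA hU) (hG.ΓA hU) (cov1 (pdA hU) (hG.ΓA hU) w) e f a)
      fun x => box G T x ![a] :=
  Rep.sum fun e => Rep.sum fun f => (rep_restrict _ (hG.smooth_inv e f)).mul
    (hG.rep_covD2 hU (fun a b => hG.rep_covD1 hU h a b) e f a)

lemma rep_box2 {T : Pt → Tensor 2} {w : Idx → Idx → smoothFns U}
    (h : ∀ a b, Rep (w a b) fun x => T x ![a, b]) (a b : Idx) :
    Rep (∑ e, ∑ f, hG.hA e f *
      cov3 (pdA hU) (hG.ΓA hU) (cov2 (pdA hU) (hG.ΓA hU) w) e f a b)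
      fun x => box G T x ![a, b] :=
  Rep.sum fun e => Rep.sum fun f => (rep_restrict _ (hG.smooth_inv e f)).mul
    (hG.rep_covD3 hU (fun a b c => hG.rep_covD2 hU h a b c) e f a b)

lemma rep_riem (a b c d : Idx) :
    Rep (rm (pdA hU) (hG.ΓA hU) a b c d) fun x => riem G x a b c d :=
  (((hG.rep_Γ hU a d b).pdA hU c).sub ((hG.rep_Γ hU a c b).pdA hU d)).add
    (Rep.sum fun e => ((hG.rep_Γ hU a c e).mul (hG.rep_Γ hU e d b)).sub
      ((hG.rep_Γ hU a d e).mul (hG.rep_Γ hU e c b)))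

lemma rep_riemLow (a b c d : Idx) :
    Rep (rmLow (pdA hU) (hG.ΓA hU) hG.gA a b c d) fun x => riemLow G x a b c d :=
  Rep.sum fun e => (rep_restrict _ (hG.smooth a e)).mul (hG.rep_riem hU e b c d)

lemma rep_ricci (a b : Idx) :
    Rep (ric (pdA hU) (hG.ΓA hU) a b) fun x => ricci G x a b :=
  Rep.sum fun e => hG.rep_riem hU e a e b

lemma rep_scalarCurv :
    Rep (∑ a, ∑ b, hG.hA a b * ric (pdA hU) (hG.ΓA hU) a b)
      fun x => scalarCurv G x :=
  Rep.sum fun a => Rep.sum fun b => (rep_restrict _ (hG.smooth_inv a b)).mul (hG.rep_ricci hU a b)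

end IsSmoothMetric

/-! ### Commutators for solutions of the conformally invariant wave equation -/

section Algebraic

variable {A : Type*} [CommRing A] [Algebra ℝ A]
variable {D : Idx → Derivation ℝ A A} {Γ : Idx → Idx → Idx → A} {g h : Idx → Idx → A}

namespace IsLeviCivita

variable (H : IsLeviCivita D Γ g h)
include H

/-- `□ ∇_b φ` for a solution of `□ φ = c R φ`. -/
lemma box_grad_of_wave {c R φ : A} (hc : ∀ e, D e c = 0)
    (hφ : ∑ e, ∑ f, h e f * cov1 D Γ (fun a => D a φ) e f = c * (R * φ)) (b : Idx) :
    ∑ e, ∑ f, h e f * cov2 D Γ (cov1 D Γ fun a => D a φ) e f b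
      = c * (R * D b φ + φ * D b R) + ∑ d, ric D Γ b d * ∑ k, h d k * D k φ := by
  rw [H.box_grad, hφ]
  simp only [Derivation.leibniz, hc, smul_eq_mul]
  ring

/-- `□ ∇_a ∇_b φ` for a solution of `□ φ = c R φ` with Ricci tensor `2 L_{ab} + c R g_{ab}`. -/
lemma box_hessian_of_wave {c R φ : A} {L : Idx → Idx → A} (hc : ∀ e, D e c = 0)
    (hφ : ∑ e, ∑ f, h e f * cov1 D Γ (fun a => D a φ) e f = c * (R * φ))
    (hR : ∀ a b, ric D Γ a b = L a b + L a b + c * (R * g a b)) (a b : Idx) :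
    ∑ e, ∑ f, h e f * cov3 D Γ (cov2 D Γ (cov1 D Γ fun a => D a φ)) e f a b
      = c * (R * cov1 D Γ (fun a => D a φ) a b + φ * cov1 D Γ (fun a => D a R) a b
          + (D a R * D b φ + D b R * D a φ))
        - 2 * ∑ c, ∑ e, rmLow D Γ g a c b e
          * ∑ k, h c k * ∑ l, h e l * cov1 D Γ (fun a => D a φ) k l
        + ∑ c, ric D Γ a c * ∑ k, h c k * cov1 D Γ (fun a => D a φ) b k
        + ∑ c, ric D Γ b c * ∑ k, h c k * cov1 D Γ (fun a => D a φ) a k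
        + 2 * ∑ c, (cov2 D Γ L a b c + cov2 D Γ L b a c - cov2 D Γ L c a b)
          * (∑ k, h c k * D k φ)
        + c * (D a R * D b φ + D b R * D a φ
          - g a b * ∑ d, D d R * ∑ k, h d k * D k φ) := by
  -- By compatibility ∇(cRg) = c(∇R)g for constant `c`, so only ∇L and ∇R remain.
  have h1 : ∀ m a b, cov2 D Γ (ric D Γ) m a b
      = 2 * cov2 D Γ L m a b + c * (D m R * g a b) := fun m a b => by
    simp only [cov2, hR, map_add, Derivation.leibniz, smul_eq_mul, hc, H.compat, Fin.sum_univ_four]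
    ring
  have h2 : cov1 D Γ (fun b => D b (c * (R * φ))) a b
      = c * (R * cov1 D Γ (fun a => D a φ) a b + φ * cov1 D Γ (fun a => D a R) a b
          + (D a R * D b φ + D b R * D a φ)) := by
    simp only [cov1, map_add, Derivation.leibniz, smul_eq_mul, hc, mul_zero, add_zero,
      Fin.sum_univ_four]
    ring
  have h3 := sum_metric_inverse_mul H.mul_inv (fun k => D k φ)
  rw [H.box_hessian, hφ, h2]
  simp only [h1]
  -- Of the three terms in ∇R, two contract the metric with the raised gradient of φ and so lower it
  -- again; the third keeps the factor g_{ab}.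
  have h4 : ∑ d, (2 * cov2 D Γ L a b d + c * (D a R * g b d)
        + (2 * cov2 D Γ L b a d + c * (D b R * g a d))
        - (2 * cov2 D Γ L d a b + c * (D d R * g a b))) * (∑ k, h d k * D k φ)
      = 2 * ∑ d, (cov2 D Γ L a b d + cov2 D Γ L b a d - cov2 D Γ L d a b)
          * (∑ k, h d k * D k φ)
        + c * (D a R * (∑ d, g b d * ∑ k, h d k * D k φ)
          + D b R * (∑ d, g a d * ∑ k, h d k * D k φ)
          - g a b * ∑ d, D d R * ∑ k, h d k * D k φ) := by
    generalize hW : (fun d => ∑ k, h d k * D k φ) = W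
    have hW' : ∀ d, ∑ k, h d k * D k φ = W d := fun d => congrFun hW d
    simp only [hW', Fin.sum_univ_four]
    ring
  rw [h4, h3, h3]
  ring

end IsLeviCivita

lemma cov1_sub (v w : Idx → A) : cov1 D Γ (fun a => v a - w a)
    = fun e a => cov1 D Γ v e a - cov1 D Γ w e a := by
  funext e a
  simp only [cov1, map_sub, mul_sub, Finset.sum_sub_distrib]; ring

lemma cov2_sub (v w : Idx → Idx → A) : cov2 D Γ (fun a b => v a b - w a b)
    = fun e a b => cov2 D Γ v e a b - cov2 D Γ w e a b := by
  funext e a b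
  simp only [cov2, map_sub, mul_sub, Finset.sum_sub_distrib]; ring

lemma cov3_sub (v w : Idx → Idx → Idx → A) : cov3 D Γ (fun a b c => v a b c - w a b c)
    = fun e a b c => cov3 D Γ v e a b c - cov3 D Γ w e a b c := by
  funext e a b c
  simp only [cov3, map_sub, mul_sub, Finset.sum_sub_distrib]; ring

lemma sum_cov2_cov1_sub (v w : Idx → A) (b : Idx) :
    ∑ e, ∑ f, h e f * cov2 D Γ (cov1 D Γ fun a => v a - w a) e f b
      = ∑ e, ∑ f, h e f * cov2 D Γ (cov1 D Γ v) e f b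
        - ∑ e, ∑ f, h e f * cov2 D Γ (cov1 D Γ w) e f b := by
  simp only [cov1_sub, cov2_sub, mul_sub, Finset.sum_sub_distrib]

lemma sum_cov3_cov2_sub (v w : Idx → Idx → A) (a b : Idx) :
    ∑ e, ∑ f, h e f * cov3 D Γ (cov2 D Γ fun a b => v a b - w a b) e f a b
      = ∑ e, ∑ f, h e f * cov3 D Γ (cov2 D Γ v) e f a b
        - ∑ e, ∑ f, h e f * cov3 D Γ (cov2 D Γ w) e f a b := by
  simp only [cov2_sub, cov3_sub, mul_sub, Finset.sum_sub_distrib]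

end Algebraic

/-! ### Wave equations for differences -/

namespace smoothFns

variable {U : Set Pt}

lemma Rep.eq {f : smoothFns U} {F F' : Pt → ℝ} (h : Rep f F) (h' : Rep f F') {x : Pt}
    (hx : x ∈ U) : F x = F' x := (h ⟨x, hx⟩).symm.trans (h' ⟨x, hx⟩)

lemma rep_const (c : ℝ) : Rep (algebraMap ℝ (smoothFns U) c) fun _ => c := fun _ => rfl

lemma rep_two : Rep (2 : smoothFns U) fun _ => 2 := by
  have := rep_const (U := U) 2
  rwa [map_ofNat] at this

end smoothFns

namespace IsSmoothMetric

open smoothFns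

variable {U : Set Pt} {G : Pt → Matrix Idx Idx ℝ} (hG : IsSmoothMetric U G) (hU : IsOpen U)
include hG hU

/-- `□ (S_b - ∇_b f)` for a solution of `□ f = (1/6) R f`. -/
lemma box_sub_grad {f : Pt → ℝ} (hf : ContDiffOn ℝ ∞ f U)
    (hw : ∀ x ∈ U, box G (scal f) x ![] = 1 / 6 * (scalarCurv G x * f x))
    {S : Pt → Tensor 1} (hS : ∀ a, ContDiffOn ℝ ∞ (fun x => S x ![a]) U)
    {x : Pt} (hx : x ∈ U) (b : Idx) :
    box G (fun y i => S y i - covD G (scal f) y i) x ![b] = box G S x ![b]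
      - (1 / 6 * (scalarCurv G x * pd b f x + f x * pd b (scalarCurv G) x)
        + ∑ d, ricci G x b d * ∑ k, (G x)⁻¹ d k * pd k f x) := by
  have rf : Rep (restrict f hf) fun x => scal f x ![] := rep_restrict f hf
  have rg : ∀ a, Rep (pdA hU a (restrict f hf)) fun x => pd a f x := fun a => Rep.pdA hU rf a
  have rS := fun a => rep_restrict _ (hS a)
  have r1 := hG.rep_box1 hU rS b
  have r3 := hG.rep_box1 hU (T := fun y i => S y i - covD G (scal f) y i)
    (fun a => (rS a).sub (rep_covD0 (G := G) hU rf a)) b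
  have rR := hG.rep_scalarCurv hU
  -- The wave equation holds on all of `U`, hence is an identity in the algebra and can be
  -- differentiated there.
  have e1 := (hG.isLeviCivita hU).box_grad_of_wave (fun e => (pdA hU e).map_algebraMap (1 / 6))
    ((hG.rep_box0 hU rf).unique (((rep_const (1 / 6)).mul (rR.mul rf)).congr
      fun x hx => (hw x hx).symm)) b
  rw [sum_cov2_cov1_sub, e1] at r3
  refine r3.eq (r1.sub (((rep_const (1 / 6)).mul ((rR.mul (rg b)).add (rf.mul (rR.pdA hU b)))).add
    (Rep.sum fun d => (hG.rep_ricci hU b d).mul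
      (Rep.sum fun k => (rep_restrict _ (hG.smooth_inv d k)).mul (rg k))))) hx

set_option maxHeartbeats 1000000 in
/-- `□ (S_{ab} - ∇_a ∇_b f)` for a solution of `□ f = (1/6) R f`. -/
lemma box_sub_hessian {f : Pt → ℝ} (hf : ContDiffOn ℝ ∞ f U)
    (hw : ∀ x ∈ U, box G (scal f) x ![] = 1 / 6 * (scalarCurv G x * f x))
    {L : Pt → Tensor 2} (hL : ∀ a b, ContDiffOn ℝ ∞ (fun x => L x ![a, b]) U)
    (hR : ∀ x ∈ U, ∀ a b, ricci G x a b
      = 2 * L x ![a, b] + 1 / 6 * scalarCurv G x * G x a b)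
    {S : Pt → Tensor 2} (hS : ∀ a b, ContDiffOn ℝ ∞ (fun x => S x ![a, b]) U)
    {x : Pt} (hx : x ∈ U) (a b : Idx) :
    box G (fun y i => S y i - covD G (covD G (scal f)) y i) x ![a, b] = box G S x ![a, b]
      - (1 / 6 * (scalarCurv G x * covD G (covD G (scal f)) x ![a, b]
          + f x * covD G (covD G (scal (scalarCurv G))) x ![a, b]
          + (pd a (scalarCurv G) x * pd b f x + pd b (scalarCurv G) x * pd a f x))
        - 2 * ∑ c, ∑ e, riemLow G x a c b e
          * ∑ k, (G x)⁻¹ c k * ∑ l, (G x)⁻¹ e l * covD G (covD G (scal f)) x ![k, l]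
        + ∑ c, ricci G x a c * ∑ k, (G x)⁻¹ c k * covD G (covD G (scal f)) x ![b, k]
        + ∑ c, ricci G x b c * ∑ k, (G x)⁻¹ c k * covD G (covD G (scal f)) x ![a, k]
        + 2 * ∑ c, (covD G L x ![a, b, c] + covD G L x ![b, a, c] - covD G L x ![c, a, b])
          * (∑ k, (G x)⁻¹ c k * pd k f x)
        + 1 / 6 * (pd a (scalarCurv G) x * pd b f x + pd b (scalarCurv G) x * pd a f x
          - G x a b * ∑ d, pd d (scalarCurv G) x * ∑ k, (G x)⁻¹ d k * pd k f x)) := by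
  have rf : Rep (restrict f hf) fun x => scal f x ![] := rep_restrict f hf
  have rg : ∀ a, Rep (pdA hU a (restrict f hf)) fun x => pd a f x := fun a => Rep.pdA hU rf a
  have rS := fun a b => rep_restrict _ (hS a b)
  have rL := fun a b => rep_restrict _ (hL a b)
  have rX := hG.rep_covD1 hU (fun a => rep_covD0 (G := G) hU rf a)
  have rDL := hG.rep_covD2 hU rL
  have rh := fun a b => rep_restrict _ (hG.smooth_inv a b)
  have r1 := hG.rep_box2 hU rS a b
  have r3 := hG.rep_box2 hU (T := fun y i => S y i - covD G (covD G (scal f)) y i)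
    (fun a b => (rS a b).sub (rX a b)) a b
  have rR := hG.rep_scalarCurv hU
  have rR' : Rep (∑ a, ∑ b, hG.hA a b * ric (pdA hU) (hG.ΓA hU) a b)
      fun x => scal (scalarCurv G) x ![] := rR
  have rdR : ∀ a, Rep _ (fun x => pd a (scalarCurv G) x) := fun a => rR.pdA hU a
  have rXR := hG.rep_covD1 hU (fun a => rep_covD0 (G := G) hU rR' a)
  have rRic := hG.rep_ricci hU
  have e1 := (hG.isLeviCivita hU).box_hessian_of_wave
    (L := fun a b => restrict _ (hL a b)) (fun e => (pdA hU e).map_algebraMap (1 / 6))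
    ((hG.rep_box0 hU rf).unique (((rep_const (1 / 6)).mul (rR.mul rf)).congr
      fun x hx => (hw x hx).symm))
    (fun a b => (rRic a b).unique ((((rL a b).add (rL a b)).add
      ((rep_const (1 / 6)).mul (rR.mul (rep_restrict _ (hG.smooth a b))))).congr
        fun x hx => by rw [hR x hx]; ring)) a b
  rw [sum_cov3_cov2_sub, e1] at r3
  have rup := fun d => Rep.sum (s := Finset.univ) fun k => (rh d k).mul (rg k)
  have t1 := (rep_const (1 / 6)).mul (((rR.mul (rX a b)).add (rf.mul (rXR a b))).add
    (((rdR a).mul (rg b)).add ((rdR b).mul (rg a))))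
  have t2 := (rep_two (U := U)).mul (Rep.sum (s := Finset.univ) fun c =>
    Rep.sum (s := Finset.univ) fun e =>
    (hG.rep_riemLow hU a c b e).mul (Rep.sum (s := Finset.univ) fun k => (rh c k).mul
      (Rep.sum (s := Finset.univ) fun l => (rh e l).mul (rX k l))))
  have t3 := fun a b => Rep.sum (s := Finset.univ) fun c => (rRic a c).mul
    (Rep.sum (s := Finset.univ) fun k => (rh c k).mul (rX b k))
  have t4 := (rep_two (U := U)).mul (Rep.sum (s := Finset.univ) fun c =>
    (((rDL a b c).add (rDL b a c)).sub (rDL c a b)).mul (rup c))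
  have t5 := (rep_const (1 / 6)).mul ((((rdR a).mul (rg b)).add ((rdR b).mul (rg a))).sub
    ((rep_restrict _ (hG.smooth a b)).mul (Rep.sum (s := Finset.univ) fun d =>
      (rdR d).mul (rup d))))
  exact r3.eq (r1.sub (((((t1.sub t2).add (t3 a b)).add (t3 b a)).add t4).add t5)) hx

end IsSmoothMetric

/-! ### Smoothness of the inverse metric -/

section Inverse

variable {E : Type*} [NormedAddCommGroup E] [NormedSpace ℝ E] {s : Set E}

lemma contDiffOn_det {M : E → Matrix Idx Idx ℝ}
    (hM : ∀ i j, ContDiffOn ℝ ∞ (fun x => M x i j) s) : ContDiffOn ℝ ∞ (fun x => (M x).det) s := by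
  simp only [Matrix.det_apply']
  exact ContDiffOn.sum fun σ _ => contDiffOn_const.mul (contDiffOn_prod fun i _ => hM _ _)

/-- Cramer's rule: each entry of the adjugate is the determinant of the matrix with one row replaced
by constants. -/
lemma contDiffOn_inv_apply {M : E → Matrix Idx Idx ℝ}
    (hM : ∀ i j, ContDiffOn ℝ ∞ (fun x => M x i j) s) (hs : ∀ x ∈ s, (M x).det ≠ 0)
    (a b : Idx) : ContDiffOn ℝ ∞ (fun x => (M x)⁻¹ a b) s := by
  have h1 : (fun x => (M x)⁻¹ a b) = fun x => ((M x).det)⁻¹ * (M x).adjugate a b := by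
    funext x; simp [Matrix.inv_def]
  rw [h1]
  refine ((contDiffOn_det hM).inv hs).mul ?_
  simp only [Matrix.adjugate_apply]
  refine contDiffOn_det fun i j => ?_
  by_cases h : i = b
  · subst h; simpa using contDiffOn_const
  · simpa [Matrix.updateRow_ne h] using hM i j

end Inverse

lemma IsLorentzian.det_ne_zero {m : Matrix Idx Idx ℝ} (h : IsLorentzian m) : m.det ≠ 0 := by
  obtain ⟨-, p, -, hp⟩ := h
  intro h0
  have := congrArg Matrix.det hp
  simp [Matrix.det_mul, h0, Fin.prod_univ_four] at this

lemma IsAdmissible.contDiffOn_apply {U : Set Pt} {u : Pt → State} (hu : IsAdmissible U u)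
    (i : Comp) : ContDiffOn ℝ ∞ (fun x => u x i) U :=
  (contDiff_apply ℝ ℝ i).comp_contDiffOn hu.1

lemma IsAdmissible.isSmoothMetric {U : Set Pt} {u : Pt → State} (hu : IsAdmissible U u) :
    IsSmoothMetric U (metric u) where
  symm x hx a b := by
    have := congrFun (congrFun (hu.2 x hx).1.1 b) a
    simpa [metric] using this
  det_ne x hx := (hu.2 x hx).1.det_ne_zero
  smooth a b := hu.contDiffOn_apply (.g a b)
  smooth_inv a b := contDiffOn_inv_apply (fun i j => hu.contDiffOn_apply (.g i j))
    (fun x hx => (hu.2 x hx).1.det_ne_zero) a b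

lemma raise_rank1 (m : Matrix Idx Idx ℝ) (T : Tensor 1) (a : Idx) :
    raise m 0 T ![a] = ∑ k, m a k * T ![k] := by
  simp only [raise, update_vec1]; rfl

lemma mix2_eq (y : State) (T : Tensor 2) (a b : Idx) :
    mix2 y T a b = ∑ k, (gOf y)⁻¹ b k * T ![a, k] := by
  simp only [mix2, raise, update_vec2_1]; rfl

lemma up2_eq (y : State) (T : Tensor 2) (a b : Idx) :
    up2 y T a b = ∑ k, (gOf y)⁻¹ a k * ∑ l, (gOf y)⁻¹ b l * T ![k, l] := by
  simp only [up2, raise, update_vec2_0, update_vec2_1]; rfl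

/-! ### Wave equations of the zero-quantities -/

lemma sum_raise_mul_comm {h : Idx → Idx → ℝ} (hh : ∀ a b, h a b = h b a) (v w : Idx → ℝ) :
    ∑ b, (∑ k, h b k * v k) * w b = ∑ b, (∑ k, h b k * w k) * v b := by
  simp only [Finset.sum_mul]
  rw [Finset.sum_comm]
  exact Finset.sum_congr rfl fun b _ => Finset.sum_congr rfl fun k _ => by rw [hh]; ring

/-- The commutator gives □∇_aφ = R∇_aφ/3 + 2L_a{}^b∇_bφ + φ∇_aR/6, where R/3 is R/6 from the wave
equation plus R/6 from the Ricci tensor. This is the equation for φ_a with ∇φ inserted, so the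
inhomogeneity φ∇_aR/6 drops out of the difference. -/
theorem box_Q1 {U : Set Pt} (hU : IsOpen U) {u : Pt → State} (hu : IsAdmissible U u)
    (hE : UnphysicalEinstein u U) (hw : SolvesScalarWaveEqs u U) {x : Pt} (hx : x ∈ U) (a : Idx) :
    box (metric u) (Q1 u) x ![a] = rhsQ1 u (scalarCurv (metric u)) x ![a] := by
  have hG := hu.isSmoothMetric
  have h1 := hG.box_sub_grad hU (f := fun y => u y .phi) (hu.contDiffOn_apply _)
    (fun y hy => by rw [(hw y hy).1, rhsPhi]; ring) (S := fun y => phi1Of (u y))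
    (fun a => hu.contDiffOn_apply _) hx a
  refine h1.trans ?_
  rw [(hw x hx).2.1]
  have h2 : ∀ b, Q1 u x ![b] = phi1Of (u x) ![b] - pd b (fun y => u y .phi) x := fun b => by
    rw [Q1, covD_rank0]; rfl
  simp only [rhsPhi1, rhsQ1, h2, hE x hx, phi1Up, raise_rank1, mix2_eq, Matrix.cons_val_zero]
  set ψ : Idx → ℝ := fun b => pd b (fun y => u y .phi) x with hψ
  set p : Idx → ℝ := fun b => phi1Of (u x) ![b] with hp
  set h : Idx → Idx → ℝ := fun a b => (gOf (u x))⁻¹ a b with hh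
  have hs : ∀ a b, h a b = h b a := fun a b => hG.symm_inv hx a b
  have h3 := sum_raise_mul_comm hs p fun b => LOf (u x) ![a, b]
  have h4 := sum_raise_mul_comm hs ψ fun b => LOf (u x) ![a, b]
  have h5 := sum_metric_inverse_mul (fun a b => hG.mul_inv hx a b) ψ a
  have h6 : ∑ d, (2 * LF u x ![a, d] + 1 / 6 * scalarCurv (metric u) x * metric u x a d)
        * ∑ k, (metric u x)⁻¹ d k * ψ k
      = 2 * ∑ d, (∑ k, h d k * ψ k) * LOf (u x) ![a, d]
        + 1 / 6 * scalarCurv (metric u) x * ∑ d, metric u x a d * ∑ k, (metric u x)⁻¹ d k * ψ k := by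
    rw [Finset.mul_sum, Finset.mul_sum, ← Finset.sum_add_distrib]
    refine Finset.sum_congr rfl fun d _ => ?_
    simp only [h, metric, LF]; ring
  rw [h6, h4, h5]
  change _ = 1 / 3 * scalarCurv (metric u) x * (p a - ψ a) + 2 * ∑ b, _ * (p b - ψ b)
  simp only [mul_sub, Finset.sum_sub_distrib]
  have h7 : ∑ b, (∑ k, (gOf (u x))⁻¹ b k * phi1Of (u x) ![k]) * LOf (u x) ![a, b]
    = ∑ b, (∑ k, (gOf (u x))⁻¹ b k * LOf (u x) ![a, k]) * p b := h3
  rw [h7]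
  simp only [p, ψ, h]
  ring

/-- The algebraic identity behind the wave equation for `Q_{ab}`. -/
lemma hessian_identity {g L X q Xm qm Xup qup HR Ric : Idx → Idx → ℝ}
    {Rm P d : Idx → Idx → Idx → Idx → ℝ} {C Δ DL : Idx → Idx → Idx → ℝ}
    {p pu ψ ψu v pR : Idx → ℝ} {R φ Ξ : ℝ}
    (hL : ∀ a b, L a b = L b a) (hX : ∀ a b, X a b = X b a) (hg : ∀ a b, g a b = g b a)
    (hHR : ∀ a b, HR a b = HR b a)
    (hXu : ∀ a b, Xup a b = Xup b a) (hqu : ∀ a b, qup a b = qup b a)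
    (hDL : ∀ a b c, DL a b c = DL a c b)
    (hd1 : ∀ a b c e, d a b c e = -d b a c e) (hd2 : ∀ a b c e, d a b c e = d c e a b)
    (hRic : ∀ a b, Ric a b = 2 * L a b + 1 / 6 * R * g a b)
    (hP : ∀ a b c e, P a b c e = Rm a b c e - Ξ * d a b c e
      - ((g a c * L e b - g a e * L c b) - (g b c * L e a - g b e * L c a)))
    (hΔ : ∀ a b c, Δ a b c = DL a b c - DL b a c - (∑ e, v e * d e c a b) - Ξ * C a b c)
    (f1 : ∀ a c, ∑ e, g a e * Xup c e = Xm a c)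
    (f2 : ∑ c, ∑ e, g c e * Xup c e = 1 / 6 * R * φ)
    (f3 : ∀ a b, ∑ c, g a c * Xm b c = X b a) (a b : Idx) :
    1 / 2 * q a b * R - 1 / 3 * R * φ * L a b
      - 2 * (∑ c, ∑ e, qup c e * L c e) * g a b
      - 1 / 6 * g a b * (∑ c, pu c * pR c)
      + 1 / 6 * φ * (1 / 2 * (HR a b + HR b a))
      - 2 * Ξ * (∑ c, ∑ e, qup c e * (1 / 2 * (d a c b e + d b c a e)))
      + 8 * (1 / 2 * ∑ c, (qm a c * L b c + qm b c * L a c))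
      + 2 * Ξ * (∑ c, pu c * (1 / 2 * (C a c b + C b c a)))
      + 2 / 3 * (1 / 2 * (p a * pR b + p b * pR a))
      + 2 * (∑ c, pu c * (1 / 2 * (DL a b c + DL b a c)))
      - 2 * (∑ c, ∑ e, pu c * (1 / 2 * (d a c b e + d b c a e)) * v e)
      - (1 / 6 * (R * X a b + φ * HR a b + (pR a * ψ b + pR b * ψ a))
        - 2 * ∑ c, ∑ e, Rm a c b e * Xup c e
        + ∑ c, Ric a c * Xm b c + ∑ c, Ric b c * Xm a c
        + 2 * ∑ c, (DL a b c + DL b a c - DL c a b) * ψu c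
        + 1 / 6 * (pR a * ψ b + pR b * ψ a - g a b * ∑ c, pR c * ψu c))
    = 1 / 2 * (q a b - X a b) * R - 2 * (∑ c, ∑ e, (qup c e - Xup c e) * L c e) * g a b
      - 1 / 6 * g a b * (∑ c, (pu c - ψu c) * pR c)
      + 2 * (∑ c, (pu c - ψu c) * DL c a b)
      - 2 * Ξ * (∑ c, ∑ e, (qup c e - Xup c e) * d a c b e)
      + 8 * (1 / 2 * ∑ c, ((qm a c - Xm a c) * L b c + (qm b c - Xm b c) * L a c))
      - 2 * (∑ c, pu c * (1 / 2 * (Δ a c b + Δ b c a)))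
      + 4 * Ξ * (∑ c, (pu c - ψu c) * (1 / 2 * (C a c b + C b c a)))
      + 4 * (∑ c, (pu c - ψu c) * (1 / 2 * (Δ a c b + Δ b c a)))
      + 2 / 3 * (1 / 2 * ((p a - ψ a) * pR b + (p b - ψ b) * pR a))
      - 4 * (∑ c, ∑ e, (pu c - ψu c) * (1 / 2 * (d a c b e + d b c a e)) * v e)
      + 2 * ∑ c, ∑ e, P a c b e * Xup c e := by
  -- Riemann is split into P, Ξd and the L-part. The contractions of the L-part give mixed Hessian
  -- terms, a trace with L, and, by the wave equation `f2`, the multiple Rφ/6 of L_{ab}.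
  have s1 : ∑ c, ∑ e, Rm a c b e * Xup c e = ∑ c, ∑ e, P a c b e * Xup c e
      + Ξ * (∑ c, ∑ e, Xup c e * d a c b e) + (∑ c, ∑ e, Xup c e * L c e) * g a b
      - ∑ c, Xm a c * L b c - ∑ c, Xm b c * L a c + L a b * (1 / 6 * R * φ) := by
    have t1 : ∑ c, Xm a c * L b c = ∑ c, ∑ e, g a e * Xup c e * L b c := by
      simp only [← f1 a, Finset.sum_mul]
    have t2 : ∑ c, Xm b c * L a c = ∑ c, ∑ e, g b c * Xup c e * L a e := by
      rw [Finset.sum_comm]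
      refine Finset.sum_congr rfl fun e _ => ?_
      rw [← f1 b, Finset.sum_mul]
      exact Finset.sum_congr rfl fun c _ => by rw [hXu]
    rw [t1, t2, ← f2]
    simp only [Finset.mul_sum, Finset.sum_mul, ← Finset.sum_add_distrib, ← Finset.sum_sub_distrib]
    refine Finset.sum_congr rfl fun c _ => Finset.sum_congr rfl fun e _ => ?_
    rw [hP, hL e c, hL e a, hL b a, hg b c]; ring
  have s2 : ∀ a b, ∑ c, Ric a c * Xm b c = 2 * ∑ c, Xm b c * L a c + 1 / 6 * R * X b a :=
    fun a b => by
      rw [← f3 a b, Finset.mul_sum, Finset.mul_sum, ← Finset.sum_add_distrib]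
      exact Finset.sum_congr rfl fun c _ => by rw [hRic]; ring
  have s3 : ∑ c, ∑ e, qup c e * (1 / 2 * (d a c b e + d b c a e))
      = ∑ c, ∑ e, qup c e * d a c b e := by
    have : ∑ c, ∑ e, qup c e * d b c a e = ∑ c, ∑ e, qup c e * d a c b e := by
      rw [Finset.sum_comm]
      exact Finset.sum_congr rfl fun c _ => Finset.sum_congr rfl fun e _ => by rw [hqu, hd2]
    simp only [mul_add, Finset.sum_add_distrib, mul_left_comm _ (1 / 2 : ℝ), ← Finset.mul_sum, this]
    ring
  -- Solved for ∇_cL_{ab}, the definition of Δ exchanges it for ∇_{(a}L_{b)c} at the price of d- and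
  -- T-terms. It is used with w = φ^c and with w = Q^c; the resulting net coefficient of Δ is 2φ^c -
  -- 4∇^cφ.
  have s4 : ∀ w : Idx → ℝ, ∑ c, w c * (1 / 2 * (Δ a c b + Δ b c a))
      = ∑ c, w c * (1 / 2 * (DL a b c + DL b a c)) - ∑ c, w c * DL c a b
        + (∑ c, ∑ e, w c * (1 / 2 * (d a c b e + d b c a e)) * v e)
        - Ξ * ∑ c, w c * (1 / 2 * (C a c b + C b c a)) := fun w => by
    rw [Finset.mul_sum]
    simp only [← Finset.sum_add_distrib, ← Finset.sum_sub_distrib]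
    refine Finset.sum_congr rfl fun c _ => ?_
    have t : ∑ e, w c * (1 / 2 * (d a c b e + d b c a e)) * v e
        = w c * (1 / 2 * (-(∑ e, v e * d e b a c) - ∑ e, v e * d e a b c)) := by
      simp only [← Finset.sum_neg_distrib, ← Finset.sum_sub_distrib, Finset.mul_sum]
      refine Finset.sum_congr rfl fun e _ => ?_
      rw [hd2 a c b e, hd2 b c a e, hd1 b e, hd1 a e]; ring
    rw [t, hΔ, hΔ, hDL a c b, hDL b c a, hDL c b a]; ring
  have s5 : ∑ c, (DL a b c + DL b a c - DL c a b) * ψu c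
      = 2 * (∑ c, ψu c * (1 / 2 * (DL a b c + DL b a c))) - ∑ c, ψu c * DL c a b := by
    rw [Finset.mul_sum, ← Finset.sum_sub_distrib]
    exact Finset.sum_congr rfl fun c _ => by ring
  have s6 : ∑ c, pR c * ψu c = ∑ c, ψu c * pR c := Finset.sum_congr rfl fun c _ => mul_comm _ _
  rw [s1, s2, s2, s3, s5, s6, hX b a, hHR b a]
  simp only [sub_mul, Finset.sum_sub_distrib, Finset.sum_add_distrib, s4]
  ring

lemma hessian_symm {U : Set Pt} {G : Pt → Matrix Idx Idx ℝ} (hG : IsSmoothMetric U G)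
    (hU : IsOpen U) {f : Pt → ℝ} (hf : ContDiffOn ℝ ∞ f U) {x : Pt} (hx : x ∈ U) (a b : Idx) :
    covD G (covD G (scal f)) x ![a, b] = covD G (covD G (scal f)) x ![b, a] := by
  have h1 : ∀ e, (fun y => covD G (scal f) y ![e]) = pd e f := fun e => by
    funext y; rw [covD_rank0]; rfl
  have h2 : ∀ k, chr G x k a b = chr G x k b a := fun k =>
    (hG.rep_Γ hU k a b).eq (F' := fun x => chr G x k b a)
      ((hG.isLeviCivita hU).torsionFree k a b ▸ hG.rep_Γ hU k b a) hx
  simp only [covD_rank1, h1, h2]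
  rw [pd_comm hU hf a b hx]

/-- The equation for φ_{ab} is written with d, T and L, whereas the commutator produces Riemann and
∇L. The mismatch consists of P and Δ, which therefore enter beside the terms linear in Q. -/
theorem box_Q2 {U : Set Pt} (hU : IsOpen U) {u : Pt → State} (hu : IsAdmissible U u)
    (hs : HasFieldSymmetries U u) (hE : UnphysicalEinstein u U) (hw : SolvesScalarWaveEqs u U)
    {x : Pt} (hx : x ∈ U) (a b : Idx) :
    box (metric u) (Q2 u) x ![a, b]
      = rhsQ2 u (scalarCurv (metric u)) x ![a, b] + termP u x ![a, b] := by
  have hG := hu.isSmoothMetric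
  have hφ := hu.contDiffOn_apply .phi
  refine (hG.box_sub_hessian hU (f := fun y => u y .phi) hφ
    (fun y hy => by rw [(hw y hy).1, rhsPhi]; ring) (L := LF u)
    (fun a b => hu.contDiffOn_apply (.L a b)) hE (S := fun y => phi2Of (u y))
    (fun a b => hu.contDiffOn_apply (.phi2 a b)) hx a b).trans ?_
  rw [(hw x hx).2.2]
  have hgs : ∀ a b, gOf (u x) a b = gOf (u x) b a := hG.symm x hx
  have hgi : ∀ a b, ∑ k, gOf (u x) a k * (gOf (u x))⁻¹ k b = if a = b then 1 else 0 :=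
    fun a b => hG.mul_inv hx a b
  have hXs := fun a b => hessian_symm hG hU hφ hx a b
  have hups : ∀ T : Tensor 2, (∀ a b, T ![a, b] = T ![b, a]) → ∀ c e,
      up2 (u x) T c e = up2 (u x) T e c := fun T hT c e => by
    simp only [up2_eq, Finset.mul_sum]
    rw [Finset.sum_comm]
    exact Finset.sum_congr rfl fun k _ => Finset.sum_congr rfl fun l _ => by rw [hT]; ring
  have hsc : ContDiffOn ℝ ∞ (scalarCurv (metric u)) U := (hG.rep_scalarCurv hU).contDiffOn
  set X : Tensor 2 := covD (metric u) (covD (metric u) (scal fun y => u y .phi)) x with hX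
  have f1 : ∀ a c, ∑ e, gOf (u x) a e * up2 (u x) X c e = mix2 (u x) X a c := fun a c => by
    have t : ∀ e, up2 (u x) X c e
        = ∑ l, (gOf (u x))⁻¹ e l * ∑ k, (gOf (u x))⁻¹ c k * X ![k, l] := fun e => by
      simp only [up2_eq, Finset.mul_sum]
      rw [Finset.sum_comm]
      exact Finset.sum_congr rfl fun k _ => Finset.sum_congr rfl fun l _ => by ring
    simp only [t, sum_metric_inverse_mul hgi fun l => ∑ k, (gOf (u x))⁻¹ c k * X ![k, l], mix2_eq]
    exact Finset.sum_congr rfl fun k _ => by rw [hXs]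
  have f3 : ∀ a b, ∑ c, gOf (u x) a c * mix2 (u x) X b c = X ![b, a] := fun a b => by
    simp only [mix2_eq, sum_metric_inverse_mul hgi fun k => X ![b, k]]
  -- The trace of the Hessian is □φ, so this is the wave equation for φ.
  have f2 : ∑ c, ∑ e, gOf (u x) c e * up2 (u x) X c e
      = 1 / 6 * scalarCurv (metric u) x * u x .phi := by
    simp only [f1, mix2_eq]
    exact (hw x hx).1
  have hD := hs x hx
  have key := hessian_identity (g := gOf (u x)) (L := fun a b => LOf (u x) ![a, b])
    (X := fun a b => X ![a, b]) (q := fun a b => phi2Of (u x) ![a, b])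
    (Xm := mix2 (u x) X) (qm := mix2 (u x) (phi2Of (u x)))
    (Xup := up2 (u x) X) (qup := up2 (u x) (phi2Of (u x)))
    (HR := fun a b => covD (metric u) (covD (metric u) (scal (scalarCurv (metric u)))) x ![a, b])
    (Ric := ricci (metric u) x) (Rm := riemLow (metric u) x)
    (P := fun a b c e => PZero u x ![a, b, c, e]) (d := fun a b c e => dOf (u x) ![a, b, c, e])
    (C := fun a b c => cottonF u x ![a, b, c]) (Δ := fun a b c => Delta u x ![a, b, c])
    (DL := fun a b c => covD (metric u) (LF u) x ![a, b, c])
    (p := fun a => phi1Of (u x) ![a]) (pu := phi1Up (u x))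
    (ψ := fun a => pd a (fun y => u y .phi) x)
    (ψu := fun c => ∑ k, (gOf (u x))⁻¹ c k * pd k (fun y => u y .phi) x)
    (v := dXiUp u x) (pR := fun a => pd a (scalarCurv (metric u)) x)
    (R := scalarCurv (metric u) x) (φ := u x .phi) (Ξ := u x .Xi)
    hD.1 hXs hgs (fun a b => hessian_symm hG hU hsc hx a b) (hups X hXs)
    (hups (phi2Of (u x)) hD.2.1)
    -- Symmetry of L is used on all of `U`, not only at `x`, because it is differentiated.
    (fun a b c => by
      have t : ∀ y ∈ U, LF u y ![b, c] = LF u y ![c, b] := fun y hy => (hs y hy).1 b c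
      have t' : ∀ b c, LF u x ![b, c] = LF u x ![c, b] := hD.1
      simp only [covD_rank2, pd_congr hU t a hx, t' _ c, t' b]
      ring)
    hD.2.2.1 hD.2.2.2.2.1 (hE x hx) (fun _ _ _ _ => rfl) (fun _ _ _ => rfl) f1 f2 f3 a b
  have hQm : ∀ a c, mix2 (u x) (Q2 u x) a c
      = mix2 (u x) (phi2Of (u x)) a c - mix2 (u x) X a c := fun a c => by
    simp only [mix2_eq, ← Finset.sum_sub_distrib, ← mul_sub]; rfl
  have hQup : ∀ a c, up2 (u x) (Q2 u x) a c
      = up2 (u x) (phi2Of (u x)) a c - up2 (u x) X a c := fun a c => by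
    simp only [up2_eq, ← Finset.sum_sub_distrib, ← mul_sub]; rfl
  have hQ1 : ∀ b, Q1 u x ![b] = phi1Of (u x) ![b] - pd b (fun y => u y .phi) x := fun b => by
    rw [Q1, covD_rank0]; rfl
  have hQu : ∀ c, upV (u x) (fun c => Q1 u x ![c]) c = phi1Up (u x) c
      - ∑ k, (gOf (u x))⁻¹ c k * pd k (fun y => u y .phi) x := fun c => by
    simp only [upV, hQ1, mul_sub, Finset.sum_sub_distrib, phi1Up, raise_rank1]
  refine Eq.trans ?_ (key.trans ?_)
  · simp only [rhsPhi2, up2_eq, mix2_eq]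
    rfl
  · simp only [rhsQ2, termP, hQm, hQup, hQu]
    simp only [hQ1]
    rfl

/-! ### Smooth functions of the state -/

/-- `f` is smooth on the regular states. -/
abbrev SmoothSt (f : State → ℝ) : Prop := ContDiffOn ℝ ∞ f regularStates

lemma smoothSt_apply (i : Comp) : SmoothSt fun y => y i :=
  (contDiff_apply ℝ ℝ i).contDiffOn

lemma smoothSt_const (c : ℝ) : SmoothSt fun _ => c := contDiffOn_const

lemma SmoothSt.add {f f' : State → ℝ} (h : SmoothSt f) (h' : SmoothSt f') :
    SmoothSt fun y => f y + f' y := ContDiffOn.add h h'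

lemma SmoothSt.sub {f f' : State → ℝ} (h : SmoothSt f) (h' : SmoothSt f') :
    SmoothSt fun y => f y - f' y := ContDiffOn.sub h h'

lemma SmoothSt.mul {f f' : State → ℝ} (h : SmoothSt f) (h' : SmoothSt f') :
    SmoothSt fun y => f y * f' y := ContDiffOn.mul h h'

lemma SmoothSt.pow {f : State → ℝ} (h : SmoothSt f) (n : ℕ) :
    SmoothSt fun y => f y ^ n := ContDiffOn.pow h n

lemma SmoothSt.sum {ι : Type*} {s : Finset ι} {f : ι → State → ℝ} (h : ∀ i, SmoothSt (f i)) :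
    SmoothSt fun y => ∑ i ∈ s, f i y := ContDiffOn.sum fun i _ => h i

lemma smoothSt_metric (a b : Idx) : SmoothSt fun y => gOf y a b := smoothSt_apply (.g a b)

lemma smoothSt_LOf (i : Fin 2 → Idx) : SmoothSt fun y => LOf y i := smoothSt_apply _

lemma smoothSt_dOf (i : Fin 4 → Idx) : SmoothSt fun y => dOf y i := smoothSt_apply _

lemma smoothSt_phi1Of (i : Fin 1 → Idx) : SmoothSt fun y => phi1Of y i := smoothSt_apply _

lemma smoothSt_phi2Of (i : Fin 2 → Idx) : SmoothSt fun y => phi2Of y i := smoothSt_apply _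

lemma smoothSt_inv (a b : Idx) : SmoothSt fun y => (gOf y)⁻¹ a b :=
  contDiffOn_inv_apply (fun i j => smoothSt_metric i j) (fun _ hy => hy.1) a b

lemma smoothSt_cottonFactor :
    SmoothSt fun y => (1 - 1 / 4 * y .Xi ^ 2 * y .phi ^ 2)⁻¹ :=
  ContDiffOn.inv ((smoothSt_const 1).sub (((smoothSt_const (1 / 4)).mul
    ((smoothSt_apply .Xi).pow 2)).mul ((smoothSt_apply .phi).pow 2))) fun _ hy => hy.2

/-- The absolute value is written as the square root of det², so both roots are taken away from
zero. -/
lemma smoothSt_vol (a b c d : Idx) : SmoothSt fun y => vol (gOf y) a b c d := by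
  have hd : SmoothSt fun y => (gOf y).det := contDiffOn_det fun i j => smoothSt_metric i j
  refine SmoothSt.mul ?_ (smoothSt_const _)
  have h1 : SmoothSt fun y => Real.sqrt ((gOf y).det ^ 2) :=
    ContDiffOn.sqrt (hd.pow 2) fun y hy => pow_ne_zero 2 hy.1
  simp only [Real.sqrt_sq_eq_abs] at h1
  exact ContDiffOn.sqrt h1 fun y hy => abs_ne_zero.2 hy.1

lemma smoothSt_phi1Up (a : Idx) : SmoothSt fun y => phi1Up y a := by
  simp only [phi1Up, raise]
  exact SmoothSt.sum fun _ => (smoothSt_inv _ _).mul (smoothSt_phi1Of _)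

lemma smoothSt_upV (v : Idx → ℝ) (a : Idx) : SmoothSt fun y => upV y v a :=
  SmoothSt.sum fun _ => (smoothSt_inv _ _).mul (smoothSt_const _)

lemma smoothSt_emT (i : Fin 2 → Idx) : SmoothSt fun y => emT y i := by
  refine SmoothSt.add (SmoothSt.sub (SmoothSt.sub ?_ ?_) ?_) ?_
  · exact (smoothSt_phi1Of _).mul (smoothSt_phi1Of _)
  · exact ((smoothSt_const _).mul (smoothSt_metric _ _)).mul
      (SmoothSt.sum fun c => (smoothSt_phi1Of _).mul (smoothSt_phi1Up _))
  · exact ((smoothSt_const _).mul (smoothSt_apply _)).mul (smoothSt_phi2Of _)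
  · exact ((smoothSt_const _).mul ((smoothSt_apply _).pow 2)).mul (smoothSt_LOf _)

lemma smoothSt_cotton (v : Idx → ℝ) (i : Fin 3 → Idx) : SmoothSt fun y => cotton y v i := by
  simp only [cotton]
  refine SmoothSt.mul smoothSt_cottonFactor ?_
  repeat' first
    | with_reducible exact smoothSt_const _
    | with_reducible exact smoothSt_apply _
    | with_reducible exact smoothSt_metric _ _
    | with_reducible exact smoothSt_LOf _
    | with_reducible exact smoothSt_dOf _
    | with_reducible exact smoothSt_phi1Of _
    | with_reducible exact smoothSt_phi2Of _
    | with_reducible exact smoothSt_phi1Up _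
    | with_reducible exact smoothSt_upV _ _
    | with_reducible exact smoothSt_emT _
    | with_reducible refine SmoothSt.add ?_ ?_
    | with_reducible refine SmoothSt.sub ?_ ?_
    | with_reducible refine SmoothSt.mul ?_ ?_
    | with_reducible refine SmoothSt.pow ?_ _
    | with_reducible refine SmoothSt.sum fun _ => ?_

lemma smoothSt_dual3 {T : State → Tensor 3} (hT : ∀ i, SmoothSt fun y => T y i)
    (i : Fin 3 → Idx) : SmoothSt fun y => dual3 (gOf y) (T y) i :=
  (smoothSt_const _).mul <| SmoothSt.sum fun _ => SmoothSt.sum fun _ => SmoothSt.sum fun _ =>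
    SmoothSt.sum fun _ => (((smoothSt_vol _ _ _ _).mul (smoothSt_inv _ _)).mul
      (smoothSt_inv _ _)).mul (hT _)

lemma isOpen_regularStates : IsOpen regularStates := by
  have hc : ∀ i : Comp, Continuous fun y : State => y i := fun i => continuous_apply i
  have hd : Continuous fun y : State => (gOf y).det :=
    Continuous.matrix_det (continuous_matrix fun i j => hc (.g i j))
  exact (isOpen_ne_fun hd continuous_const).inter
    (isOpen_ne_fun (continuous_const.sub ((continuous_const.mul ((hc .Xi).pow 2)).mul
      ((hc .phi).pow 2))) continuous_const)

lemma IsAdmissible.mem_regularStates {U : Set Pt} {u : Pt → State} (hu : IsAdmissible U u)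
    {x : Pt} (hx : x ∈ U) : u x ∈ regularStates :=
  ⟨(hu.2 x hx).1.det_ne_zero, (hu.2 x hx).2⟩

lemma IsAdmissible.contDiffOn_comp {U : Set Pt} {u : Pt → State} (hu : IsAdmissible U u)
    {f : State → ℝ} (hf : SmoothSt f) : ContDiffOn ℝ ∞ (fun x => f (u x)) U :=
  hf.comp hu.1 fun _ hx => hu.mem_regularStates hx

/-! ### Functionals depending smoothly on the first jet of the unknowns -/

/-- `Φ[u](x)` is a smooth function of `(x, u, ∂u)`. -/
def IsJet (U : Set Pt) (Φ : (Pt → State) → Pt → ℝ) : Prop :=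
  ∃ N : Pt × State × Jet → ℝ, ContDiffOn ℝ ∞ N (jetDomain U) ∧
    ∀ u, IsAdmissible U u → ∀ x ∈ U, Φ u x = N (x, u x, jet u x)

namespace IsJet

variable {U : Set Pt} {Φ Ψ : (Pt → State) → Pt → ℝ}

/-- Agreement is required only for admissible unknowns at points of `U`. Identities between
functionals may therefore use smoothness and the symmetry of the metric, although `N` is also
defined on jets without them. -/
lemma congr (h : IsJet U Φ) (hΨ : ∀ u, IsAdmissible U u → ∀ x ∈ U, Ψ u x = Φ u x) :
    IsJet U Ψ := by
  obtain ⟨N, hN, h⟩ := h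
  exact ⟨N, hN, fun u hu x hx => (hΨ u hu x hx).trans (h u hu x hx)⟩

lemma const (c : ℝ) : IsJet U fun _ _ => c := ⟨fun _ => c, contDiffOn_const, fun _ _ _ _ => rfl⟩

lemma add (h : IsJet U Φ) (h' : IsJet U Ψ) : IsJet U fun u x => Φ u x + Ψ u x := by
  obtain ⟨N, hN, h⟩ := h
  obtain ⟨N', hN', h'⟩ := h'
  exact ⟨_, hN.add hN', fun u hu x hx => by
    simp only [h u hu x hx, h' u hu x hx]⟩

lemma sub (h : IsJet U Φ) (h' : IsJet U Ψ) : IsJet U fun u x => Φ u x - Ψ u x := by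
  obtain ⟨N, hN, h⟩ := h
  obtain ⟨N', hN', h'⟩ := h'
  exact ⟨_, hN.sub hN', fun u hu x hx => by
    simp only [h u hu x hx, h' u hu x hx]⟩

lemma mul (h : IsJet U Φ) (h' : IsJet U Ψ) : IsJet U fun u x => Φ u x * Ψ u x := by
  obtain ⟨N, hN, h⟩ := h
  obtain ⟨N', hN', h'⟩ := h'
  exact ⟨_, hN.mul hN', fun u hu x hx => by
    simp only [h u hu x hx, h' u hu x hx]⟩

lemma neg (h : IsJet U Φ) : IsJet U fun u x => -Φ u x :=
  ((const (-1)).mul h).congr fun _ _ _ _ => by ring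

lemma pow (h : IsJet U Φ) (n : ℕ) : IsJet U fun u x => Φ u x ^ n := by
  obtain ⟨N, hN, h⟩ := h
  exact ⟨_, hN.pow n, fun u hu x hx => by simp only [h u hu x hx]⟩

lemma sum {ι : Type*} {s : Finset ι} {Φ : ι → (Pt → State) → Pt → ℝ} (h : ∀ i, IsJet U (Φ i)) :
    IsJet U fun u x => ∑ i ∈ s, Φ i u x := by
  choose N hN h using h
  exact ⟨fun q => ∑ i ∈ s, N i q, ContDiffOn.sum fun i _ => hN i,
    fun u hu x hx => Finset.sum_congr rfl fun i _ => h i u hu x hx⟩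

lemma of_point {f : Pt → ℝ} (hf : ContDiffOn ℝ ∞ f U) : IsJet U fun _ x => f x :=
  ⟨fun q => f q.1, hf.comp contDiff_fst.contDiffOn fun _ hq => hq.1, fun _ _ _ _ => rfl⟩

lemma of_state {f : State → ℝ} (hf : SmoothSt f) : IsJet U fun u x => f (u x) :=
  ⟨fun q => f q.2.1, hf.comp (contDiff_fst.comp contDiff_snd).contDiffOn fun _ hq => hq.2.1,
    fun _ _ _ _ => rfl⟩

lemma pd_apply (i : Comp) (μ : Idx) : IsJet U fun u x => pd μ (fun y => u y i) x :=
  ⟨fun q => q.2.2 i μ, by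
    have h1 : ContDiff ℝ ∞ fun q : Pt × State × Jet => q.2.2 i μ :=
      (contDiff_apply_apply ℝ ℝ i μ).comp (contDiff_snd.comp contDiff_snd)
    exact h1.contDiffOn, fun _ _ _ _ => rfl⟩

/-- The coordinate derivatives of a smooth function of the state. -/
lemma pd_of_state (hU : IsOpen U) {f : State → ℝ} (hf : SmoothSt f) (μ : Idx) :
    IsJet U fun u x => pd μ (fun y => f (u y)) x := by
  -- Chain rule: the derivative of f at the state, applied to the jet in direction μ.
  refine ⟨fun q => fderiv ℝ f q.2.1 fun i => q.2.2 i μ, ?_, fun u hu x hx => ?_⟩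
  · have h1 : ContDiffOn ℝ ∞ (fderiv ℝ f) regularStates :=
      hf.fderiv_of_isOpen isOpen_regularStates (by simp)
    have h2 : ContDiff ℝ ∞ fun q : Pt × State × Jet => fun i => q.2.2 i μ :=
      contDiff_pi.2 fun i => (contDiff_apply_apply ℝ ℝ i μ).comp (contDiff_snd.comp contDiff_snd)
    exact (h1.comp (contDiff_fst.comp contDiff_snd).contDiffOn fun _ hq => hq.2.1).clm_apply
      h2.contDiffOn
  · have h1 : DifferentiableAt ℝ f (u x) :=
      (hf.contDiffAt (isOpen_regularStates.mem_nhds (hu.mem_regularStates hx))).differentiableAt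
        (by simp)
    have h2 : DifferentiableAt ℝ u x :=
      (hu.1.contDiffAt (hU.mem_nhds hx)).differentiableAt (by simp)
    have h3 : (fun i => jet u x i μ) = fderiv ℝ u x (Pi.single μ 1) := by
      funext i
      rw [jet, pd, fderiv_apply h2 i]
      rfl
    change fderiv ℝ (f ∘ u) x _ = _
    rw [fderiv_comp x h1 h2]
    exact congrArg (fderiv ℝ f (u x)) h3.symm

end IsJet

/-! ### Second derivatives of the metric in the curvature and in the wave operator -/

namespace IsJet

variable {U : Set Pt}

lemma metric_apply (a b : Idx) : IsJet U fun u x => metric u x a b :=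
  of_state (smoothSt_metric a b)

lemma inv_apply (a b : Idx) : IsJet U fun u x => (metric u x)⁻¹ a b :=
  of_state (smoothSt_inv a b)

lemma pd_metric (e a b : Idx) : IsJet U fun u x => pd e (fun y => metric u y a b) x :=
  pd_apply (.g a b) e

lemma pd_inv (hU : IsOpen U) (e a b : Idx) :
    IsJet U fun u x => pd e (fun y => (metric u y)⁻¹ a b) x :=
  pd_of_state hU (smoothSt_inv a b) e

lemma chr (a b c : Idx) : IsJet U fun u x => chr (metric u) x a b c :=
  (const _).mul (sum fun _ => (inv_apply _ _).mul
    (((pd_metric _ _ _).add (pd_metric _ _ _)).sub (pd_metric _ _ _)))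

end IsJet

section

variable {U : Set Pt}

/-- `∂_e ∂_f g_{ab}`. -/
def ddg (u : Pt → State) (x : Pt) (e f a b : Idx) : ℝ :=
  pd e (pd f fun y => metric u y a b) x

/-- The part of `∂_e Γ^a{}_{bc}` of second order in the metric. -/
def dchrTop (u : Pt → State) (x : Pt) (e a b c : Idx) : ℝ :=
  1 / 2 * ∑ d, (metric u x)⁻¹ a d * (ddg u x e b d c + ddg u x e c b d - ddg u x e d b c)

lemma IsAdmissible.differentiableAt_pd {u : Pt → State} (hu : IsAdmissible U u) (hU : IsOpen U)
    {x : Pt} (hx : x ∈ U) (i : Comp) (μ : Idx) :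
    DifferentiableAt ℝ (pd μ fun y => u y i) x :=
  differentiableAt_of_contDiffOn hU ((hu.contDiffOn_apply i).pd hU μ) hx

lemma IsAdmissible.contDiffOn_chr {u : Pt → State} (hu : IsAdmissible U u) (hU : IsOpen U)
    (a b c : Idx) : ContDiffOn ℝ ∞ (fun x => chr (metric u) x a b c) U :=
  (hu.isSmoothMetric.rep_Γ hU a b c).contDiffOn

/-- By the product rule the remainder is a first derivative of the inverse metric times first
derivatives of the metric. -/
lemma isJet_pd_chr_sub (hU : IsOpen U) (e a b c : Idx) :
    IsJet U fun u x => pd e (fun y => chr (metric u) y a b c) x - dchrTop u x e a b c := by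
  have h1 : IsJet U fun u x => 1 / 2 * ∑ d,
      (pd b (fun y => metric u y d c) x + pd c (fun y => metric u y b d) x
        - pd d (fun y => metric u y b c) x) * pd e (fun y => (metric u y)⁻¹ a d) x :=
    (IsJet.const _).mul (IsJet.sum fun d => (((IsJet.pd_metric _ _ _).add
      (IsJet.pd_metric _ _ _)).sub (IsJet.pd_metric _ _ _)).mul (IsJet.pd_inv hU _ _ _))
  refine h1.congr fun u hu x hx => ?_
  have hi : ∀ d, DifferentiableAt ℝ (fun y => (metric u y)⁻¹ a d) x := fun d =>
    differentiableAt_of_contDiffOn hU (hu.isSmoothMetric.smooth_inv a d) hx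
  have hp : ∀ a b c, DifferentiableAt ℝ (pd c fun y => metric u y a b) x := fun a b c =>
    hu.differentiableAt_pd hU hx (.g a b) c
  have hs : ∀ d, DifferentiableAt ℝ (fun y => pd b (fun y => metric u y d c) y
      + pd c (fun y => metric u y b d) y - pd d (fun y => metric u y b c) y) x := fun d =>
    ((hp d c b).fun_add (hp b d c)).sub (hp b c d)
  unfold chr
  rw [pd_const_mul (DifferentiableAt.fun_sum fun d _ => (hi d).fun_mul (hs d)),
    pd_sum _ fun d => (hi d).fun_mul (hs d), dchrTop, ← mul_sub, ← Finset.sum_sub_distrib]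
  congr 1
  refine Finset.sum_congr rfl fun d _ => ?_
  rw [pd_mul (hi d) (hs d), pd_sub ((hp d c b).fun_add (hp b d c)) (hp b c d),
    pd_add (hp d c b) (hp b d c)]
  simp only [ddg]; ring

lemma isJet_ricci_sub (hU : IsOpen U) (b d : Idx) :
    IsJet U fun u x => ricci (metric u) x b d
      - ∑ a, (dchrTop u x a a d b - dchrTop u x d a a b) := by
  have h1 : IsJet U fun u x => ∑ a, ((pd a (fun y => chr (metric u) y a d b) x
      - dchrTop u x a a d b) - (pd d (fun y => chr (metric u) y a a b) x - dchrTop u x d a a b)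
      + ∑ e, (chr (metric u) x a a e * chr (metric u) x e d b
        - chr (metric u) x a d e * chr (metric u) x e a b)) :=
    IsJet.sum fun a => ((isJet_pd_chr_sub hU _ _ _ _).sub (isJet_pd_chr_sub hU _ _ _ _)).add
      (IsJet.sum fun e => ((IsJet.chr _ _ _).mul (IsJet.chr _ _ _)).sub
        ((IsJet.chr _ _ _).mul (IsJet.chr _ _ _)))
  refine h1.congr fun u hu x hx => ?_
  rw [ricci, ← Finset.sum_sub_distrib]
  refine Finset.sum_congr rfl fun a _ => ?_
  rw [riem]; ring

lemma isJet_covDVec_contrChr_sub (hU : IsOpen U) (ν σ : Idx) :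
    IsJet U fun u x => covDVec (metric u) (contrChr (metric u)) x ν σ
      - ∑ a, ∑ b, (metric u x)⁻¹ a b * dchrTop u x ν σ a b := by
  have h1 : IsJet U fun u x => ∑ a, ∑ b, ((metric u x)⁻¹ a b *
      (pd ν (fun y => chr (metric u) y σ a b) x - dchrTop u x ν σ a b)
      + chr (metric u) x σ a b * pd ν (fun y => (metric u y)⁻¹ a b) x)
      + ∑ k, chr (metric u) x σ ν k * ∑ a, ∑ b, (metric u x)⁻¹ a b * chr (metric u) x k a b :=
    (IsJet.sum fun a => IsJet.sum fun b => ((IsJet.inv_apply _ _).mul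
      (isJet_pd_chr_sub hU _ _ _ _)).add ((IsJet.chr _ _ _).mul (IsJet.pd_inv hU _ _ _))).add
      (IsJet.sum fun k => (IsJet.chr _ _ _).mul
        (IsJet.sum fun a => IsJet.sum fun b => (IsJet.inv_apply _ _).mul (IsJet.chr _ _ _)))
  refine h1.congr fun u hu x hx => ?_
  have hi : ∀ a b, DifferentiableAt ℝ (fun y => (metric u y)⁻¹ a b) x := fun a b =>
    differentiableAt_of_contDiffOn hU (hu.isSmoothMetric.smooth_inv a b) hx
  have hc : ∀ a b, DifferentiableAt ℝ (fun y => chr (metric u) y σ a b) x := fun a b =>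
    differentiableAt_of_contDiffOn hU (hu.contDiffOn_chr hU σ a b) hx
  simp only [covDVec, contrChr]
  rw [pd_sum _ fun a => DifferentiableAt.fun_sum fun b _ => (hi a b).fun_mul (hc a b),
    add_sub_right_comm, ← Finset.sum_sub_distrib]
  congr 1
  refine Finset.sum_congr rfl fun a _ => ?_
  rw [pd_sum _ fun b => (hi a b).fun_mul (hc a b), ← Finset.sum_sub_distrib]
  refine Finset.sum_congr rfl fun b _ => ?_
  rw [pd_mul (hi a b) (hc a b)]; ring

lemma ddg_swap_left {u : Pt → State} (hu : IsAdmissible U u) (hU : IsOpen U) {x : Pt}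
    (hx : x ∈ U) (e f a b : Idx) : ddg u x e f a b = ddg u x f e a b :=
  pd_comm hU (hu.contDiffOn_apply (.g a b)) e f hx

lemma ddg_swap_right {u : Pt → State} (hu : IsAdmissible U u) (hU : IsOpen U) {x : Pt}
    (hx : x ∈ U) (e f a b : Idx) : ddg u x e f a b = ddg u x e f b a :=
  pd_congr hU (fun _ hy => pd_congr hU (fun _ hz => hu.isSmoothMetric.symm _ hz a b) f hy) e hx

/-- Lowering the upper index of the top order part of `∂_a Γ^σ`. -/
lemma sum_metric_dchrTop {u : Pt → State} (hu : IsAdmissible U u) {x : Pt}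
    (hx : x ∈ U) (a τ : Idx) :
    ∑ σ, metric u x σ τ * ∑ m, ∑ d, (metric u x)⁻¹ m d * dchrTop u x a σ m d
      = 1 / 2 * ∑ m, ∑ d, (metric u x)⁻¹ m d *
        (ddg u x a m τ d + ddg u x a d m τ - ddg u x a τ m d) := by
  have hG := hu.isSmoothMetric
  have h1 : ∀ m d, ∑ σ, metric u x σ τ * dchrTop u x a σ m d
      = 1 / 2 * (ddg u x a m τ d + ddg u x a d m τ - ddg u x a τ m d) := fun m d => by
    rw [← sum_metric_inverse_mul (fun a b => hG.mul_inv hx a b)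
      (fun τ => ddg u x a m τ d + ddg u x a d m τ - ddg u x a τ m d) τ, Finset.mul_sum]
    exact Finset.sum_congr rfl fun σ _ => by rw [dchrTop, hG.symm x hx σ τ]; ring
  simp only [Finset.mul_sum]
  rw [Finset.sum_comm]
  refine Finset.sum_congr rfl fun m _ => ?_
  rw [Finset.sum_comm]
  refine Finset.sum_congr rfl fun d _ => ?_
  have := congrArg (fun z => (metric u x)⁻¹ m d * z) (h1 m d)
  simp only [Finset.mul_sum] at this
  rw [← mul_assoc, mul_comm (1 / 2 : ℝ), mul_assoc, ← this]
  exact Finset.sum_congr rfl fun σ _ => by ring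

lemma sum_dchrTop_ricci {u : Pt → State} (x : Pt) (a τ : Idx) :
    ∑ m, (dchrTop u x m m a τ - dchrTop u x a m m τ)
      = 1 / 2 * ∑ m, ∑ d, (metric u x)⁻¹ m d *
        (ddg u x m a d τ + ddg u x m τ a d - ddg u x m d a τ
          - (ddg u x a m d τ + ddg u x a τ m d - ddg u x a d m τ)) := by
  rw [Finset.mul_sum]
  refine Finset.sum_congr rfl fun m _ => ?_
  rw [dchrTop, dchrTop, ← mul_sub, ← Finset.sum_sub_distrib]
  exact congrArg _ (Finset.sum_congr rfl fun d _ => by ring)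

/-- The second derivatives of the metric cancel in the reduced wave operator. -/
lemma dchrTop_cancel {u : Pt → State} (hu : IsAdmissible U u) (hU : IsOpen U) {x : Pt}
    (hx : x ∈ U) (k a : Idx) :
    ∑ e, ∑ f, (metric u x)⁻¹ e f * dchrTop u x e k f a
      + ∑ τ, (metric u x)⁻¹ τ k * (∑ m, (dchrTop u x m m a τ - dchrTop u x a m m τ)
        - ∑ σ, metric u x σ τ * ∑ m, ∑ d, (metric u x)⁻¹ m d * dchrTop u x a σ m d) = 0 := by
  have hG := hu.isSmoothMetric
  have h1 : ∑ e, ∑ f, (metric u x)⁻¹ e f * dchrTop u x e k f a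
      = ∑ τ, (metric u x)⁻¹ τ k * (1 / 2 * ∑ e, ∑ f, (metric u x)⁻¹ e f *
        (ddg u x e f τ a + ddg u x e a f τ - ddg u x e τ f a)) := by
    simp only [dchrTop, Finset.mul_sum]
    rw [Finset.sum_congr rfl fun e _ => Finset.sum_comm, Finset.sum_comm]
    exact Finset.sum_congr rfl fun τ _ => Finset.sum_congr rfl fun e _ =>
      Finset.sum_congr rfl fun f _ => by rw [hG.symm_inv hx k τ]; ring
  simp only [h1, sum_metric_dchrTop hu hx, sum_dchrTop_ricci, ← Finset.sum_add_distrib, ← mul_add,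
    ← mul_sub, ← Finset.sum_sub_distrib]
  refine Finset.sum_eq_zero fun τ _ => ?_
  rw [Finset.sum_eq_zero, mul_zero, mul_zero]
  refine fun m _ => Finset.sum_eq_zero fun d _ => ?_
  -- With the inverse metrics factored out, the cancellation holds for each pair `m`, `d`
  -- separately, by symmetry of ∂∂ and of g alone.
  linear_combination (metric u x)⁻¹ m d * (ddg_swap_right hu hU hx m d τ a
    + 2 * ddg_swap_left hu hU hx m a d τ - ddg_swap_right hu hU hx m τ d a
    - ddg_swap_right hu hU hx a m τ d)

end

/-! ### Principal parts of the reduced Ricci and reduced wave operators -/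

section

variable {U : Set Pt}

lemma isJet_covDVec (hU : IsOpen U) {F : Pt → Idx → ℝ} (hF : ContDiffOn ℝ ∞ F U) (ν σ : Idx) :
    IsJet U fun u x => covDVec (metric u) F x ν σ := by
  have h1 : ∀ σ, ContDiffOn ℝ ∞ (fun x => F x σ) U := fun σ =>
    (contDiff_apply ℝ ℝ σ).comp_contDiffOn hF
  exact (IsJet.of_point ((h1 σ).pd hU ν)).add
    (IsJet.sum fun k => (IsJet.chr _ _ _).mul (IsJet.of_point (h1 k)))

/-- The reduced Ricci operator is `-½ g^{στ} ∂_σ ∂_τ g_{μν}` up to terms of first order. -/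
lemma isJet_redRicci_add (hU : IsOpen U) {F : Pt → Idx → ℝ} (hF : ContDiffOn ℝ ∞ F U)
    (μ ν : Idx) :
    IsJet U fun u x => redRicci (metric u) F x μ ν + 1 / 2 * principal u x (.g μ ν) := by
  have h1 : IsJet U fun u x =>
      (ricci (metric u) x μ ν - ∑ a, (dchrTop u x a a ν μ - dchrTop u x ν a a μ))
      - 1 / 2 * ∑ σ, (metric u x σ μ * (covDVec (metric u) (contrChr (metric u)) x ν σ
          - ∑ a, ∑ b, (metric u x)⁻¹ a b * dchrTop u x ν σ a b)
        + metric u x σ ν * (covDVec (metric u) (contrChr (metric u)) x μ σ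
          - ∑ a, ∑ b, (metric u x)⁻¹ a b * dchrTop u x μ σ a b))
      + 1 / 2 * ∑ σ, (metric u x σ μ * covDVec (metric u) F x ν σ
        + metric u x σ ν * covDVec (metric u) F x μ σ) :=
    ((isJet_ricci_sub hU _ _).sub ((IsJet.const _).mul (IsJet.sum fun σ =>
      ((IsJet.metric_apply _ _).mul (isJet_covDVec_contrChr_sub hU _ _)).add
      ((IsJet.metric_apply _ _).mul (isJet_covDVec_contrChr_sub hU _ _))))).add
      ((IsJet.const _).mul (IsJet.sum fun σ =>
      ((IsJet.metric_apply _ _).mul (isJet_covDVec hU hF _ _)).add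
      ((IsJet.metric_apply _ _).mul (isJet_covDVec hU hF _ _))))
  refine h1.congr fun u hu x hx => ?_
  have h2 : principal u x (.g μ ν) = ∑ m, ∑ d, (metric u x)⁻¹ m d * ddg u x m d μ ν := rfl
  -- The terms of the Ricci tensor and of the symmetrised ∇Γ match only after the two traced indices
  -- are interchanged; symmetry of the inverse metric permits this.
  have h3 : ∀ W : Idx → Idx → ℝ, ∑ m, ∑ d, (metric u x)⁻¹ m d * W m d
      = ∑ m, ∑ d, (metric u x)⁻¹ m d * W d m := fun W => by
    rw [Finset.sum_comm]
    exact Finset.sum_congr rfl fun m _ => Finset.sum_congr rfl fun d _ => by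
      rw [hu.isSmoothMetric.symm_inv hx]
  have h4 : ∑ a, (dchrTop u x a a ν μ - dchrTop u x ν a a μ)
      - 1 / 2 * (∑ σ, metric u x σ μ * ∑ a, ∑ b, (metric u x)⁻¹ a b * dchrTop u x ν σ a b
        + ∑ σ, metric u x σ ν * ∑ a, ∑ b, (metric u x)⁻¹ a b * dchrTop u x μ σ a b)
      + 1 / 2 * principal u x (.g μ ν) = 0 := by
    rw [sum_metric_dchrTop hu hx, sum_metric_dchrTop hu hx, sum_dchrTop_ricci, h2]
    have e1 := h3 fun m d => ddg u x ν m d μ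
    have e2 := h3 fun m d => ddg u x μ m d ν
    have e3 : ∑ m, ∑ d, (metric u x)⁻¹ m d *
        (ddg u x m ν d μ + ddg u x m μ ν d - ddg u x m d ν μ
          - (ddg u x ν m d μ + ddg u x ν μ m d - ddg u x ν d m μ))
        - 1 / 2 * (∑ m, ∑ d, (metric u x)⁻¹ m d *
          (ddg u x ν m μ d + ddg u x ν d m μ - ddg u x ν μ m d)
        + ∑ m, ∑ d, (metric u x)⁻¹ m d *
          (ddg u x μ m ν d + ddg u x μ d m ν - ddg u x μ ν m d))
        + ∑ m, ∑ d, (metric u x)⁻¹ m d * ddg u x m d μ ν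
        + 1 / 2 * (∑ m, ∑ d, (metric u x)⁻¹ m d * ddg u x ν m d μ
          - ∑ m, ∑ d, (metric u x)⁻¹ m d * ddg u x ν d m μ)
        - 1 / 2 * (∑ m, ∑ d, (metric u x)⁻¹ m d * ddg u x μ m d ν
          - ∑ m, ∑ d, (metric u x)⁻¹ m d * ddg u x μ d m ν) = 0 := by
      simp only [Finset.mul_sum, ← Finset.sum_add_distrib, ← Finset.sum_sub_distrib]
      refine Finset.sum_eq_zero fun m _ => Finset.sum_eq_zero fun d _ => ?_
      linear_combination (metric u x)⁻¹ m d * (ddg_swap_left hu hU hx m ν d μ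
        + ddg_swap_left hu hU hx m μ ν d - ddg_swap_right hu hU hx m d ν μ
        + 1 / 2 * ddg_swap_right hu hU hx ν m d μ + 1 / 2 * ddg_swap_right hu hU hx μ m ν d
        + 1 / 2 * ddg_swap_left hu hU hx μ ν m d)
    linear_combination 1 / 2 * e3 - 1 / 4 * e1 + 1 / 4 * e2
  simp only [mul_sub, Finset.sum_add_distrib, Finset.sum_sub_distrib] at h4 ⊢
  rw [redRicci]
  simp only [Finset.sum_add_distrib]
  linear_combination h4

/-- The map `κ` from index tuples to components lets one statement cover all tensor fields among the
unknowns, of every rank. -/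
lemma isJet_covD {n : ℕ} (κ : (Fin n → Idx) → Comp) (b : Fin (n + 1) → Idx) :
    IsJet U fun u x => covD (metric u) (fun y a => u y (κ a)) x b :=
  (IsJet.pd_apply _ _).sub (IsJet.sum fun _ => IsJet.sum fun _ => (IsJet.chr _ _ _).mul
    (IsJet.of_state (smoothSt_apply _)))

/-- The wave operator in terms of second derivatives of the field and of the metric. -/
lemma isJet_box_sub {n : ℕ} (hU : IsOpen U) (κ : (Fin n → Idx) → Comp) (a : Fin n → Idx) :
    IsJet U fun u x => box (metric u) (fun y a => u y (κ a)) x a - principal u x (κ a)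
      + ∑ i, ∑ k, u x (κ (Function.update a i k)) *
        ∑ e, ∑ f, (metric u x)⁻¹ e f * dchrTop u x e k f (a i) := by
  have h1 : IsJet U fun u x => -∑ e, ∑ f, (metric u x)⁻¹ e f *
      (∑ i, ∑ k, (chr (metric u) x k f (a i) * pd e (fun y => u y (κ (Function.update a i k))) x
        + u x (κ (Function.update a i k)) * (pd e (fun y => chr (metric u) y k f (a i)) x
          - dchrTop u x e k f (a i)))
      + ∑ j : Fin (n + 1), ∑ k, chr (metric u) x k e ((Matrix.vecCons f a : Fin (n + 1) → Idx) j) *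
        covD (metric u) (fun y a => u y (κ a)) x
          (Function.update (Matrix.vecCons f a : Fin (n + 1) → Idx) j k)) :=
    (IsJet.sum fun e => IsJet.sum fun f => (IsJet.inv_apply _ _).mul
      ((IsJet.sum fun i => IsJet.sum fun k => ((IsJet.chr _ _ _).mul (IsJet.pd_apply _ _)).add
        ((IsJet.of_state (smoothSt_apply _)).mul (isJet_pd_chr_sub hU _ _ _ _))).add
      (IsJet.sum fun j => IsJet.sum fun k => (IsJet.chr _ _ _).mul (isJet_covD _ _)))).neg
  refine h1.congr fun u hu x hx => ?_
  have hp : ∀ i μ, DifferentiableAt ℝ (pd μ fun y => u y i) x := fun i μ =>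
    hu.differentiableAt_pd hU hx i μ
  have hu' : ∀ i, DifferentiableAt ℝ (fun y => u y i) x := fun i =>
    differentiableAt_of_contDiffOn hU (hu.contDiffOn_apply i) hx
  have hc : ∀ a b c, DifferentiableAt ℝ (fun y => chr (metric u) y a b c) x := fun a b c =>
    differentiableAt_of_contDiffOn hU (hu.contDiffOn_chr hU a b c) hx
  -- Only the connection terms of the inner derivative are differentiated. Those of the outer one
  -- multiply first-order quantities and need no correction.
  have h2 : ∀ e f, pd e (fun y => covD (metric u) (fun y a => u y (κ a)) y
      (Matrix.vecCons f a)) x = pd e (pd f fun y => u y (κ a)) x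
      - ∑ i, ∑ k, (chr (metric u) x k f (a i) * pd e (fun y => u y (κ (Function.update a i k))) x
        + u x (κ (Function.update a i k)) * pd e (fun y => chr (metric u) y k f (a i)) x) := by
    intro e f
    have hm : ∀ i k, DifferentiableAt ℝ (fun y => chr (metric u) y k f (a i) *
        u y (κ (Function.update a i k))) x := fun i k => (hc _ _ _).fun_mul (hu' _)
    change pd e (fun y => pd f (fun y => u y (κ a)) y - ∑ i, ∑ k, chr (metric u) y k f (a i) *
        u y (κ (Function.update a i k))) x = _
    rw [pd_sub (hp _ _) (DifferentiableAt.fun_sum fun i _ => DifferentiableAt.fun_sum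
      fun k _ => hm i k), pd_sum _ fun i => DifferentiableAt.fun_sum fun k _ => hm i k]
    congr 1
    refine Finset.sum_congr rfl fun i _ => ?_
    rw [pd_sum _ fun k => hm i k]
    exact Finset.sum_congr rfl fun k _ => pd_mul (hc _ _ _) (hu' _) e
  have h3 : ∑ i, ∑ k, u x (κ (Function.update a i k)) *
        ∑ e, ∑ f, (metric u x)⁻¹ e f * dchrTop u x e k f (a i)
      = ∑ e, ∑ f, (metric u x)⁻¹ e f * ∑ i, ∑ k, u x (κ (Function.update a i k)) *
        dchrTop u x e k f (a i) := by
    simp only [Finset.mul_sum]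
    rw [Finset.sum_congr rfl fun i _ => Finset.sum_comm, Finset.sum_comm]
    refine Finset.sum_congr rfl fun e _ => ?_
    rw [Finset.sum_congr rfl fun i _ => Finset.sum_comm, Finset.sum_comm]
    exact Finset.sum_congr rfl fun f _ => Finset.sum_congr rfl fun i _ =>
      Finset.sum_congr rfl fun k _ => by ring
  have h4 : box (metric u) (fun y a => u y (κ a)) x a = ∑ e, ∑ f, (metric u x)⁻¹ e f *
      (pd e (fun y => covD (metric u) (fun y a => u y (κ a)) y (Matrix.vecCons f a)) x
        - ∑ j : Fin (n + 1), ∑ k, chr (metric u) x k e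
          ((Matrix.vecCons f a : Fin (n + 1) → Idx) j) *
          covD (metric u) (fun y a => u y (κ a)) x
            (Function.update (Matrix.vecCons f a : Fin (n + 1) → Idx) j k)) := rfl
  have h5 : principal u x (κ a) = ∑ e, ∑ f, (metric u x)⁻¹ e f *
      pd e (pd f fun y => u y (κ a)) x := rfl
  rw [h3, h4, h5]
  simp only [h2, ← Finset.sum_sub_distrib, ← Finset.sum_add_distrib, ← Finset.sum_neg_distrib]
  refine Finset.sum_congr rfl fun e _ => Finset.sum_congr rfl fun f _ => ?_
  simp only [mul_sub, Finset.sum_add_distrib, Finset.sum_sub_distrib]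
  ring

/-- In the reduced wave operator no second derivatives other than `g^{στ} ∂_σ ∂_τ` of the field
itself enter. -/
lemma isJet_blackBox_sub {n : ℕ} (hU : IsOpen U) {R : Pt → ℝ} {F : Pt → Idx → ℝ}
    (hR : ContDiffOn ℝ ∞ R U) (hF : ContDiffOn ℝ ∞ F U) (κ : (Fin n → Idx) → Comp)
    (a : Fin n → Idx) :
    IsJet U fun u x => blackBox (metric u) (LF u) R F (fun y a => u y (κ a)) x a
      - principal u x (κ a) := by
  have h1 : IsJet U fun u x => (box (metric u) (fun y a => u y (κ a)) x a - principal u x (κ a)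
      + ∑ i, ∑ k, u x (κ (Function.update a i k)) *
        ∑ e, ∑ f, (metric u x)⁻¹ e f * dchrTop u x e k f (a i))
      + ∑ i, ∑ k, u x (κ (Function.update a i k)) * ∑ τ, (metric u x)⁻¹ τ k *
        (2 * LF u x ![τ, a i] + 1 / 6 * R x * metric u x τ (a i)
          - ∑ σ, metric u x σ τ * covDVec (metric u) F x (a i) σ
          - (ricci (metric u) x τ (a i) - ∑ m, (dchrTop u x m m (a i) τ - dchrTop u x (a i) m m τ))
          + ∑ σ, metric u x σ τ * (covDVec (metric u) (contrChr (metric u)) x (a i) σ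
            - ∑ m, ∑ d, (metric u x)⁻¹ m d * dchrTop u x (a i) σ m d)) := by
    refine (isJet_box_sub hU κ a).add (IsJet.sum fun i => IsJet.sum fun k =>
      (IsJet.of_state (smoothSt_apply _)).mul (IsJet.sum fun τ => (IsJet.inv_apply _ _).mul ?_))
    refine (((IsJet.add ?_ ?_).sub ?_).sub (isJet_ricci_sub hU _ _)).add (IsJet.sum fun σ =>
      (IsJet.metric_apply _ _).mul (isJet_covDVec_contrChr_sub hU _ _))
    · exact (IsJet.const _).mul (IsJet.of_state (smoothSt_LOf _))
    · exact ((IsJet.const _).mul (IsJet.of_point hR)).mul (IsJet.metric_apply _ _)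
    · exact IsJet.sum fun σ => (IsJet.metric_apply _ _).mul (isJet_covDVec hU hF _ _)
  refine h1.congr fun u hu x hx => ?_
  -- The correction is rewritten as a coefficient of each component T_{…k…}, the form in which the
  -- ∂Γ-terms of □ appear, so that the two can be compared.
  have h2 : ∀ i, ∑ τ,
      ((2 * LF u x ![τ, a i] + 1 / 6 * R x * metric u x τ (a i) - ricci (metric u) x τ (a i))
      - ∑ σ, metric u x σ τ * (covDVec (metric u) F x (a i) σ
          - covDVec (metric u) (contrChr (metric u)) x (a i) σ))
      * raise (metric u x)⁻¹ i (fun a => u x (κ a)) (Function.update a i τ)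
      = ∑ k, u x (κ (Function.update a i k)) * ∑ τ, (metric u x)⁻¹ τ k *
      ((2 * LF u x ![τ, a i] + 1 / 6 * R x * metric u x τ (a i) - ricci (metric u) x τ (a i))
      - ∑ σ, metric u x σ τ * (covDVec (metric u) F x (a i) σ
          - covDVec (metric u) (contrChr (metric u)) x (a i) σ)) := fun i => by
    simp only [raise, Function.update_self, Function.update_idem]
    simp only [Finset.mul_sum (Finset.univ : Finset Idx) (fun k => (metric u x)⁻¹ _ k * _) _]
    rw [Finset.sum_comm]
    refine Finset.sum_congr rfl fun k _ => ?_
    rw [Finset.mul_sum]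
    exact Finset.sum_congr rfl fun τ _ => by ring
  rw [blackBox]
  simp only [h2]
  rw [add_sub_right_comm, add_assoc]
  congr 1
  simp only [← Finset.sum_add_distrib]
  refine Finset.sum_congr rfl fun i _ => Finset.sum_congr rfl fun k _ => ?_
  rw [← mul_add]
  congr 1
  rw [eq_neg_of_add_eq_zero_left (dchrTop_cancel hu hU hx k (a i)), ← Finset.sum_neg_distrib,
    ← Finset.sum_add_distrib]
  refine Finset.sum_congr rfl fun τ _ => ?_
  simp only [mul_sub, Finset.sum_sub_distrib]
  ring

end

/-! ### The rescaled Cotton tensor as an affine function of `∇Ξ` -/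

/-- Subtracting the value at v = 0 removes every term without ∇Ξ, and the remaining ones are of
degree one. -/
lemma cottonLin_isLinear (y : State) (i : Fin 3 → Idx) :
    IsLinearMap ℝ fun v => cottonLin y v i := by
  have hz : ∀ a, upV y 0 a = 0 := fun a => by simp [upV]
  have ha : ∀ v w a, upV y (v + w) a = upV y v a + upV y w a := fun v w a => by
    simp [upV, mul_add, Finset.sum_add_distrib]
  have hm : ∀ (c : ℝ) v a, upV y (c • v) a = c * upV y v a := fun c v a => by
    simp only [upV, Pi.smul_apply, smul_eq_mul, Finset.mul_sum]
    exact Finset.sum_congr rfl fun _ _ => by ring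
  constructor
  · intro v w
    simp only [cottonLin, cotton, hz, ha, Pi.add_apply, Pi.zero_apply, mul_add,
      Finset.sum_add_distrib, mul_zero, Finset.sum_const_zero]
    ring
  · intro c v
    have hs : ∀ f : Idx → ℝ, ∑ k, f k * (c * upV y v k) = c * ∑ k, f k * upV y v k := fun f => by
      rw [Finset.mul_sum]
      exact Finset.sum_congr rfl fun _ _ => by ring
    simp only [cottonLin, cotton, hz, hm, Pi.smul_apply, Pi.zero_apply, smul_eq_mul, hs,
      mul_zero, Finset.sum_const_zero]
    ring

lemma cottonLin_eq_sum (y : State) (v : Idx → ℝ) (i : Fin 3 → Idx) :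
    cottonLin y v i = ∑ k, v k * cottonLin y (Pi.single k 1) i := by
  have h := LinearMap.pi_apply_eq_sum_univ (cottonLin_isLinear y i).mk' v
  refine h.trans (Finset.sum_congr rfl fun k _ => ?_)
  have hk : (fun j => if k = j then (1 : ℝ) else 0) = Pi.single k 1 := by
    funext j; simp [Pi.single_apply, eq_comm]
  rw [smul_eq_mul, hk]
  rfl

lemma dual3_add (m : Matrix Idx Idx ℝ) (S T : Tensor 3) (i : Fin 3 → Idx) :
    dual3 m (fun j => S j + T j) i = dual3 m S i + dual3 m T i := by
  simp only [dual3, mul_add, Finset.sum_add_distrib]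

lemma dual3_sum_mul (m : Matrix Idx Idx ℝ) (v : Idx → ℝ) (T : Idx → Tensor 3) (i : Fin 3 → Idx) :
    dual3 m (fun j => ∑ k, v k * T k j) i = ∑ k, v k * dual3 m (T k) i := by
  simp only [dual3, Fin.sum_univ_four (fun k => v k * _)]
  simp only [mul_add, Finset.sum_add_distrib, mul_left_comm _ (v _), ← Finset.mul_sum]

lemma smoothSt_cottonLin (v : Idx → ℝ) (i : Fin 3 → Idx) : SmoothSt fun y => cottonLin y v i :=
  (smoothSt_cotton v i).sub (smoothSt_cotton 0 i)

/-- Separates the dependence on ∇Ξ from coefficients depending on the state alone, whose derivatives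
are again of first order. -/
lemma cotton_eq_sum (y : State) (v : Idx → ℝ) (i : Fin 3 → Idx) :
    cotton y v i = cotton y 0 i + ∑ k, v k * cottonLin y (Pi.single k 1) i := by
  rw [← cottonLin_eq_sum, cottonLin]; ring

/-! ### Second derivatives of the conformal factor -/

section

variable {U : Set Pt}

/-- `∂_e ∂_f Ξ`. -/
def ddXi (u : Pt → State) (x : Pt) (e f : Idx) : ℝ := pd e (pd f fun y => u y .Xi) x

/-- Up to a smooth function of the first jet, `Φ` is `z` times a linear function of the second
derivatives of `Ξ` with coefficients depending smoothly on the first jet. -/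
def IsJetUpTo (U : Set Pt) (z : ℝ) (Φ : (Pt → State) → Pt → ℝ) : Prop :=
  ∃ A : Pt × State × Jet → Idx → Idx → ℝ, ContDiffOn ℝ ∞ A (jetDomain U) ∧
    IsJet U fun u x => Φ u x - z * ∑ σ, ∑ τ, A (x, u x, jet u x) σ τ * ddXi u x σ τ

lemma contDiffOn_matrix {s : Set (Pt × State × Jet)} {A : Pt × State × Jet → Idx → Idx → ℝ} :
    ContDiffOn ℝ ∞ A s ↔ ∀ σ τ, ContDiffOn ℝ ∞ (fun q => A q σ τ) s := by
  rw [contDiffOn_pi]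
  exact forall_congr' fun σ => contDiffOn_pi

namespace IsJetUpTo

variable {z : ℝ} {Φ Ψ : (Pt → State) → Pt → ℝ}

lemma of_isJet (h : IsJet U Φ) : IsJetUpTo U z Φ :=
  ⟨fun _ _ _ => 0, contDiffOn_const, h.congr fun _ _ _ _ => by simp⟩

/-- The number `z` is a switch: at z = 1 the Hessian of Ξ is allowed, at z = 0 it is excluded. One
analysis of the equations thus serves both versions of the system. -/
lemma isJet (h : IsJetUpTo U 0 Φ) : IsJet U Φ := by
  obtain ⟨A, -, h⟩ := h
  exact h.congr fun _ _ _ _ => by simp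

lemma add (h : IsJetUpTo U z Φ) (h' : IsJetUpTo U z Ψ) :
    IsJetUpTo U z fun u x => Φ u x + Ψ u x := by
  obtain ⟨A, hA, h⟩ := h
  obtain ⟨B, hB, h'⟩ := h'
  refine ⟨fun q σ τ => A q σ τ + B q σ τ, contDiffOn_matrix.2 fun σ τ =>
    (contDiffOn_matrix.1 hA σ τ).add (contDiffOn_matrix.1 hB σ τ),
    (h.add h').congr fun u _ x _ => ?_⟩
  simp only [add_mul, Finset.sum_add_distrib]; ring

lemma mul_left (h : IsJet U Ψ) (h' : IsJetUpTo U z Φ) :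
    IsJetUpTo U z fun u x => Ψ u x * Φ u x := by
  obtain ⟨N, hN, hN'⟩ := id h
  obtain ⟨B, hB, h'⟩ := h'
  refine ⟨fun q σ τ => N q * B q σ τ, contDiffOn_matrix.2 fun σ τ =>
    hN.mul (contDiffOn_matrix.1 hB σ τ), (h.mul h').congr fun u hu x hx => ?_⟩
  simp only [← hN' u hu x hx, mul_assoc, ← Finset.mul_sum]; ring

lemma sub (h : IsJetUpTo U z Φ) (h' : IsJetUpTo U z Ψ) :
    IsJetUpTo U z fun u x => Φ u x - Ψ u x := by
  have := h.add (mul_left (IsJet.const (-1)) h')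
  simpa [sub_eq_add_neg] using this

lemma sum {ι : Type*} {s : Finset ι} {Φ : ι → (Pt → State) → Pt → ℝ}
    (h : ∀ i, IsJetUpTo U z (Φ i)) : IsJetUpTo U z fun u x => ∑ i ∈ s, Φ i u x := by
  classical
  induction s using Finset.induction_on with
  | empty => simpa using of_isJet (IsJet.const 0)
  | insert i s hi ih => simpa [Finset.sum_insert hi] using (h i).add ih

lemma ddXi (e f : Idx) : IsJetUpTo U 1 fun u x => ddXi u x e f := by
  refine ⟨fun _ σ τ => if σ = e then (if τ = f then 1 else 0) else 0, contDiffOn_const,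
    (IsJet.const 0).congr fun u _ x _ => ?_⟩
  simp

end IsJetUpTo

lemma IsJet.dXi (a : Idx) : IsJet U fun u x => dXi u x a := IsJet.pd_apply .Xi a

lemma IsJet.dXiUp (a : Idx) : IsJet U fun u x => dXiUp u x a :=
  IsJet.sum (s := Finset.univ) fun k => (IsJet.inv_apply a k).mul (IsJet.dXi k)

lemma IsJet.cottonF (i : Fin 3 → Idx) : IsJet U fun u x => cottonF u x i := by
  simp only [ConfWave.cottonF, cotton_eq_sum _ (ConfWave.dXi _ _)]
  exact (IsJet.of_state (smoothSt_cotton 0 i)).add (IsJet.sum fun _ => (IsJet.dXi _).mul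
    (IsJet.of_state (smoothSt_cottonLin _ _)))

lemma IsJet.dualCottonF (i : Fin 3 → Idx) : IsJet U fun u x => dualCottonF u x i :=
  (IsJet.const _).mul <| IsJet.sum fun _ => IsJet.sum fun _ => IsJet.sum fun _ =>
    IsJet.sum fun _ => (((IsJet.of_state (smoothSt_vol _ _ _ _)).mul (IsJet.inv_apply _ _)).mul
      (IsJet.inv_apply _ _)).mul (IsJet.cottonF _)

/-- The derivative of an affine function of `∇Ξ` with coefficients depending on the state. -/
lemma isJet_pd_affine_sub (hU : IsOpen U) {f : State → ℝ} {K : Idx → State → ℝ} (hf : SmoothSt f)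
    (hK : ∀ k, SmoothSt (K k)) (e : Idx) :
    IsJet U fun u x => pd e (fun y => f (u y) + ∑ k, dXi u y k * K k (u y)) x
      - ∑ k, K k (u x) * ddXi u x e k := by
  have h1 : IsJet U fun u x => pd e (fun y => f (u y)) x
      + ∑ k, dXi u x k * pd e (fun y => K k (u y)) x :=
    (IsJet.pd_of_state hU hf e).add (IsJet.sum fun k => (IsJet.dXi k).mul
      (IsJet.pd_of_state hU (hK k) e))
  refine h1.congr fun u hu x hx => ?_
  have hf' := differentiableAt_of_contDiffOn hU (hu.contDiffOn_comp hf) hx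
  have hK' := fun k => differentiableAt_of_contDiffOn hU (hu.contDiffOn_comp (hK k)) hx
  have hd : ∀ k, DifferentiableAt ℝ (fun y => dXi u y k) x := fun k =>
    hu.differentiableAt_pd hU hx .Xi k
  have hm := fun k => (hd k).fun_mul (hK' k)
  rw [pd_add hf' (DifferentiableAt.fun_sum fun k _ => hm k), pd_sum _ hm, add_sub_assoc,
    ← Finset.sum_sub_distrib]
  congr 1
  refine Finset.sum_congr rfl fun k _ => ?_
  rw [pd_mul (hd k) (hK' k), add_sub_assoc]
  have h2 : pd e (fun y => dXi u y k) x = ddXi u x e k := rfl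
  rw [h2]; ring

lemma dualCottonF_eq_sum (u : Pt → State) (x : Pt) (i : Fin 3 → Idx) :
    dualCottonF u x i = dual3 (gOf (u x)) (cotton (u x) 0) i
      + ∑ k, dXi u x k * dual3 (gOf (u x)) (cottonLin (u x) (Pi.single k 1)) i := by
  have h : cottonF u x = fun j => cotton (u x) 0 j
      + ∑ k, dXi u x k * cottonLin (u x) (Pi.single k 1) j :=
    funext fun j => cotton_eq_sum _ _ _
  rw [dualCottonF, h, dual3_add, dual3_sum_mul]; rfl

/-- The part of a covariant derivative of a rank three tensor without derivatives. -/
lemma isJet_covD_sub_pd {T : (Pt → State) → Pt → Tensor 3} (hT : ∀ i, IsJet U fun u x => T u x i)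
    (i : Fin 4 → Idx) :
    IsJet U fun u x => covD (metric u) (T u) x i - pd (i 0) (fun y => T u y fun j => i j.succ) x :=
  (IsJet.sum fun _ => IsJet.sum fun _ => (IsJet.chr _ _ _).mul (hT _)).neg.congr
    fun u _ x _ => by rw [covD]; ring

/-- The affine form in ∇Ξ is differentiated; the derivative of the factor ∇Ξ is the only source of
second derivatives. -/
lemma isJet_dCotton_sub (hU : IsOpen U) (i : Fin 4 → Idx) :
    IsJet U fun u x => dCotton u x i
      - ∑ k, cottonLin (u x) (Pi.single k 1) (fun j => i j.succ) * ddXi u x (i 0) k := by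
  have h1 := (isJet_covD_sub_pd (U := U) (T := cottonF) IsJet.cottonF i).add
    (isJet_pd_affine_sub hU (smoothSt_cotton 0 fun j => i j.succ)
      (fun k => smoothSt_cottonLin (Pi.single k 1) fun j => i j.succ) (i 0))
  refine h1.congr fun u _ x _ => ?_
  have h2 : (fun y => cottonF u y fun j => i j.succ) = fun y => cotton (u y) 0 (fun j => i j.succ)
      + ∑ k, dXi u y k * cottonLin (u y) (Pi.single k 1) (fun j => i j.succ) :=
    funext fun y => cotton_eq_sum _ _ _
  rw [h2, dCotton]; ring

lemma isJet_dDualCotton_sub (hU : IsOpen U) (i : Fin 4 → Idx) :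
    IsJet U fun u x => dDualCotton u x i
      - ∑ k, dual3 (gOf (u x)) (cottonLin (u x) (Pi.single k 1)) (fun j => i j.succ)
        * ddXi u x (i 0) k := by
  have h1 := (isJet_covD_sub_pd (U := U) (T := dualCottonF) IsJet.dualCottonF i).add
    (isJet_pd_affine_sub hU
      (smoothSt_dual3 (fun j => smoothSt_cotton 0 j) fun j => i j.succ)
      (fun k => smoothSt_dual3 (fun j => smoothSt_cottonLin (Pi.single k 1) j)
        fun j => i j.succ) (i 0))
  refine h1.congr fun u _ x _ => ?_
  have h2 : (fun y => dualCottonF u y fun j => i j.succ)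
      = fun y => dual3 (gOf (u y)) (cotton (u y) 0) (fun j => i j.succ)
      + ∑ k, dXi u y k * dual3 (gOf (u y)) (cottonLin (u y) (Pi.single k 1)) (fun j => i j.succ) :=
    funext fun y => dualCottonF_eq_sum _ _ _
  rw [h2, dDualCotton]; ring

lemma covD_scal_eq (G : Pt → Matrix Idx Idx ℝ) (f : Pt → ℝ) (x : Pt) (a b : Idx) :
    covD G (covD G (scal f)) x ![a, b] = pd a (pd b f) x - ∑ k, chr G x k a b * pd k f x := by
  have h1 : ∀ e, (fun y => covD G (scal f) y ![e]) = pd e f := fun e => by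
    funext y; rw [covD_rank0]; rfl
  have h2 : ∀ e, covD G (scal f) x ![e] = pd e f x := fun e => congrFun (h1 e) x
  simp only [covD_rank1, h1, h2]

/-- Derivatives of a prescribed function of any order depend on the point only; the unknowns enter
through the Christoffel symbols. -/
lemma IsJet.hessian_of_point (hU : IsOpen U) {f : Pt → ℝ} (hf : ContDiffOn ℝ ∞ f U) (a b : Idx) :
    IsJet U fun u x => covD (metric u) (covD (metric u) (scal f)) x ![a, b] := by
  simp only [covD_scal_eq]
  exact (IsJet.of_point ((hf.pd hU b).pd hU a)).sub (IsJet.sum fun _ => (IsJet.chr _ _ _).mul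
    (IsJet.of_point (hf.pd hU _)))

/-- The covariant Hessian of Ξ differs from ∂∂Ξ by ΓdΞ, and the other terms of Υ contain no
derivatives of the unknowns. -/
lemma isJet_Upsilon_sub (e k : Idx) :
    IsJet U fun u x => Upsilon u x ![e, k] - ddXi u x e k := by
  have h1 : IsJet U fun u x => -(∑ m, chr (metric u) x m e k * dXi u x m)
      + u x .Xi * LF u x ![e, k] - u x .s * metric u x e k
      - 1 / 2 * u x .Xi ^ 3 * emT (u x) ![e, k] :=
    (((IsJet.sum fun _ => (IsJet.chr _ _ _).mul (IsJet.dXi _)).neg.add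
      ((IsJet.of_state (smoothSt_apply _)).mul (IsJet.of_state (smoothSt_LOf _)))).sub
      ((IsJet.of_state (smoothSt_apply _)).mul (IsJet.metric_apply _ _))).sub
      (((IsJet.const _).mul ((IsJet.of_state (smoothSt_apply _)).pow 3)).mul
        (IsJet.of_state (smoothSt_emT _)))
  refine h1.congr fun u _ x _ => ?_
  rw [Upsilon, covD_scal_eq]
  simp only [dXi, ddXi, Matrix.cons_val_zero, Matrix.cons_val_one]
  ring

/-- The same coefficients multiply ∂∂Ξ in ∇T_{abc} and Υ in the subtracted term, so the second
derivatives cancel exactly. -/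
lemma isJet_dCottonElim (hU : IsOpen U) (i : Fin 4 → Idx) :
    IsJet U fun u x => dCottonElim u x i := by
  refine ((isJet_dCotton_sub hU i).sub (IsJet.sum (s := Finset.univ) fun k =>
    (isJet_Upsilon_sub (i 0) k).mul (IsJet.of_state
      (smoothSt_cottonLin (Pi.single k 1) fun j => i j.succ)))).congr fun u _ x _ => ?_
  rw [dCottonElim, cottonLin_eq_sum, sub_sub, ← Finset.sum_add_distrib]
  congr 1
  exact Finset.sum_congr rfl fun _ _ => by ring

lemma isJet_dDualCottonElim (hU : IsOpen U) (i : Fin 4 → Idx) :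
    IsJet U fun u x => dDualCottonElim u x i := by
  refine ((isJet_dDualCotton_sub hU i).sub (IsJet.sum (s := Finset.univ) fun k =>
    (isJet_Upsilon_sub (i 0) k).mul (IsJet.of_state (smoothSt_dual3
      (fun j => smoothSt_cottonLin (Pi.single k 1) j) fun j => i j.succ)))).congr
      fun u _ x _ => ?_
  have h : cottonLin (u x) (fun k => Upsilon u x ![i 0, k])
      = fun j => ∑ k, Upsilon u x ![i 0, k] * cottonLin (u x) (Pi.single k 1) j :=
    funext fun j => cottonLin_eq_sum _ _ _
  rw [dDualCottonElim, h, dual3_sum_mul, sub_sub, ← Finset.sum_add_distrib]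
  congr 1
  exact Finset.sum_congr rfl fun _ _ => by simp only [metric]; ring

lemma isJetUpTo_dCotton (hU : IsOpen U) (i : Fin 4 → Idx) :
    IsJetUpTo U 1 fun u x => dCotton u x i := by
  have := (IsJetUpTo.of_isJet (z := 1) (isJet_dCotton_sub hU i)).add (IsJetUpTo.sum
    (s := Finset.univ) fun k => IsJetUpTo.mul_left (IsJet.of_state
      (smoothSt_cottonLin (Pi.single k 1) fun j => i j.succ)) (IsJetUpTo.ddXi (U := U) (i 0) k))
  simpa only [sub_add_cancel] using this

lemma isJetUpTo_dDualCotton (hU : IsOpen U) (i : Fin 4 → Idx) :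
    IsJetUpTo U 1 fun u x => dDualCotton u x i := by
  have := (IsJetUpTo.of_isJet (z := 1) (isJet_dDualCotton_sub hU i)).add (IsJetUpTo.sum
    (s := Finset.univ) fun k => IsJetUpTo.mul_left (IsJet.of_state
      (smoothSt_dual3 (fun j => smoothSt_cottonLin (Pi.single k 1) j) fun j => i j.succ))
      (IsJetUpTo.ddXi (U := U) (i 0) k))
  simpa only [sub_add_cancel] using this

end

/-! ### The reduced system -/

section

variable {U : Set Pt}

lemma smoothSt_mix2 {T : State → Tensor 2} (hT : ∀ i, SmoothSt fun y => T y i) (a b : Idx) :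
    SmoothSt fun y => mix2 y (T y) a b := by
  simp only [mix2_eq]
  exact SmoothSt.sum fun k => (smoothSt_inv b k).mul (hT _)

lemma smoothSt_up2 {T : State → Tensor 2} (hT : ∀ i, SmoothSt fun y => T y i) (a b : Idx) :
    SmoothSt fun y => up2 y (T y) a b := by
  simp only [up2_eq]
  exact SmoothSt.sum fun k => (smoothSt_inv a k).mul
    (SmoothSt.sum fun l => (smoothSt_inv b l).mul (hT _))

lemma IsJet.covD_LF (i : Fin 3 → Idx) : IsJet U fun u x => covD (metric u) (LF u) x i :=
  isJet_covD (fun a => .L (a 0) (a 1)) i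

variable {R : Pt → ℝ}

lemma isJet_rhsXi (hR : ContDiffOn ℝ ∞ R U) : IsJet U fun u x => rhsXi u R x :=
  ((IsJet.const _).mul (IsJet.of_state (smoothSt_apply _))).sub
    (((IsJet.const _).mul (IsJet.of_state (smoothSt_apply _))).mul (IsJet.of_point hR))

lemma isJet_rhsPhi (hR : ContDiffOn ℝ ∞ R U) : IsJet U fun u x => rhsPhi u R x :=
  ((IsJet.const _).mul (IsJet.of_point hR)).mul (IsJet.of_state (smoothSt_apply _))

lemma isJet_rhsS (hU : IsOpen U) (hR : ContDiffOn ℝ ∞ R U) : IsJet U fun u x => rhsS u R x := by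
  simp only [rhsS]
  repeat' first
    | with_reducible exact IsJet.const _
    | with_reducible exact IsJet.of_state (smoothSt_apply _)
    | with_reducible exact IsJet.of_state (smoothSt_LOf _)
    | with_reducible exact IsJet.of_state (smoothSt_emT _)
    | with_reducible exact IsJet.of_state (smoothSt_up2 smoothSt_LOf _ _)
    | with_reducible exact IsJet.of_state (smoothSt_up2 smoothSt_emT _ _)
    | with_reducible exact IsJet.dXiUp _
    | with_reducible exact IsJet.of_point hR
    | with_reducible exact IsJet.of_point (hR.pd hU _)
    | with_reducible refine IsJet.add ?_ ?_
    | with_reducible refine IsJet.sub ?_ ?_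
    | with_reducible refine IsJet.mul ?_ ?_
    | with_reducible refine IsJet.pow ?_ _
    | with_reducible refine IsJet.sum fun _ => ?_

lemma isJet_rhsPhi1 (hU : IsOpen U) (hR : ContDiffOn ℝ ∞ R U) (i : Fin 1 → Idx) :
    IsJet U fun u x => rhsPhi1 u R x i :=
  (((IsJet.const _).mul (IsJet.sum fun b => (IsJet.of_state (smoothSt_phi1Up b)).mul
    (IsJet.of_state (smoothSt_LOf _)))).add (((IsJet.const _).mul (IsJet.of_point hR)).mul
      (IsJet.of_state (smoothSt_phi1Of i)))).add (((IsJet.const _).mul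
        (IsJet.of_state (smoothSt_apply _))).mul (IsJet.of_point (hR.pd hU _)))

lemma isJet_rhsPhi2 (hU : IsOpen U) (hR : ContDiffOn ℝ ∞ R U) (i : Fin 2 → Idx) :
    IsJet U fun u x => rhsPhi2 u R x i := by
  simp only [rhsPhi2]
  repeat' first
    | with_reducible exact IsJet.const _
    | with_reducible exact IsJet.of_state (smoothSt_apply _)
    | with_reducible exact IsJet.of_state (smoothSt_metric _ _)
    | with_reducible exact IsJet.of_state (smoothSt_LOf _)
    | with_reducible exact IsJet.of_state (smoothSt_dOf _)
    | with_reducible exact IsJet.of_state (smoothSt_phi1Of _)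
    | with_reducible exact IsJet.of_state (smoothSt_phi2Of _)
    | with_reducible exact IsJet.of_state (smoothSt_phi1Up _)
    | with_reducible exact IsJet.of_state (smoothSt_up2 smoothSt_phi2Of _ _)
    | with_reducible exact IsJet.of_state (smoothSt_mix2 smoothSt_phi2Of _ _)
    | with_reducible exact IsJet.cottonF _
    | with_reducible exact IsJet.dXiUp _
    | with_reducible exact IsJet.covD_LF _
    | with_reducible exact IsJet.hessian_of_point hU hR _ _
    | with_reducible exact IsJet.of_point hR
    | with_reducible exact IsJet.of_point (hR.pd hU _)
    | with_reducible refine IsJet.add ?_ ?_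
    | with_reducible refine IsJet.sub ?_ ?_
    | with_reducible refine IsJet.mul ?_ ?_
    | with_reducible refine IsJet.sum fun _ => ?_

variable {z : ℝ} {D S : (Pt → State) → Pt → Tensor 4}

lemma isJetUpTo_rhsL (hU : IsOpen U) (hR : ContDiffOn ℝ ∞ R U)
    (hD : ∀ i, IsJetUpTo U z fun u x => D u x i) (i : Fin 2 → Idx) :
    IsJetUpTo U z fun u x => rhsL u R (D u) x i := by
  simp only [rhsL]
  refine IsJetUpTo.sub (IsJetUpTo.sub (IsJetUpTo.of_isJet ?_) (IsJetUpTo.mul_left ?_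
    (IsJetUpTo.sum fun c => IsJetUpTo.sum fun e => IsJetUpTo.mul_left ?_ (hD _))))
    (IsJetUpTo.of_isJet ?_)
  all_goals repeat' first
    | with_reducible exact IsJet.const _
    | with_reducible exact IsJet.of_state (smoothSt_apply _)
    | with_reducible exact IsJet.of_state (smoothSt_metric _ _)
    | with_reducible exact IsJet.of_state (smoothSt_inv _ _)
    | with_reducible exact IsJet.of_state (smoothSt_LOf _)
    | with_reducible exact IsJet.of_state (smoothSt_dOf _)
    | with_reducible exact IsJet.of_state (smoothSt_up2 smoothSt_LOf _ _)
    | with_reducible exact IsJet.of_state (smoothSt_up2 smoothSt_emT _ _)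
    | with_reducible exact IsJet.of_state (smoothSt_mix2 smoothSt_LOf _ _)
    | with_reducible exact IsJet.cottonF _
    | with_reducible exact IsJet.dXiUp _
    | with_reducible exact IsJet.hessian_of_point hU hR _ _
    | with_reducible refine IsJet.add ?_ ?_
    | with_reducible refine IsJet.sub ?_ ?_
    | with_reducible refine IsJet.mul ?_ ?_
    | with_reducible refine IsJet.pow ?_ _
    | with_reducible refine IsJet.sum fun _ => ?_

/-- The fields `D` and `S` enter linearly, with coefficients depending on the state; all other terms
are of first order at most. -/
lemma isJetUpTo_rhsD (hR : ContDiffOn ℝ ∞ R U)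
    (hD : ∀ i, IsJetUpTo U z fun u x => D u x i) (hS : ∀ i, IsJetUpTo U z fun u x => S u x i)
    (i : Fin 4 → Idx) : IsJetUpTo U z fun u x => rhsD u R (D u) (S u) x i := by
  simp only [rhsD, raise]
  refine IsJetUpTo.add (IsJetUpTo.add (IsJetUpTo.of_isJet ?_) (IsJetUpTo.sub (hD _) (hD _)))
    (IsJetUpTo.sum fun e => IsJetUpTo.sum fun f => IsJetUpTo.mul_left
      (IsJet.of_state (smoothSt_vol _ _ _ _)) (IsJetUpTo.sum fun k => IsJetUpTo.mul_left
        (IsJet.of_state (smoothSt_inv _ _)) (IsJetUpTo.sum fun l => IsJetUpTo.mul_left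
          (IsJet.of_state (smoothSt_inv _ _)) (hS _))))
  repeat' first
    | with_reducible exact IsJet.const _
    | with_reducible exact IsJet.of_state (smoothSt_apply _)
    | with_reducible exact IsJet.of_state (smoothSt_metric _ _)
    | with_reducible exact IsJet.of_state (smoothSt_inv _ _)
    | with_reducible exact IsJet.of_state (smoothSt_dOf _)
    | with_reducible exact IsJet.of_state (smoothSt_up2 smoothSt_emT _ _)
    | with_reducible exact IsJet.of_state (smoothSt_mix2 smoothSt_emT _ _)
    | with_reducible exact IsJet.of_point hR
    | with_reducible refine IsJet.add ?_ ?_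
    | with_reducible refine IsJet.sub ?_ ?_
    | with_reducible refine IsJet.mul ?_ ?_
    | with_reducible refine IsJet.pow ?_ _
    | with_reducible refine IsJet.sum fun _ => ?_

/-- The constant factor of the principal part in the equations of the reduced system. -/
def principalFactor : Comp → ℝ
  | .g _ _ => -(1 / 2)
  | _ => 1

lemma principalFactor_ne_zero (i : Comp) : principalFactor i ≠ 0 := by
  cases i <;> norm_num [principalFactor]

variable {F : Pt → Idx → ℝ}

/-- Common to all equations except the one for the metric; the factor 1⁻¹ is there to match the
inverse of `principalFactor` on those components. -/
lemma isJet_principal_add_sub {n : ℕ} (hU : IsOpen U) (hR : ContDiffOn ℝ ∞ R U)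
    (hF : ContDiffOn ℝ ∞ F U) (κ : (Fin n → Idx) → Comp) (a : Fin n → Idx)
    {rhs : (Pt → State) → Pt → ℝ} (h : IsJetUpTo U z rhs) :
    IsJetUpTo U z fun u x => principal u x (κ a)
      - 1⁻¹ * (blackBox (metric u) (LF u) R F (fun y a => u y (κ a)) x a - rhs u x) := by
  have := h.sub (IsJetUpTo.of_isJet (isJet_blackBox_sub hU hR hF κ a))
  refine (congrArg (IsJetUpTo U z) ?_).mp this
  funext u x; ring

/-- `D` and `S` occur only in the equations for L and d, so nothing is asked of them elsewhere. This
lets `z` be chosen separately for each component. -/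
lemma isJetUpTo_reducedEqs (hU : IsOpen U) (hR : ContDiffOn ℝ ∞ R U) (hF : ContDiffOn ℝ ∞ F U)
    (i : Comp) (hD : i ∈ LdRows → ∀ j, IsJetUpTo U z fun u x => D u x j)
    (hS : i ∈ LdRows → ∀ j, IsJetUpTo U z fun u x => S u x j) :
    IsJetUpTo U z fun u x => principal u x i
      - (principalFactor i)⁻¹ * reducedEqs u R F (D u) (S u) x i := by
  cases i with
  | g μ ν =>
    have h1 : IsJet U fun u x => 2 * (redRicci (metric u) F x μ ν + 1 / 2 * principal u x (.g μ ν))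
        - 2 * (2 * LF u x ![μ, ν] + 1 / 6 * R x * metric u x μ ν) :=
      ((IsJet.const 2).mul (isJet_redRicci_add hU hF μ ν)).sub ((IsJet.const 2).mul
        (((IsJet.const 2).mul (IsJet.of_state (smoothSt_LOf _))).add
          (((IsJet.const _).mul (IsJet.of_point hR)).mul (IsJet.metric_apply μ ν))))
    refine IsJetUpTo.of_isJet (h1.congr fun u _ x _ => ?_)
    simp only [principalFactor, reducedEqs]
    ring
  | Xi =>
    exact isJet_principal_add_sub hU hR hF (fun _ : Fin 0 → Idx => .Xi) ![]
      (IsJetUpTo.of_isJet (isJet_rhsXi hR))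
  | s =>
    exact isJet_principal_add_sub hU hR hF (fun _ : Fin 0 → Idx => .s) ![]
      (IsJetUpTo.of_isJet (isJet_rhsS hU hR))
  | L μ ν =>
    exact isJet_principal_add_sub hU hR hF (fun a : Fin 2 → Idx => .L (a 0) (a 1)) ![μ, ν]
      (isJetUpTo_rhsL hU hR (hD (Or.inl ⟨μ, ν, rfl⟩)) _)
  | d μ ν ρ σ =>
    exact isJet_principal_add_sub hU hR hF
      (fun a : Fin 4 → Idx => .d (a 0) (a 1) (a 2) (a 3)) ![μ, ν, ρ, σ]
      (isJetUpTo_rhsD hR (hD (Or.inr ⟨μ, ν, ρ, σ, rfl⟩)) (hS (Or.inr ⟨μ, ν, ρ, σ, rfl⟩)) _)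
  | phi =>
    exact isJet_principal_add_sub hU hR hF (fun _ : Fin 0 → Idx => .phi) ![]
      (IsJetUpTo.of_isJet (isJet_rhsPhi hR))
  | phi1 μ =>
    exact isJet_principal_add_sub hU hR hF (fun a : Fin 1 → Idx => .phi1 (a 0)) ![μ]
      (IsJetUpTo.of_isJet (isJet_rhsPhi1 hU hR _))
  | phi2 μ ν =>
    exact isJet_principal_add_sub hU hR hF (fun a : Fin 2 → Idx => .phi2 (a 0) (a 1))
      ![μ, ν] (IsJetUpTo.of_isJet (isJet_rhsPhi2 hU hR _))

theorem reducedSystem_isProperUpToHessian (hU : IsOpen U) (hR : ContDiffOn ℝ ∞ R U)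
    (hF : ContDiffOn ℝ ∞ F U) :
    IsProperQuasilinearUpToHessian LdRows U (reducedSystem R F) := by
  classical
  -- The switch is on exactly for the components of L and d, which makes the Hessian coefficients
  -- vanish in all other equations.
  have h1 : ∀ i, IsJetUpTo U (if i ∈ LdRows then 1 else 0) fun u x => principal u x i
      - (principalFactor i)⁻¹ * reducedSystem R F u x i := fun i => by
    refine isJetUpTo_reducedEqs hU hR hF i (fun hi => ?_) (fun hi => ?_)
    · simpa only [hi, if_true] using isJetUpTo_dCotton hU
    · simpa only [hi, if_true] using isJetUpTo_dDualCotton hU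
  choose A hA N hN h using h1
  refine ⟨principalFactor, fun q i => N i q,
    fun q i σ τ => (if i ∈ LdRows then 1 else 0) * A i q σ τ, principalFactor_ne_zero,
    contDiffOn_pi.2 hN, contDiffOn_pi.2 fun i => contDiffOn_matrix.2 fun σ τ =>
      contDiffOn_const.mul (contDiffOn_matrix.1 (hA i) σ τ), fun q i hi => ?_,
    fun u hu x hx i => ?_⟩
  · funext σ τ; simp [hi]
  · have h2 := h i u hu x hx
    have h3 : ∑ σ, ∑ τ, (if i ∈ LdRows then (1 : ℝ) else 0) * A i (x, u x, jet u x) σ τ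
          * pd σ (pd τ fun y => u y .Xi) x
        = (if i ∈ LdRows then (1 : ℝ) else 0)
          * ∑ σ, ∑ τ, A i (x, u x, jet u x) σ τ * ddXi u x σ τ := by
      simp only [Finset.mul_sum, mul_assoc]; rfl
    have hc := mul_inv_cancel₀ (principalFactor_ne_zero i)
    rw [h3]
    simp only [← h2]
    linear_combination (-reducedSystem R F u x i) * hc

theorem reducedSystemElim_isProper (hU : IsOpen U) (hR : ContDiffOn ℝ ∞ R U)
    (hF : ContDiffOn ℝ ∞ F U) :
    IsProperQuasilinearWaveSystem U (reducedSystemElim R F) := by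
  have h1 : ∀ i, IsJet U fun u x => principal u x i
      - (principalFactor i)⁻¹ * reducedSystemElim R F u x i := fun i =>
    (isJetUpTo_reducedEqs hU hR hF i
      (fun _ j => IsJetUpTo.of_isJet (isJet_dCottonElim hU j))
      (fun _ j => IsJetUpTo.of_isJet (isJet_dDualCottonElim hU j))).isJet
  choose N hN h using h1
  refine ⟨principalFactor, fun q i => N i q, principalFactor_ne_zero, contDiffOn_pi.2 hN,
    fun u hu x hx i => ?_⟩
  have hc := mul_inv_cancel₀ (principalFactor_ne_zero i)
  simp only [← h i u hu x hx]
  linear_combination (-reducedSystemElim R F u x i) * hc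

end

end ConfWave

theorem mainTheorem9 (U : Set ConfWave.Pt) (hU : IsOpen U) :
    (∀ (R : ConfWave.Pt → ℝ) (F : ConfWave.Pt → ConfWave.Idx → ℝ),
      ContDiffOn ℝ ∞ R U → ContDiffOn ℝ ∞ F U →
        ConfWave.IsProperQuasilinearUpToHessian ConfWave.LdRows U (ConfWave.reducedSystem R F) ∧
        ConfWave.IsProperQuasilinearWaveSystem U (ConfWave.reducedSystemElim R F)) ∧
    (∀ u : ConfWave.Pt → ConfWave.State,
      ConfWave.IsAdmissible U u → ConfWave.HasFieldSymmetries U u →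
      ConfWave.UnphysicalEinstein u U → ConfWave.SolvesScalarWaveEqs u U →
        ∀ x ∈ U,
          (∀ a, ConfWave.box (ConfWave.metric u) (ConfWave.Q1 u) x ![a]
            = ConfWave.rhsQ1 u (ConfWave.scalarCurv (ConfWave.metric u)) x ![a]) ∧
          (∀ a b, ConfWave.box (ConfWave.metric u) (ConfWave.Q2 u) x ![a, b]
            = ConfWave.rhsQ2 u (ConfWave.scalarCurv (ConfWave.metric u)) x ![a, b]
              + ConfWave.termP u x ![a, b])) :=
  ⟨fun _ _ hR hF => ⟨ConfWave.reducedSystem_isProperUpToHessian hU hR hF,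
      ConfWave.reducedSystemElim_isProper hU hR hF⟩,
    fun _ hu hs hE hw _ hx => ⟨fun a => ConfWave.box_Q1 hU hu hE hw hx a,
      fun a b => ConfWave.box_Q2 hU hu hs hE hw hx a b⟩⟩

end
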